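/- **Setting.** Let $g$ be a probability density on $\mathbf R$ satisfying: (A1) $g$ is real analytic on $\mathbf R$ and has a meromorphic continuation, again denoted $g$, to the upper half plane; (A2) for every $\gamma>0$ there is $C>0$ with $|g(\omega)|<Ce^{-\gamma|\omega|}$ for $\omega\in\mathbf R$; (A3) there is $\delta>0$ such that for every $\gamma>0$ there is $C>0$ with $|g(z)|<Ce^{-\gamma|z|}$ in the sectors $|\arg z|\le\delta$ and $|\arg z-\pi|\le\delta$ of the closed upper half plane. Let $$D(\lambda)=\int_{\mathbf R}\frac{g(\omega)}{\lambda-i\omega}\,d\omega ,\qquad K_c=\frac{2}{\pi\sup_j g(y_j)},$$ where $y_j$ runs over all real $y$ with $\lim_{x\to+0}\int_{\mathbf R}\frac{\omega-y}{x^2+(\omega-y)^2}g(\omega)\,d\omega=0$, and let $0<K\le K_c$. *Resonance poles* are the $\lambda$ with $\mathrm{Re}\,\lambda<0$ (with $-i\lambda$ not a pole of $g$) and $D(\lambda)+2\pi g(-i\lambda)=2/K$, and the $\lambda$ with $\mathrm{Re}\,\lambda=0$ at which the limit of $D$ from the right and that of $D+2\pi g(-i\,\cdot)$ from the left are equal to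 $2/K$. Put $G(\lambda)=1-\frac K2D(\lambda)-\pi Kg(-i\lambda)$ for $\mathrm{Re}\,\lambda<0$, continued analytically to $\mathrm{Re}\,\lambda\ge0$ by the boundary value from the right of $1-\frac K2D$ and by $1-\frac K2D$ itself. For $p>0$ let $F_p(\beta,n)$ ($\beta=0,1,\dots$; $n=1,2,\dots$) be the Banach space of functions $\phi$ continuous on $-1/n\le\mathrm{Im}\,z\le p+1/n$ and holomorphic in its interior with $\sup|\phi(z)|e^{-\beta|z|}<\infty$, and let $F_p=\bigcup_{\beta,n}F_p(\beta,n)$ with the inductive limit topology. Let $F_p'$ be the space of continuous linear functionals $\phi\mapsto\langle\phi\,|\,\mu\rangle$ on $F_p$, with scalar multiplication $\langle\phi\,|\,c\mu\rangle=\overline c\,\langle\phi\,|\,\mu\rangle$ and the weak dual topology; limits and integrals in $F_p'$ are taken in this topology, and integrals over a line are improper. On $F_p$ put $(T_1\phi)(z)=iz\,\phi(z)+\frac K2\int_{\mathbf R}\phi(\omega)g(\omega)\,d\omega$. For $\phi,\psi\in F_p$ define $$\langle\phi\,|\,\overline\psi\rangle=\int_{\mathbf R}\phi\psi g\,d\omega,\qquad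 \langle\phi\,|\,\mu(\lambda)\rangle=\int_{\mathbf R}\frac{\phi(\omega)g(\omega)}{\lambda-i\omega}d\omega+2\pi\phi(-i\lambda)g(-i\lambda)\quad(\mathrm{Re}\,\lambda<0),$$ $$\langle\phi\,|\,\mu(\lambda)\rangle=\lim_{x\to+0}\int_{\mathbf R}\frac{\phi(\omega)g(\omega)}{\lambda+x-i\omega}d\omega\quad(\mathrm{Re}\,\lambda=0),$$ $$\langle\phi\,|\,\overline\psi\cdot\mu(\lambda)\rangle=\int_{\mathbf R}\frac{\phi(\omega)\psi(\omega)g(\omega)}{\lambda-i\omega}d\omega+2\pi\phi(-i\lambda)\psi(-i\lambda)g(-i\lambda)\quad(\mathrm{Re}\,\lambda<0).$$ **Theorem.** Let $0<a\le p$. Assume that there are no resonance poles on the line $\mathrm{Re}\,\lambda=-a$, that $g$ has no poles on the line $\mathrm{Im}\,z=a$, and that all resonance poles in the strip $-a<\mathrm{Re}\,\lambda\le0$ are simple roots of $G$. Then $T_1$ generates a unique strongly continuous semigroup $e^{T_1t}$ ($t\ge0$) of continuous operators on $F_p$; the strip contains only finitely many resonance poles $\lambda_0,\dots,\lambda_n$;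 for $-p\le\mathrm{Re}\,\lambda\le0$ with $-i\lambda$ not a pole of $g$, and for all $\psi\in F_p$, the functionals $|\overline\psi\rangle$, $\mu(\lambda)$ and, if $\mathrm{Re}\,\lambda<0$, $\overline\psi\cdot\mu(\lambda)$ belong to $F_p'$. With $\mu_j=\mu(\lambda_j)$, $D_j=\lim_{\lambda\to\lambda_j}G(\lambda)/(\lambda-\lambda_j)$, and $(e^{T_1t})^\times$ the dual of $e^{T_1t}$, for every $\psi\in F_p$ and $t>0$ $$\begin{aligned}(e^{T_1t})^\times|\overline\psi\rangle&=\sum_{j=0}^n\frac{K}{2\overline{D_j}}e^{\overline{\lambda_j}t}\,\overline{\langle\psi\,|\,\mu_j\rangle}\,|\mu_j\rangle+\frac{e^{-at}}{2\pi}\int_{-\infty}^\infty e^{-iyt}\,|\overline\psi\cdot\mu(-a+iy)\rangle\,dy\\&\quad+\frac{Ke^{-at}}{4\pi}\int_{-\infty}^\infty e^{-iyt}\frac{\overline{\langle\psi\,|\,\mu(-a+iy)\rangle}}{\overline{G(-a+iy)}}\,|\mu(-a+iy)\rangle\,dy\\&=\sum_{j=0}^n\frac{K}{2\overline{D_j}}e^{\overline{\lambda_j}t}\,\overline{\langle\psi\,|\,\mu_j\rangle}\,|\mu_j\rangle+\frac1{2\pi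 i}\int_{-a-i\infty}^{-a+i\infty}e^{\overline\lambda t}\,|\overline\psi\cdot\mu(\lambda)\rangle\,d\lambda\\&\quad+\frac K{4\pi i}\int_{-a-i\infty}^{-a+i\infty}e^{\overline\lambda t}\frac{\overline{\langle\psi\,|\,\mu(\lambda)\rangle}}{\overline{G(\lambda)}}\,|\mu(\lambda)\rangle\,d\lambda ,\end{aligned}$$ where all integrals converge in $F_p'$. The two integrals over $y$ tend to $0$ in $F_p'$ as $t\to\infty$, so that the integral terms are $o(e^{-at})$. Moreover the limits below exist in $F_p'$ and $$|\overline\psi\rangle=\sum_{j=0}^n\frac{K}{2\overline{D_j}}\,\overline{\langle\psi\,|\,\mu_j\rangle}\,|\mu_j\rangle+\frac1{2\pi i}\lim_{t\to+0}\int_{-a-i\infty}^{-a+i\infty}e^{\overline\lambda t}\,|\overline\psi\cdot\mu(\lambda)\rangle\,d\lambda+\frac K{4\pi i}\lim_{t\to+0}\int_{-a-i\infty}^{-a+i\infty}e^{\overline\lambda t}\frac{\overline{\langle\psi\,|\,\mu(\lambda)\rangle}}{\overline{G(\lambda)}}\,|\mu(\lambda)\rangle\,d\lambda .$$ -/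

import Mathlib

open MeasureTheory Filter Topology Complex
open scoped NNReal ComplexConjugate

namespace Kuramoto

noncomputable section

/-! ### The density of natural frequencies -/

/-- `g` is a probability density on the real line. -/
def IsProbabilityDensity (g : ℝ → ℝ) : Prop :=
  (∀ ω, 0 ≤ g ω) ∧ Integrable g ∧ ∫ ω, g ω = 1

/-- `g` is real analytic on the line and `gc` is its meromorphic continuation to the upper half
plane. Normal form fixes the otherwise arbitrary values of a meromorphic function: `gc` takes its
true value wherever it is analytic, and the value `0` at its poles. Hence `gc` is unique on the
closed upper half plane, and the poles of `gc` are exactly its points of non-analyticity there. -/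
def HasMeromorphicContinuation (g : ℝ → ℝ) (gc : ℂ → ℂ) : Prop :=
  (∀ x : ℝ, AnalyticAt ℝ g x) ∧
  MeromorphicNFOn gc {z : ℂ | 0 ≤ z.im} ∧
  ∀ x : ℝ, AnalyticAt ℂ gc (x : ℂ) ∧ gc (x : ℂ) = ((g x : ℝ) : ℂ)

/-- On the real line `g` decays faster than every exponential. -/
def DecaysSuperexponentially (g : ℝ → ℝ) : Prop :=
  ∀ γ : ℝ, 0 < γ → ∃ C : ℝ, 0 < C ∧ ∀ ω : ℝ, |g ω| < C * Real.exp (-γ * |ω|)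

/-- The same decay for the continuation, in two closed sectors of the closed upper half plane
around the two real half lines. -/
def DecaysInSectors (gc : ℂ → ℂ) : Prop :=
  ∃ δ : ℝ, 0 < δ ∧ ∀ γ : ℝ, 0 < γ → ∃ C : ℝ, 0 < C ∧ ∀ z : ℂ, 0 ≤ z.im →
    (|arg z| ≤ δ ∨ |arg z - Real.pi| ≤ δ) → ‖gc z‖ < C * Real.exp (-γ * ‖z‖)

/-! ### The critical coupling, the dispersion function and the resonance poles -/

/-- `D(λ) = ∫ g(ω) / (λ - iω) dω`. -/
def D (g : ℝ → ℝ) (lam : ℂ) : ℂ := ∫ ω : ℝ, (g ω : ℂ) / (lam - I * ω)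

/-- The frequencies `y` with `lim_{x → +0} ∫ (ω - y) / (x² + (ω - y)²) g(ω) dω = 0`. -/
def criticalFrequencies (g : ℝ → ℝ) : Set ℝ :=
  {y | Tendsto (fun x : ℝ => ∫ ω : ℝ, (ω - y) / (x ^ 2 + (ω - y) ^ 2) * g ω) (𝓝[>] 0) (𝓝 0)}

/-- `K_c = 2 / (π sup_j g(y_j))`, over all critical frequencies `y_j`. -/
def criticalCoupling (g : ℝ → ℝ) : ℝ :=
  2 / (Real.pi * sSup (g '' criticalFrequencies g))

/-- The continuation of `D` from the right half plane across the imaginary axis: on the axis it is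
the boundary value from the right. -/
def Dcont (g : ℝ → ℝ) (gc : ℂ → ℂ) (lam : ℂ) : ℂ :=
  if 0 < lam.re then D g lam
  else if lam.re < 0 then D g lam + 2 * Real.pi * gc (-I * lam)
  else limUnder (𝓝[>] (0 : ℝ)) (fun x : ℝ => D g (lam + x))

/-- `G(λ) = 1 - (K/2) D(λ) - π K g(-iλ)` for `Re λ < 0`, and its continuation elsewhere. -/
def G (K : ℝ) (g : ℝ → ℝ) (gc : ℂ → ℂ) (lam : ℂ) : ℂ := 1 - (K / 2 : ℂ) * Dcont g gc lam

/-- Resonance poles: `D(λ) + 2π g(-iλ) = 2/K` in the open left half plane (where `g` has no pole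
at `-iλ`), and on the imaginary axis the common limit of `D` from the right and of
`D + 2π g(-i·)` from the left equals `2/K`. -/
def IsResonancePole (K : ℝ) (g : ℝ → ℝ) (gc : ℂ → ℂ) (lam : ℂ) : Prop :=
  (lam.re < 0 ∧ AnalyticAt ℂ gc (-I * lam) ∧
    D g lam + 2 * Real.pi * gc (-I * lam) = 2 / K) ∨
  (lam.re = 0 ∧
    Tendsto (fun x : ℝ => D g (lam + x)) (𝓝[>] 0) (𝓝 (2 / K)) ∧
    Tendsto (fun x : ℝ => D g (lam + x) + 2 * Real.pi * gc (-I * (lam + x)))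
      (𝓝[<] 0) (𝓝 (2 / K)))

/-- The resonance poles in the strip `-a < Re λ ≤ 0`. -/
def resonancePoles (K : ℝ) (g : ℝ → ℝ) (gc : ℂ → ℂ) (a : ℝ) : Set ℂ :=
  {lam | IsResonancePole K g gc lam ∧ -a < lam.re ∧ lam.re ≤ 0}

/-- `lam₀` is a simple root of `G`. -/
def IsSimpleRoot (K : ℝ) (g : ℝ → ℝ) (gc : ℂ → ℂ) (lam₀ : ℂ) : Prop :=
  ∃ d : ℂ, d ≠ 0 ∧ Tendsto (fun lam => (lam - lam₀)⁻¹ * G K g gc lam) (𝓝[≠] lam₀) (𝓝 d)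

/-- `D_j = lim_{λ → λ_j} G(λ) / (λ - λ_j)`. -/
def residueConst (K : ℝ) (g : ℝ → ℝ) (gc : ℂ → ℂ) (lam₀ : ℂ) : ℂ :=
  limUnder (𝓝[≠] lam₀) (fun lam => (lam - lam₀)⁻¹ * G K g gc lam)

/-! ### The test function space `F_p` -/

/-- The closed strip `-ε ≤ Im z ≤ p + ε`. -/
def strip (p ε : ℝ) : Set ℂ := {z | -ε ≤ z.im ∧ z.im ≤ p + ε}

/-- The open strip `-ε < Im z < p + ε`. -/
def openStrip (p ε : ℝ) : Set ℂ := {z | -ε < z.im ∧ z.im < p + ε}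

/-- The underlying vector space of the Banach space `F_p(β, n + 1)` of functions that are continuous on the closed strip
`-1/(n+1) ≤ Im z ≤ p + 1/(n+1)`, holomorphic in its interior, and of growth `O(exp(β|z|))` there.
An element is stored as a function on `ℂ` that vanishes off the strip. -/
def stepSubmodule (p : ℝ) (β n : ℕ) : Submodule ℂ (ℂ → ℂ) where
  carrier := {f | (∀ z ∉ strip p (1 / (n + 1)), f z = 0) ∧
    ContinuousOn f (strip p (1 / (n + 1))) ∧
    DifferentiableOn ℂ f (openStrip p (1 / (n + 1))) ∧
    ∃ C : ℝ, ∀ z, ‖f z‖ ≤ C * Real.exp (β * ‖z‖)}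
  zero_mem' := ⟨fun _ _ => rfl, continuousOn_const, differentiableOn_const 0, 0, fun z => by simp⟩
  add_mem' := by
    rintro f h ⟨f0, fc, fd, A, hA⟩ ⟨h0, hc, hd, B, hB⟩
    refine ⟨fun z hz => by simp [f0 z hz, h0 z hz], fc.add hc, fd.add hd, A + B, fun z => ?_⟩
    rw [add_mul]
    exact (norm_add_le _ _).trans (add_le_add (hA z) (hB z))
  smul_mem' := by
    rintro c f ⟨f0, fc, fd, A, hA⟩
    refine ⟨fun z hz => by simp [f0 z hz], fc.const_smul c, fd.const_smul c, ‖c‖ * A, fun z => ?_⟩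
    rw [Pi.smul_apply, norm_smul, mul_assoc]
    exact mul_le_mul_of_nonneg_left (hA z) (norm_nonneg c)

/-- The Banach space `F_p(β, n + 1)`, with the norm below. -/
def FpStep (p : ℝ) (β n : ℕ) : Type := stepSubmodule p β n

instance (p : ℝ) (β n : ℕ) : AddCommGroup (FpStep p β n) :=
  inferInstanceAs (AddCommGroup (stepSubmodule p β n))

instance (p : ℝ) (β n : ℕ) : Module ℂ (FpStep p β n) :=
  inferInstanceAs (Module ℂ (stepSubmodule p β n))

instance (p : ℝ) (β n : ℕ) : CoeFun (FpStep p β n) (fun _ => ℂ → ℂ) := ⟨Subtype.val⟩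

/-- `‖φ‖_{β,n} = sup |φ(z)| exp(-β|z|)` over the strip (off the strip `φ` is zero). -/
instance (p : ℝ) (β n : ℕ) : Norm (FpStep p β n) :=
  ⟨fun f => ⨆ z : ℂ, ‖f z‖ * Real.exp (-(β * ‖z‖))⟩

theorem FpStep.norm_def {p : ℝ} {β n : ℕ} (f : FpStep p β n) :
    ‖f‖ = ⨆ z : ℂ, ‖f z‖ * Real.exp (-(β * ‖z‖)) := rfl

theorem FpStep.bddAbove {p : ℝ} {β n : ℕ} (f : FpStep p β n) :
    BddAbove (Set.range fun z : ℂ => ‖f z‖ * Real.exp (-(β * ‖z‖))) := by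
  obtain ⟨-, -, -, C, hC⟩ := f.2
  refine ⟨C, ?_⟩
  rintro _ ⟨z, rfl⟩
  calc ‖f z‖ * Real.exp (-(β * ‖z‖))
      ≤ C * Real.exp (β * ‖z‖) * Real.exp (-(β * ‖z‖)) :=
        mul_le_mul_of_nonneg_right (hC z) (Real.exp_pos _).le
    _ = C := by rw [mul_assoc, ← Real.exp_add]; simp

theorem FpStep.normCore (p : ℝ) (β n : ℕ) : NormedSpace.Core ℂ (FpStep p β n) where
  norm_nonneg f := Real.iSup_nonneg fun z => by positivity
  norm_smul c f := by
    rw [FpStep.norm_def, FpStep.norm_def, Real.mul_iSup_of_nonneg (norm_nonneg c)]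
    refine iSup_congr fun z => ?_
    have h : (c • f : FpStep p β n) z = c * f z := rfl
    rw [h, norm_mul, mul_assoc]
  norm_triangle f h := by
    rw [FpStep.norm_def (f + h)]
    refine ciSup_le fun z => ?_
    have h1 := le_ciSup (FpStep.bddAbove f) z
    have h2 := le_ciSup (FpStep.bddAbove h) z
    rw [← FpStep.norm_def] at h1 h2
    refine le_trans ?_ (add_le_add h1 h2)
    rw [← add_mul]
    exact mul_le_mul_of_nonneg_right (norm_add_le (f z) (h z)) (Real.exp_pos _).le
  norm_eq_zero_iff f := by
    constructor
    · intro hf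
      refine Subtype.ext (funext fun z => ?_)
      have h1 := le_ciSup (FpStep.bddAbove f) z
      rw [← FpStep.norm_def, hf] at h1
      have h2 : ‖f z‖ ≤ 0 := by
        by_contra hcon
        exact absurd h1 (not_le.mpr (mul_pos (not_le.mp hcon) (Real.exp_pos _)))
      exact norm_le_zero_iff.mp h2
    · rintro rfl
      have h : ∀ z, (0 : FpStep p β n) z = 0 := fun _ => rfl
      simp [FpStep.norm_def, h]

instance (p : ℝ) (β n : ℕ) : NormedAddCommGroup (FpStep p β n) :=
  NormedAddCommGroup.ofCore (FpStep.normCore p β n)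

theorem strip_mono {p ε ε' : ℝ} (h : ε ≤ ε') : strip p ε ⊆ strip p ε' :=
  fun _ hz => ⟨by linarith [hz.1], by linarith [hz.2]⟩

theorem openStrip_mono {p ε ε' : ℝ} (h : ε ≤ ε') : openStrip p ε ⊆ openStrip p ε' :=
  fun _ hz => ⟨by linarith [hz.1], by linarith [hz.2]⟩

/-- Elements of `F_p`: restrictions to the closed strip `0 ≤ Im z ≤ p` (extended by zero) of
functions holomorphic and of exponential growth on some larger strip. By the identity theorem the
restriction determines the holomorphic function, so this is the union of the `F_p(β, n)`. -/
def MemFp (p : ℝ) (φ : ℂ → ℂ) : Prop :=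
  (∀ z ∉ strip p 0, φ z = 0) ∧
  ∃ (n : ℕ) (β : ℕ) (C : ℝ) (f : ℂ → ℂ),
    ContinuousOn f (strip p (1 / (n + 1))) ∧
    DifferentiableOn ℂ f (openStrip p (1 / (n + 1))) ∧
    (∀ z ∈ strip p (1 / (n + 1)), ‖f z‖ ≤ C * Real.exp (β * ‖z‖)) ∧
    ∀ z ∈ strip p 0, φ z = f z

theorem strip_zero_subset (p : ℝ) (n : ℕ) : strip p 0 ⊆ strip p (1 / (n + 1)) :=
  strip_mono (by positivity)

/-- The underlying vector space of `F_p = ⋃ F_p(β, n)`. -/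
def fpSubmodule (p : ℝ) : Submodule ℂ (ℂ → ℂ) where
  carrier := {φ | MemFp p φ}
  zero_mem' := ⟨fun _ _ => rfl, 0, 0, 0, 0, continuousOn_const, differentiableOn_const 0,
    fun z _ => by simp, fun _ _ => rfl⟩
  add_mem' := by
    rintro φ ψ ⟨φ0, n, β, A, f, fc, fd, hA, hf⟩ ⟨ψ0, m, γ, B, h, hc, hd, hB, hh⟩
    have hn : (1 : ℝ) / ((max n m : ℕ) + 1) ≤ 1 / (n + 1) := by
      gcongr
      exact le_max_left _ _
    have hm : (1 : ℝ) / ((max n m : ℕ) + 1) ≤ 1 / (m + 1) := by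
      gcongr
      exact le_max_right _ _
    refine ⟨fun z hz => by simp [φ0 z hz, ψ0 z hz], max n m, max β γ, |A| + |B|, f + h,
      (fc.mono (strip_mono hn)).add (hc.mono (strip_mono hm)),
      (fd.mono (openStrip_mono hn)).add (hd.mono (openStrip_mono hm)), fun z hz => ?_,
      fun z hz => by simp [hf z hz, hh z hz]⟩
    have e1 : A * Real.exp (β * ‖z‖) ≤ |A| * Real.exp ((max β γ : ℕ) * ‖z‖) := by
      gcongr
      · exact le_abs_self A
      · exact le_max_left _ _
    have e2 : B * Real.exp (γ * ‖z‖) ≤ |B| * Real.exp ((max β γ : ℕ) * ‖z‖) := by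
      gcongr
      · exact le_abs_self B
      · exact le_max_right _ _
    rw [add_mul]
    exact (norm_add_le _ _).trans (add_le_add ((hA z (strip_mono hn hz)).trans e1)
      ((hB z (strip_mono hm hz)).trans e2))
  smul_mem' := by
    rintro c φ ⟨φ0, n, β, A, f, fc, fd, hA, hf⟩
    refine ⟨fun z hz => by simp [φ0 z hz], n, β, ‖c‖ * A, c • f, fc.const_smul c,
      fd.const_smul c, fun z hz => ?_, fun z hz => by simp [hf z hz]⟩
    rw [Pi.smul_apply, norm_smul, mul_assoc]
    exact mul_le_mul_of_nonneg_left (hA z hz) (norm_nonneg c)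

/-- The space `F_p = ⋃ F_p(β, n)`, with the inductive limit topology below. -/
def Fp (p : ℝ) : Type := fpSubmodule p

instance (p : ℝ) : AddCommGroup (Fp p) := inferInstanceAs (AddCommGroup (fpSubmodule p))

instance (p : ℝ) : Module ℂ (Fp p) := inferInstanceAs (Module ℂ (fpSubmodule p))

instance (p : ℝ) : CoeFun (Fp p) (fun _ => ℂ → ℂ) := ⟨Subtype.val⟩

/-- The natural map `F_p(β, n) → F_p` (restriction to the closed strip `0 ≤ Im z ≤ p`). -/
def Fp.ofStep (p : ℝ) (β n : ℕ) (f : FpStep p β n) : Fp p :=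
  ⟨(strip p 0).indicator f, fun z hz => by simp [hz], n, β,
    f.2.2.2.2.choose, f, f.2.2.1, f.2.2.2.1, fun z _ => f.2.2.2.2.choose_spec z,
    fun z hz => by simp [hz]⟩

/-- The inductive limit topology: `U` is open iff its preimage in every Banach space `F_p(β, n)`
is open. -/
instance (p : ℝ) : TopologicalSpace (Fp p) :=
  ⨆ (β : ℕ) (n : ℕ), TopologicalSpace.coinduced (Fp.ofStep p β n) inferInstance

/-! ### The dual space `F_p'` -/

/-- `F_p'`, the space of continuous linear functionals on `F_p`; see the scalar multiplication
below. -/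
def FpDual (p : ℝ) : Type := Fp p →L[ℂ] ℂ

/-- The pairing `⟨φ | μ⟩`. -/
def pair {p : ℝ} (φ : Fp p) (μ : FpDual p) : ℂ :=
  (show Fp p →L[ℂ] ℂ from μ) φ

instance (p : ℝ) : AddCommGroup (FpDual p) :=
  inferInstanceAs (AddCommGroup (Fp p →L[ℂ] ℂ))

/-- Scalars act on `F_p'` through conjugation: `⟨φ | c μ⟩ = conj(c) ⟨φ | μ⟩`. -/
instance (p : ℝ) : Module ℂ (FpDual p) :=
  Module.compHom (Fp p →L[ℂ] ℂ) (starRingEnd ℂ)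

theorem pair_add {p : ℝ} (φ : Fp p) (μ ν : FpDual p) : pair φ (μ + ν) = pair φ μ + pair φ ν := rfl

theorem pair_smul {p : ℝ} (φ : Fp p) (c : ℂ) (μ : FpDual p) :
    pair φ (c • μ) = conj c * pair φ μ := rfl

/-- The weak dual topology. -/
instance (p : ℝ) : TopologicalSpace (FpDual p) :=
  TopologicalSpace.induced (fun (μ : FpDual p) (φ : Fp p) => pair φ μ) Pi.topologicalSpace

/-- The dual operator: `⟨φ | A^× μ⟩ = ⟨A φ | μ⟩`. -/
def dualOp {p : ℝ} (A : Fp p →L[ℂ] Fp p) (μ : FpDual p) : FpDual p :=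
  ContinuousLinearMap.comp (show Fp p →L[ℂ] ℂ from μ) A

theorem pair_dualOp {p : ℝ} (A : Fp p →L[ℂ] Fp p) (φ : Fp p) (μ : FpDual p) :
    pair φ (dualOp A μ) = pair (A φ) μ := rfl

/-! ### The operator `T₁` and its semigroup on `F_p` -/

theorem MemFp.mul_id_add_const {p : ℝ} {φ : ℂ → ℂ} (hφ : MemFp p φ) (c : ℂ) :
    MemFp p ((strip p 0).indicator fun z => I * z * φ z + c) := by
  obtain ⟨-, n, β, A, f, fc, fd, hA, hf⟩ := hφ
  refine ⟨fun z hz => by simp [hz], n, β + 1, |A| + ‖c‖, fun z => I * z * f z + c,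
    (((continuousOn_const.mul continuousOn_id).mul fc).add continuousOn_const),
    ((((differentiableOn_const I).mul differentiableOn_id).mul fd).add
      (differentiableOn_const c)), fun z hz => ?_, fun z hz => by simp [hz, hf z hz]⟩
  have h1 : ‖z‖ ≤ Real.exp ‖z‖ := by linarith [Real.add_one_le_exp ‖z‖]
  have h2 : ‖f z‖ ≤ |A| * Real.exp (β * ‖z‖) :=
    (hA z hz).trans (mul_le_mul_of_nonneg_right (le_abs_self A) (Real.exp_pos _).le)
  have h3 : (1 : ℝ) ≤ Real.exp (((β + 1 : ℕ) : ℝ) * ‖z‖) := Real.one_le_exp (by positivity)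
  have h4 : Real.exp ‖z‖ * Real.exp (β * ‖z‖) = Real.exp (((β + 1 : ℕ) : ℝ) * ‖z‖) := by
    rw [← Real.exp_add]; congr 1; push_cast; ring
  calc ‖I * z * f z + c‖ ≤ ‖z‖ * ‖f z‖ + ‖c‖ := by
        refine (norm_add_le _ _).trans ?_
        simp
    _ ≤ Real.exp ‖z‖ * (|A| * Real.exp (β * ‖z‖)) + ‖c‖ * Real.exp (((β + 1 : ℕ) : ℝ) * ‖z‖) :=
        add_le_add (mul_le_mul h1 h2 (norm_nonneg _) (Real.exp_pos _).le)
          (le_mul_of_one_le_right (norm_nonneg c) h3)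
    _ = (|A| + ‖c‖) * Real.exp (((β + 1 : ℕ) : ℝ) * ‖z‖) := by rw [← h4]; ring

/-- `(T₁ φ)(z) = i z φ(z) + (K/2) ∫ φ(ω) g(ω) dω` on `F_p`. -/
def T1 (K : ℝ) (g : ℝ → ℝ) (p : ℝ) (φ : Fp p) : Fp p :=
  ⟨(strip p 0).indicator fun z => I * z * φ z + (K / 2 : ℂ) * ∫ ω : ℝ, φ ω * g ω,
    MemFp.mul_id_add_const φ.2 _⟩

/-- `S` is a strongly continuous semigroup of continuous linear operators on `F_p` whose generator
is the everywhere defined operator `A`. -/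
structure IsSemigroupGeneratedBy {p : ℝ} (A : Fp p → Fp p) (S : ℝ≥0 → Fp p →L[ℂ] Fp p) :
    Prop where
  map_zero : ∀ φ, S 0 φ = φ
  map_add : ∀ s t φ, S (s + t) φ = S s (S t φ)
  continuous : ∀ φ, Continuous fun t => S t φ
  generator : ∀ φ, Tendsto (fun h : ℝ≥0 => ((h : ℝ) : ℂ)⁻¹ • (S h φ - φ)) (𝓝[>] 0) (𝓝 (A φ))

/-! ### The functionals in the decomposition -/

/-- `μ` is the functional `i(ψ)`: `⟨φ | i(ψ)⟩ = ∫ φ(ω) ψ(ω) g(ω) dω`. -/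
def IsCanonicalImage {p : ℝ} (g : ℝ → ℝ) (ψ : Fp p) (μ : FpDual p) : Prop :=
  ∀ φ : Fp p, pair φ μ = ∫ ω : ℝ, φ ω * ψ ω * g ω

/-- `μ` is the functional `μ(λ)`, for `Re λ < 0` or `Re λ = 0`. -/
def IsMu {p : ℝ} (g : ℝ → ℝ) (gc : ℂ → ℂ) (lam : ℂ) (μ : FpDual p) : Prop :=
  (lam.re < 0 → ∀ φ : Fp p, pair φ μ =
    (∫ ω : ℝ, φ ω * g ω / (lam - I * ω)) +
      2 * Real.pi * φ (-I * lam) * gc (-I * lam)) ∧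
  (lam.re = 0 → ∀ φ : Fp p, Tendsto
    (fun x : ℝ => ∫ ω : ℝ, φ ω * g ω / ((lam + x) - I * ω)) (𝓝[>] 0) (𝓝 (pair φ μ)))

/-- `ν` is the product functional `ψ̄ · μ(λ)`, for `Re λ < 0`. -/
def IsPsiMu {p : ℝ} (g : ℝ → ℝ) (gc : ℂ → ℂ) (ψ : Fp p) (lam : ℂ) (ν : FpDual p) : Prop :=
  ∀ φ : Fp p, pair φ ν =
    (∫ ω : ℝ, φ ω * ψ ω * g ω / (lam - I * ω)) +
      2 * Real.pi * φ (-I * lam) * ψ (-I * lam) * gc (-I * lam)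

/-- `ξ = ∫_{-∞}^{∞} f(y) dy` in `F_p'`, as an improper integral that converges in the weak dual
topology, with the two endpoints going to infinity independently of each other. -/
def HasWeakIntegral {p : ℝ} (f : ℝ → FpDual p) (ξ : FpDual p) : Prop :=
  ∀ φ : Fp p, (∀ r s : ℝ, IntervalIntegrable (fun y => pair φ (f y)) volume r s) ∧
    Tendsto (fun r : ℝ × ℝ => ∫ y in r.1..r.2, pair φ (f y)) (atBot ×ˢ atTop) (𝓝 (pair φ ξ))

/-- `ξ = ∫_{-a-i∞}^{-a+i∞} f(λ) dλ` in `F_p'`, with `λ = -a + iy` and `dλ = i dy`. -/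
def HasLineIntegral {p : ℝ} (a : ℝ) (f : ℂ → FpDual p) (ξ : FpDual p) : Prop :=
  HasWeakIntegral (fun y : ℝ => I • f (-a + I * y)) ξ

end

end Kuramoto

namespace Kuramoto

/-! ### Fourier inversion and the Laplace kernel -/

/-- Fourier inversion in the normalisation `∫ exp(-iys) f(s) ds`. -/
theorem integral_exp_mul_eq_of_fourier {f Φ : ℝ → ℂ} (hc : Continuous f) (hf : Integrable f)
    (hΦ : ∀ y : ℝ, ∫ s : ℝ, Complex.exp (-(I * y * s)) * f s = Φ y) (hΦi : Integrable Φ) (t : ℝ) :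
    ∫ y : ℝ, Complex.exp (I * y * t) * Φ y = 2 * Real.pi * f t := by
  have hF : FourierTransform.fourier f = fun v : ℝ => Φ (2 * Real.pi * v) := by
    ext v
    rw [Real.fourier_real_eq_integral_exp_smul, ← hΦ]
    refine integral_congr_ae (Eventually.of_forall fun s => ?_)
    simp only [smul_eq_mul]
    congr 2
    push_cast
    ring
  have hFi : Integrable (FourierTransform.fourier f) := by
    rw [hF]
    exact hΦi.comp_mul_left' (by positivity)
  have h := congrFun (hc.fourierInv_fourier_eq hf hFi) t
  rw [Real.fourierInv_eq'] at h
  rw [hF] at h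
  have h2 := MeasureTheory.Measure.integral_comp_mul_left
    (fun y : ℝ => Complex.exp (I * y * t) * Φ y) (2 * Real.pi)
  have h3 : (∫ v : ℝ, Complex.exp (↑(2 * Real.pi * inner ℝ v t) * I) • Φ (2 * Real.pi * v))
      = ∫ v : ℝ, Complex.exp (I * ((2 * Real.pi * v : ℝ) : ℂ) * t) * Φ (2 * Real.pi * v) := by
    refine integral_congr_ae (Eventually.of_forall fun s => ?_)
    simp only [smul_eq_mul, RCLike.inner_apply, conj_trivial]
    congr 2
    push_cast
    ring
  rw [h3, h2] at h
  rw [← h, abs_of_pos (by positivity), Complex.real_smul]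
  push_cast
  rw [← mul_assoc, mul_inv_cancel₀ (by simp [Real.pi_ne_zero]), one_mul]

theorem integral_Ioi_mul_exp_neg {z : ℂ} (hz : 0 < z.re) :
    IntegrableOn (fun s : ℝ => (s : ℂ) * Complex.exp (-(z * s))) (Set.Ioi 0) ∧
    ∫ s in Set.Ioi (0 : ℝ), (s : ℂ) * Complex.exp (-(z * s)) = 1 / z ^ 2 := by
  have hz0 : z ≠ 0 := fun h => by simp [h] at hz
  have hnorm : ∀ s : ℝ, ‖Complex.exp (-(z * s))‖ = Real.exp (-(z.re * s)) := fun s => by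
    rw [Complex.norm_exp]; simp
  have hint : IntegrableOn (fun s : ℝ => (s : ℂ) * Complex.exp (-(z * s))) (Set.Ioi 0) := by
    have h1 : IntegrableOn (fun s : ℝ => s ^ (1 : ℝ) * Real.exp (-z.re * s)) (Set.Ioi 0) :=
      by simpa using integrableOn_rpow_mul_exp_neg_mul_rpow (p := 1) (s := 1) (b := z.re)
          (by norm_num) (by norm_num) hz
    refine Integrable.mono' h1 (by fun_prop) ?_
    filter_upwards [ae_restrict_mem measurableSet_Ioi] with s hs
    rw [norm_mul, hnorm, Complex.norm_real, Real.norm_of_nonneg (le_of_lt hs), Real.rpow_one,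
      neg_mul]
  refine ⟨hint, ?_⟩
  have hd : ∀ s ∈ Set.Ici (0 : ℝ), HasDerivAt
      (fun s : ℝ => -((s : ℂ) / z + 1 / z ^ 2) * Complex.exp (-(z * s)))
      ((s : ℂ) * Complex.exp (-(z * s))) s := by
    intro s _
    have h1 : HasDerivAt (fun w : ℂ => -(w / z + 1 / z ^ 2) * Complex.exp (-(z * w)))
      ((s : ℂ) * Complex.exp (-(z * s))) (s : ℂ) := by
      have ha : HasDerivAt (fun w : ℂ => -(w / z + 1 / z ^ 2)) (-(1 / z)) (s : ℂ) :=
        (((hasDerivAt_id _).div_const z).add_const _).neg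
      have hb : HasDerivAt (fun w : ℂ => Complex.exp (-(z * w)))
        (Complex.exp (-(z * s)) * (-(z * 1))) (s : ℂ) :=
        (((hasDerivAt_id _).const_mul z).neg).cexp
      refine (ha.mul hb).congr_deriv ?_
      linear_combination ((s : ℂ) + z⁻¹) * Complex.exp (-(z * s)) * mul_inv_cancel₀ hz0
    exact h1.comp_ofReal
  have hlim : Tendsto (fun s : ℝ => -((s : ℂ) / z + 1 / z ^ 2) * Complex.exp (-(z * s)))
      atTop (𝓝 0) := by
    have e1 : Tendsto (fun s : ℝ => s * Real.exp (-(z.re * s))) atTop (𝓝 0) := by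
      simpa using tendsto_rpow_mul_exp_neg_mul_atTop_nhds_zero 1 z.re hz
    have e0 : Tendsto (fun s : ℝ => Real.exp (-(z.re * s))) atTop (𝓝 0) := by
      simpa using tendsto_rpow_mul_exp_neg_mul_atTop_nhds_zero 0 z.re hz
    have e2 : Tendsto (fun s : ℝ => ‖1 / z‖ * (s * Real.exp (-(z.re * s))) +
        ‖1 / z ^ 2‖ * Real.exp (-(z.re * s))) atTop (𝓝 0) := by
      simpa only [mul_zero, add_zero] using (e1.const_mul ‖1 / z‖).add (e0.const_mul ‖1 / z ^ 2‖)
    refine squeeze_zero_norm' ?_ e2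
    filter_upwards [eventually_ge_atTop 0] with s hs
    rw [norm_mul, hnorm, norm_neg]
    have : ‖(s : ℂ) / z + 1 / z ^ 2‖ ≤ ‖1 / z‖ * s + ‖1 / z ^ 2‖ := by
      refine (norm_add_le _ _).trans (add_le_add (le_of_eq ?_) le_rfl)
      rw [div_eq_mul_one_div, norm_mul, Complex.norm_real, Real.norm_of_nonneg hs, mul_comm]
    calc _ ≤ (‖1 / z‖ * s + ‖1 / z ^ 2‖) * Real.exp (-(z.re * s)) := by gcongr
      _ = _ := by ring
  rw [integral_Ioi_of_hasDerivAt_of_tendsto' hd hint hlim]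
  simp

theorem norm_line_ge (c y : ℝ) : |c| ≤ ‖(c + I * y : ℂ)‖ := by
  simpa using Complex.abs_re_le_norm (c + I * y : ℂ)

theorem line_ne_zero {c : ℝ} (hc : c ≠ 0) (y : ℝ) : (c + I * y : ℂ) ≠ 0 := fun h => by
  have := norm_line_ge c y
  rw [h, norm_zero] at this
  exact hc (abs_nonpos_iff.mp this)

theorem norm_line_sq (c y : ℝ) : ‖(c + I * y : ℂ)‖ ^ 2 = c ^ 2 + y ^ 2 := by
  rw [← Complex.normSq_eq_norm_sq, Complex.normSq_apply]; simp; ring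

theorem integrable_inv_const_add_sq {c : ℝ} (hc : c ≠ 0) :
    Integrable fun y : ℝ => 1 / (c ^ 2 + y ^ 2) := by
  have h := (integrable_inv_one_add_sq.comp_mul_left' (inv_ne_zero hc)).const_mul (1 / c ^ 2)
  refine h.congr (Eventually.of_forall fun y => ?_)
  have : c ^ 2 + y ^ 2 ≠ 0 := by positivity
  have : 1 + (c⁻¹ * y) ^ 2 ≠ 0 := by positivity
  simp only
  field_simp

theorem integrable_inv_line_sq {c : ℝ} (hc : c ≠ 0) :
    Integrable fun y : ℝ => 1 / (c + I * y : ℂ) ^ 2 := by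
  refine Integrable.mono' (integrable_inv_const_add_sq hc) ?_ ?_
  · refine Continuous.aestronglyMeasurable ?_
    exact continuous_const.div (by fun_prop) fun y => pow_ne_zero _ (line_ne_zero hc y)
  · filter_upwards with y
    rw [norm_div, norm_pow, norm_line_sq, norm_one]

/-- The value of the inverse Laplace transform of `1/λ²`. -/
theorem integral_exp_div_line_sq {c : ℝ} (hc : c ≠ 0) {t : ℝ} (ht : 0 < t) :
    ∫ y : ℝ, Complex.exp (I * y * t) * (1 / (c + I * y : ℂ) ^ 2) =
      if 0 < c then 2 * Real.pi * (t * Complex.exp (-(c * t))) else 0 := by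
  rcases lt_or_gt_of_ne hc with hc | hc
  · rw [if_neg (not_lt.mpr hc.le)]
    have hz : ∀ y : ℝ, 0 < (-(c + I * y) : ℂ).re := fun y => by simpa using hc
    have key : ∀ y : ℝ, ∀ s : ℝ, Complex.exp (-(I * y * s)) *
          (((max (-s) 0 : ℝ) : ℂ) * Complex.exp (-(c * s))) =
        (Set.Iio (0 : ℝ)).indicator (fun s : ℝ => (fun u : ℝ => (u : ℂ) *
          Complex.exp (-(-(c + I * y) * u))) (-s)) s := by
      intro y s
      by_cases hs : s < 0
      · rw [Set.indicator_of_mem (Set.mem_Iio.mpr hs), max_eq_left (by linarith), mul_left_comm,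
          ← Complex.exp_add]
        push_cast
        congr 2
        ring
      · rw [Set.indicator_of_notMem (by simpa using hs), max_eq_right (by linarith)]
        simp
    have hconv : ∀ y : ℝ, (Integrable fun s : ℝ => Complex.exp (-(I * y * s)) *
          (((max (-s) 0 : ℝ) : ℂ) * Complex.exp (-(c * s)))) ∧
        ∫ s : ℝ, Complex.exp (-(I * y * s)) *
          (((max (-s) 0 : ℝ) : ℂ) * Complex.exp (-(c * s))) = 1 / (c + I * y : ℂ) ^ 2 := by
      intro y
      obtain ⟨h1, h2⟩ := integral_Ioi_mul_exp_neg (hz y)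
      simp_rw [key]
      refine ⟨?_, ?_⟩
      · rw [integrable_indicator_iff measurableSet_Iio]
        have := h1.comp_neg
        simpa using this
      · rw [integral_indicator measurableSet_Iio, ← integral_Iic_eq_integral_Iio,
          integral_comp_neg_Iic (f := fun u : ℝ => (u : ℂ) *
            Complex.exp (-(-(c + I * y) * u))), neg_zero, h2]
        ring
    have := integral_exp_mul_eq_of_fourier (by fun_prop) (by simpa using (hconv 0).1)
      (fun y => (hconv y).2) (integrable_inv_line_sq hc.ne) t
    rw [this, max_eq_right (by linarith)]
    simp
  · rw [if_pos hc]
    have hz : ∀ y : ℝ, 0 < (c + I * y : ℂ).re := fun y => by simpa using hc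
    have key : ∀ y : ℝ, ∀ s : ℝ, Complex.exp (-(I * y * s)) *
          (((max s 0 : ℝ) : ℂ) * Complex.exp (-(c * s))) =
        (Set.Ioi (0 : ℝ)).indicator (fun u : ℝ => (u : ℂ) *
          Complex.exp (-((c + I * y) * u))) s := by
      intro y s
      by_cases hs : 0 < s
      · rw [Set.indicator_of_mem (Set.mem_Ioi.mpr hs), max_eq_left (by linarith), mul_left_comm,
          ← Complex.exp_add]
        congr 2
        ring
      · rw [Set.indicator_of_notMem (by simpa using hs), max_eq_right (by linarith)]
        simp
    have hconv : ∀ y : ℝ, (Integrable fun s : ℝ => Complex.exp (-(I * y * s)) *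
          (((max s 0 : ℝ) : ℂ) * Complex.exp (-(c * s)))) ∧
        ∫ s : ℝ, Complex.exp (-(I * y * s)) *
          (((max s 0 : ℝ) : ℂ) * Complex.exp (-(c * s))) = 1 / (c + I * y : ℂ) ^ 2 := by
      intro y
      obtain ⟨h1, h2⟩ := integral_Ioi_mul_exp_neg (hz y)
      simp_rw [key]
      exact ⟨by rwa [integrable_indicator_iff measurableSet_Ioi],
        by rw [integral_indicator measurableSet_Ioi, h2]⟩
    have := integral_exp_mul_eq_of_fourier (by fun_prop) (by simpa using (hconv 0).1)
      (fun y => (hconv y).2) (integrable_inv_line_sq hc.ne') t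
    rw [this, max_eq_left ht.le]

end Kuramoto

namespace Kuramoto

theorem hasDerivAt_exp_line (t y : ℝ) :
    HasDerivAt (fun y : ℝ => Complex.exp (I * y * t)) (Complex.exp (I * y * t) * (I * t)) y := by
  have h : HasDerivAt (fun w : ℂ => Complex.exp (I * w * t))
      (Complex.exp (I * y * t) * (I * 1 * t)) (y : ℂ) :=
    (((hasDerivAt_id _).const_mul I).mul_const (t : ℂ)).cexp
  simpa using h.comp_ofReal

theorem hasDerivAt_line (c y : ℝ) : HasDerivAt (fun y : ℝ => (c + I * y : ℂ)) I y := by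
  have h : HasDerivAt (fun w : ℂ => (c + I * w : ℂ)) (I * 1) (y : ℂ) :=
    ((hasDerivAt_id _).const_mul I).const_add _
  simpa using h.comp_ofReal

theorem norm_exp_I_mul (y t : ℝ) : ‖Complex.exp (I * y * t)‖ = 1 := by
  rw [Complex.norm_exp]; simp

theorem integral_exp_div_line {c : ℝ} (hc : c ≠ 0) {t : ℝ} (ht : 0 < t) (r s : ℝ) :
    ∫ y in r..s, Complex.exp (I * y * t) / (c + I * y) =
      (I * t)⁻¹ * (Complex.exp (I * s * t) / (c + I * s) - Complex.exp (I * r * t) / (c + I * r)) +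
      (t : ℂ)⁻¹ * ∫ y in r..s, Complex.exp (I * y * t) * (1 / (c + I * y : ℂ) ^ 2) := by
  have ht0 : (t : ℂ) ≠ 0 := by exact_mod_cast ht.ne'
  have hd : ∀ y : ℝ, HasDerivAt (fun y : ℝ => (I * t)⁻¹ * (Complex.exp (I * y * t) / (c + I * y)))
      (Complex.exp (I * y * t) / (c + I * y) -
        (t : ℂ)⁻¹ * (Complex.exp (I * y * t) * (1 / (c + I * y : ℂ) ^ 2))) y := by
    intro y
    have hl := line_ne_zero hc y
    refine (((hasDerivAt_exp_line t y).div (hasDerivAt_line c y) hl).const_mul _).congr_deriv ?_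
    field_simp
  have hcont1 : Continuous fun y : ℝ => Complex.exp (I * y * t) / (c + I * y) :=
    Continuous.div (by fun_prop) (by fun_prop) (line_ne_zero hc)
  have hcont2 : Continuous fun y : ℝ =>
      (t : ℂ)⁻¹ * (Complex.exp (I * y * t) * (1 / (c + I * y : ℂ) ^ 2)) :=
    continuous_const.mul (Continuous.mul (by fun_prop)
      (continuous_const.div (by fun_prop) fun y => pow_ne_zero _ (line_ne_zero hc y)))
  have h := intervalIntegral.integral_eq_sub_of_hasDerivAt (a := r) (b := s) (fun y _ => hd y)
    ((hcont1.sub hcont2).intervalIntegrable _ _)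
  rw [intervalIntegral.integral_sub (hcont1.intervalIntegrable _ _)
    (hcont2.intervalIntegrable _ _), intervalIntegral.integral_const_mul] at h
  rw [eq_add_of_sub_eq h]
  ring

theorem tendsto_exp_div_line_zero (c t : ℝ) :
    Tendsto (fun y : ℝ => Complex.exp (I * y * t) / (c + I * y)) (cocompact ℝ) (𝓝 0) := by
  have h1 : Tendsto (fun y : ℝ => ‖y‖⁻¹) (cocompact ℝ) (𝓝 0) :=
    tendsto_inv_atTop_zero.comp tendsto_norm_cocompact_atTop
  refine squeeze_zero_norm' ?_ h1
  have : ∀ᶠ y : ℝ in cocompact ℝ, 0 < ‖y‖ :=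
    tendsto_norm_cocompact_atTop.eventually (eventually_gt_atTop 0)
  filter_upwards [this] with y hy
  rw [norm_div, norm_exp_I_mul, one_div]
  refine inv_anti₀ hy ?_
  simpa using Complex.abs_im_le_norm (c + I * y : ℂ)

/-- The improper line integral of the Laplace kernel. -/
theorem tendsto_integral_exp_div_line {c : ℝ} (hc : c ≠ 0) {t : ℝ} (ht : 0 < t) :
    Tendsto (fun r : ℝ × ℝ => ∫ y in r.1..r.2, Complex.exp (I * y * t) / (c + I * y))
      (atBot ×ˢ atTop) (𝓝 (if 0 < c then 2 * Real.pi * Complex.exp (-(c * t)) else 0)) := by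
  simp_rw [integral_exp_div_line hc ht]
  have hi : Integrable fun y : ℝ => Complex.exp (I * y * t) * (1 / (c + I * y : ℂ) ^ 2) := by
    refine (integrable_inv_line_sq hc).bdd_mul (c := 1)
      (Continuous.aestronglyMeasurable (by fun_prop)) (Eventually.of_forall fun y => ?_)
    rw [norm_exp_I_mul]
  have h1 : Tendsto (fun r : ℝ × ℝ => ∫ y in r.1..r.2,
      Complex.exp (I * y * t) * (1 / (c + I * y : ℂ) ^ 2)) (atBot ×ˢ atTop) (𝓝 _) :=
    intervalIntegral_tendsto_integral hi tendsto_fst tendsto_snd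
  rw [integral_exp_div_line_sq hc ht] at h1
  have hz := tendsto_exp_div_line_zero c t
  have h2 : Tendsto (fun r : ℝ × ℝ => Complex.exp (I * r.2 * t) / (c + I * r.2))
      (atBot ×ˢ atTop) (𝓝 0) := (hz.mono_left atTop_le_cocompact).comp tendsto_snd
  have h3 : Tendsto (fun r : ℝ × ℝ => Complex.exp (I * r.1 * t) / (c + I * r.1))
      (atBot ×ˢ atTop) (𝓝 0) := (hz.mono_left atBot_le_cocompact).comp tendsto_fst
  have h := ((h2.sub h3).const_mul (I * t)⁻¹).add (h1.const_mul (t : ℂ)⁻¹)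
  convert h using 2
  have ht0 : (t : ℂ) ≠ 0 := by exact_mod_cast ht.ne'
  split_ifs
  · field_simp
    ring
  · simp

theorem exists_bound_integral_exp_div_line {c : ℝ} (hc : c ≠ 0) {t : ℝ} (ht : 0 < t) :
    ∃ M : ℝ, ∀ r s : ℝ, ‖∫ y in r..s, Complex.exp (I * y * t) / (c + I * y)‖ ≤ M := by
  refine ⟨t⁻¹ * (|c|⁻¹ + |c|⁻¹) + t⁻¹ * ∫ y : ℝ, 1 / (c ^ 2 + y ^ 2), fun r s => ?_⟩
  rw [integral_exp_div_line hc ht]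
  have hb : ∀ y : ℝ, ‖Complex.exp (I * y * t) / (c + I * y)‖ ≤ |c|⁻¹ := fun y => by
    rw [norm_div, norm_exp_I_mul, one_div]
    exact inv_anti₀ (abs_pos.mpr hc) (norm_line_ge c y)
  refine (norm_add_le _ _).trans (add_le_add ?_ ?_)
  · rw [norm_mul, norm_inv, norm_mul, norm_I, one_mul, Complex.norm_real, Real.norm_of_nonneg ht.le]
    gcongr
    exact (norm_sub_le _ _).trans (add_le_add (hb _) (hb _))
  · rw [norm_mul, norm_inv, Complex.norm_real, Real.norm_of_nonneg ht.le]
    gcongr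
    refine intervalIntegral.norm_integral_le_integral_norm_uIoc.trans ?_
    refine (setIntegral_mono_on ?_ (integrable_inv_const_add_sq hc).integrableOn
      measurableSet_uIoc fun y _ => ?_).trans
      (setIntegral_le_integral (integrable_inv_const_add_sq hc)
        (Eventually.of_forall fun y => by positivity))
    · refine Integrable.norm ?_
      refine Integrable.integrableOn ?_
      refine (integrable_inv_line_sq hc).bdd_mul (c := 1)
        (Continuous.aestronglyMeasurable (by fun_prop)) (Eventually.of_forall fun y => ?_)
      rw [norm_exp_I_mul]
    · rw [norm_mul, norm_exp_I_mul, one_mul, norm_div, norm_pow, norm_line_sq, norm_one]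

theorem integral_exp_div_line_shift (c v t r s : ℝ) :
    ∫ y in r..s, Complex.exp (I * y * t) / (c + I * y - I * v) =
      Complex.exp (I * v * t) *
        ∫ y in (r - v)..(s - v), Complex.exp (I * y * t) / (c + I * y) := by
  rw [← intervalIntegral.integral_const_mul, ← intervalIntegral.integral_comp_sub_right
    (fun y : ℝ => Complex.exp (I * v * t) * (Complex.exp (I * y * t) / (c + I * y)))]
  refine intervalIntegral.integral_congr fun y _ => ?_
  rw [← mul_div_assoc, ← Complex.exp_add]
  congr 1
  · congr 1; push_cast; ring
  · push_cast; ring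

theorem tendsto_sub_const_atBot_prod_atTop (v : ℝ) :
    Tendsto (fun r : ℝ × ℝ => (r.1 - v, r.2 - v)) (atBot ×ˢ atTop) (atBot ×ˢ atTop) :=
  Tendsto.prodMap (tendsto_atBot_add_const_right _ (-v) tendsto_id)
    (tendsto_atTop_add_const_right _ (-v) tendsto_id)

/-- Inverse Laplace transform of `1 / (λ - w)`, over a vertical line on either side of `w`. -/
theorem tendsto_integral_exp_div_sub {c : ℝ} {w : ℂ} (hc : c ≠ w.re) {t : ℝ} (ht : 0 < t) :
    Tendsto (fun r : ℝ × ℝ => ∫ y in r.1..r.2, Complex.exp ((c + I * y) * t) / (c + I * y - w))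
      (atBot ×ˢ atTop) (𝓝 (if w.re < c then 2 * Real.pi * Complex.exp (w * t) else 0)) := by
  have h := (tendsto_integral_exp_div_line (c := c - w.re) (sub_ne_zero.mpr hc) ht).comp
    (tendsto_sub_const_atBot_prod_atTop w.im)
  have h' := h.const_mul (Complex.exp (c * t) * Complex.exp (I * w.im * t))
  refine (h'.congr fun r => ?_).trans (le_of_eq ?_)
  · simp only [Function.comp]
    rw [mul_assoc, ← integral_exp_div_line_shift, ← intervalIntegral.integral_const_mul]
    refine intervalIntegral.integral_congr fun y _ => ?_
    rw [← mul_div_assoc, ← Complex.exp_add]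
    congr 1
    · congr 1; ring
    · conv_rhs => rw [← Complex.re_add_im w]
      push_cast; ring
  · simp only [sub_pos]
    split_ifs
    · congr 1
      conv_rhs => rw [← Complex.re_add_im w]
      rw [mul_left_comm, ← Complex.exp_add, ← Complex.exp_add]
      congr 2
      push_cast; ring
    · simp

/-! ### Integrals over vertical lines -/

/-- Cauchy's theorem in a vertical strip. -/
theorem tendsto_integral_vertical_sub {k : ℂ → ℂ} {c₁ c₂ : ℝ} (h : c₁ ≤ c₂)
    (hc : ContinuousOn k {z | c₁ ≤ z.re ∧ z.re ≤ c₂})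
    (hd : ∀ z : ℂ, c₁ < z.re → z.re < c₂ → DifferentiableAt ℂ k z)
    (hdec : ∀ ε : ℝ, 0 < ε → ∃ Y : ℝ, ∀ z : ℂ, c₁ ≤ z.re → z.re ≤ c₂ → Y ≤ |z.im| → ‖k z‖ ≤ ε) :
    Tendsto (fun r : ℝ × ℝ => (∫ y in r.1..r.2, k (c₂ + I * y)) - ∫ y in r.1..r.2, k (c₁ + I * y))
      (atBot ×ˢ atTop) (𝓝 0) := by
  rw [Metric.tendsto_nhds]
  intro ε hε
  have hden : 0 < 2 * (c₂ - c₁) + 1 := by linarith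
  obtain ⟨Y, hY⟩ := hdec (ε / (2 * (c₂ - c₁) + 1)) (by positivity)
  have h1 : ∀ᶠ r : ℝ × ℝ in atBot ×ˢ atTop, r.1 ≤ -|Y| ∧ |Y| ≤ r.2 :=
    ((eventually_le_atBot (-|Y|)).prod_mk (eventually_ge_atTop |Y|))
  filter_upwards [h1] with r hr
  have hrect := Complex.integral_boundary_rect_eq_zero_of_differentiable_on_off_countable k
    (c₁ + I * r.1) (c₂ + I * r.2) ∅ Set.countable_empty ?_ ?_
  · simp only [add_re, ofReal_re, mul_re, I_re, zero_mul, I_im, ofReal_im, mul_zero, sub_self,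
      add_zero, add_im, mul_im, one_mul, zero_add] at hrect
    have e : ∀ c : ℝ, (∫ y in r.1..r.2, k (c + I * y)) = ∫ y in r.1..r.2, k (c + y * I) := by
      intro c; simp_rw [mul_comm I]
    rw [dist_zero_right, e, e]
    set A := ∫ y in r.1..r.2, k (c₂ + y * I)
    set B := ∫ y in r.1..r.2, k (c₁ + y * I)
    have hside : ∀ y : ℝ, Y ≤ |y| →
        ‖∫ x in c₁..c₂, k (x + y * I)‖ ≤ ε / (2 * (c₂ - c₁) + 1) * (c₂ - c₁) := by
      intro y hy
      have := intervalIntegral.norm_integral_le_of_norm_le_const (a := c₁) (b := c₂)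
        (f := fun x : ℝ => k (x + y * I)) (C := ε / (2 * (c₂ - c₁) + 1)) (fun x hx => ?_)
      · rwa [abs_of_nonneg (by linarith)] at this
      · rw [Set.uIoc_of_le h] at hx
        exact hY _ (by simpa using hx.1.le) (by simpa using hx.2) (by simpa using hy)
    have hA : I • (A - B) = (∫ x in c₁..c₂, k (x + r.2 * I)) - ∫ x in c₁..c₂, k (x + r.1 * I) := by
      rw [smul_sub]
      linear_combination hrect
    have hn : ‖A - B‖ = ‖I • (A - B)‖ := by rw [norm_smul, norm_I, one_mul]
    rw [hn, hA]
    refine (norm_sub_le _ _).trans_lt ?_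
    have b1 := hside r.2 ((le_abs_self Y).trans (hr.2.trans (le_abs_self _)))
    have b2 := hside r.1 ((le_abs_self Y).trans ((le_neg.mpr hr.1).trans (neg_le_abs _)))
    have : ε / (2 * (c₂ - c₁) + 1) * (2 * (c₂ - c₁)) < ε := by
      rw [div_mul_eq_mul_div, div_lt_iff₀ hden]
      linarith
    linarith
  · refine hc.mono ?_
    intro z hz
    rw [Complex.mem_reProdIm] at hz
    have := hz.1
    simpa [Set.uIcc_of_le h] using this
  · intro z hz
    have h2 := hz.1
    rw [Complex.mem_reProdIm] at h2
    have h3 := h2.1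
    simp only [add_re, ofReal_re, mul_re, I_re, zero_mul, I_im, ofReal_im, mul_zero, sub_self,
      add_zero, min_eq_left h, max_eq_right h] at h3
    exact hd z h3.1 h3.2

end Kuramoto

namespace Kuramoto

/-! ### Rapidly decaying functions and their Cauchy transforms -/

/-- Continuous functions on the line that decay faster than every exponential. -/
structure RapidDecay (u : ℝ → ℂ) : Prop where
  cont : Continuous u
  bound : ∀ γ : ℝ, ∃ C : ℝ, ∀ ω : ℝ, ‖u ω‖ ≤ C * Real.exp (-γ * |ω|)

theorem integrable_exp_neg_abs : Integrable fun x : ℝ => Real.exp (-|x|) := by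
  have h1 : IntegrableOn (fun x : ℝ => Real.exp (-|x|)) (Set.Ioi 0) := by
    refine (integrableOn_exp_neg_Ioi 0).congr_fun (fun x hx => ?_) measurableSet_Ioi
    simp [abs_of_pos (Set.mem_Ioi.mp hx)]
  have h2 : IntegrableOn (fun x : ℝ => Real.exp (-|x|)) (Set.Iic 0) := by
    have := (integrableOn_exp_neg_Ioi 0).comp_neg
    simp only [neg_neg, Set.neg_Ioi, neg_zero] at this
    rw [integrableOn_Iic_iff_integrableOn_Iio]
    refine this.congr_fun (fun x hx => ?_) measurableSet_Iio
    simp [abs_of_neg (Set.mem_Iio.mp hx)]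
  rw [← integrableOn_univ, ← Set.Iic_union_Ioi (a := (0 : ℝ))]
  exact h2.union h1

theorem RapidDecay.integrable_exp_mul {u : ℝ → ℂ} (hu : RapidDecay u) (β : ℝ) :
    Integrable fun ω : ℝ => Real.exp (β * |ω|) * ‖u ω‖ := by
  obtain ⟨C, hC⟩ := hu.bound (β + 1)
  have hcont := hu.cont
  refine Integrable.mono' (integrable_exp_neg_abs.const_mul C)
    (Continuous.aestronglyMeasurable (by fun_prop)) (Eventually.of_forall fun ω => ?_)
  rw [Real.norm_of_nonneg (by positivity)]
  calc Real.exp (β * |ω|) * ‖u ω‖ ≤ Real.exp (β * |ω|) * (C * Real.exp (-(β + 1) * |ω|)) := by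
        gcongr; exact hC ω
    _ = C * Real.exp (-|ω|) := by
        rw [mul_left_comm, ← Real.exp_add]; congr 2; ring

theorem RapidDecay.integrable {u : ℝ → ℂ} (hu : RapidDecay u) : Integrable u := by
  have := hu.integrable_exp_mul 0
  simp only [zero_mul, Real.exp_zero, one_mul] at this
  exact (integrable_norm_iff hu.cont.aestronglyMeasurable).mp this

theorem RapidDecay.integrable_one_add_abs_mul {u : ℝ → ℂ} (hu : RapidDecay u) (c : ℝ) :
    Integrable fun ω : ℝ => ‖u ω‖ * (1 + |ω| / c) := by
  have h1 := hu.integrable_exp_mul 1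
  have hcont := hu.cont
  have h2 : Integrable fun ω : ℝ => |ω| * ‖u ω‖ := by
    refine h1.mono' (Continuous.aestronglyMeasurable (by fun_prop))
      (Eventually.of_forall fun ω => ?_)
    rw [Real.norm_of_nonneg (by positivity)]
    gcongr
    linarith [Real.add_one_le_exp (1 * |ω|)]
  refine (hu.integrable.norm.add (h2.div_const c)).congr (Eventually.of_forall fun ω => ?_)
  simp only [Pi.add_apply]
  ring

theorem RapidDecay.mul_of_exp_bound {u v : ℝ → ℂ} (hu : RapidDecay u) (hv : Continuous v)
    {A β : ℝ} (h : ∀ ω, ‖v ω‖ ≤ A * Real.exp (β * |ω|)) : RapidDecay fun ω => v ω * u ω := by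
  refine ⟨hv.mul hu.cont, fun γ => ?_⟩
  obtain ⟨C, hC⟩ := hu.bound (γ + β)
  refine ⟨A * C, fun ω => ?_⟩
  have hA : 0 ≤ A * Real.exp (β * |ω|) := (norm_nonneg _).trans (h ω)
  rw [norm_mul]
  calc ‖v ω‖ * ‖u ω‖ ≤ A * Real.exp (β * |ω|) * (C * Real.exp (-(γ + β) * |ω|)) :=
        mul_le_mul (h ω) (hC ω) (norm_nonneg _) hA
    _ = A * C * (Real.exp (β * |ω|) * Real.exp (-(γ + β) * |ω|)) := by ring
    _ = _ := by rw [← Real.exp_add]; congr 2; ring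

/-- The Cauchy transform `∫ u(ω) / (λ - iω) dω`. -/
noncomputable def cauchyTransform (u : ℝ → ℂ) (lam : ℂ) : ℂ := ∫ ω : ℝ, u ω / (lam - I * ω)

/-- The characteristic function `∫ exp(iωt) u(ω) dω`. -/
noncomputable def charTransform (u : ℝ → ℂ) (t : ℝ) : ℂ := ∫ ω : ℝ, Complex.exp (I * ω * t) * u ω

theorem abs_re_le_norm_sub (lam : ℂ) (ω : ℝ) : |lam.re| ≤ ‖lam - I * ω‖ := by
  simpa using Complex.abs_re_le_norm (lam - I * ω)

theorem sub_I_mul_ne_zero {lam : ℂ} (h : lam.re ≠ 0) (ω : ℝ) : lam - I * ω ≠ 0 := fun h0 => by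
  have := abs_re_le_norm_sub lam ω
  rw [h0, norm_zero] at this
  exact h (abs_nonpos_iff.mp this)

theorem integrable_div_sub {u : ℝ → ℂ} (hu : Integrable u) {lam : ℂ} (h : lam.re ≠ 0) :
    Integrable fun ω : ℝ => u ω / (lam - I * ω) := by
  have : Integrable fun ω : ℝ => (lam - I * ω)⁻¹ * u ω := by
    refine hu.bdd_mul (c := |lam.re|⁻¹) (Continuous.aestronglyMeasurable ?_)
      (Eventually.of_forall fun ω => ?_)
    · exact Continuous.inv₀ (by fun_prop) (sub_I_mul_ne_zero h)
    · rw [norm_inv]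
      exact inv_anti₀ (abs_pos.mpr h) (abs_re_le_norm_sub lam ω)
  exact this.congr (Eventually.of_forall fun ω => by simp only; rw [div_eq_inv_mul])

theorem norm_mul_norm_inv_sub_le {lam : ℂ} {c : ℝ} (hc : 0 < c) (h : c ≤ |lam.re|) (ω : ℝ) :
    ‖lam‖ / ‖lam - I * ω‖ ≤ 1 + |ω| / c := by
  have h1 := h.trans (abs_re_le_norm_sub lam ω)
  have h2 : ‖lam‖ ≤ ‖lam - I * ω‖ + |ω| := by
    calc ‖lam‖ = ‖(lam - I * ω) + I * ω‖ := by ring_nf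
      _ ≤ ‖lam - I * ω‖ + ‖I * (ω : ℂ)‖ := norm_add_le _ _
      _ = _ := by simp
  have h3 : 0 < ‖lam - I * ω‖ := hc.trans_le h1
  calc ‖lam‖ / ‖lam - I * ω‖ ≤ (‖lam - I * ω‖ + |ω|) / ‖lam - I * ω‖ := by gcongr
    _ = 1 + |ω| / ‖lam - I * ω‖ := by rw [add_div, div_self h3.ne']
    _ ≤ 1 + |ω| / c := by gcongr

theorem norm_mul_norm_cauchyTransform_le {u : ℝ → ℂ} {c : ℝ}
    (hu : Integrable fun ω : ℝ => ‖u ω‖ * (1 + |ω| / c)) (hc : 0 < c) {lam : ℂ}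
    (h : c ≤ |lam.re|) :
    ‖lam‖ * ‖cauchyTransform u lam‖ ≤ ∫ ω : ℝ, ‖u ω‖ * (1 + |ω| / c) := by
  rw [← norm_mul, cauchyTransform, ← integral_const_mul]
  refine norm_integral_le_of_norm_le hu (Eventually.of_forall fun ω => ?_)
  rw [norm_mul, norm_div, mul_div_left_comm]
  gcongr
  exact norm_mul_norm_inv_sub_le hc h ω

theorem differentiableAt_cauchyTransform {u : ℝ → ℂ} (hu : Integrable u) {lam : ℂ}
    (h : lam.re ≠ 0) : DifferentiableAt ℂ (cauchyTransform u) lam := by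
  have hpos : 0 < |lam.re| / 2 := by positivity
  have hball : ∀ z ∈ Metric.ball lam (|lam.re| / 2), |lam.re| / 2 ≤ |z.re| := by
    intro z hz
    have h1 : |lam.re - z.re| ≤ ‖lam - z‖ := by simpa using Complex.abs_re_le_norm (lam - z)
    rw [Metric.mem_ball, dist_comm, dist_eq_norm] at hz
    have h2 := abs_sub_abs_le_abs_sub lam.re z.re
    linarith
  have hre : ∀ z ∈ Metric.ball lam (|lam.re| / 2), z.re ≠ 0 := fun z hz h0 => by
    have := hball z hz
    rw [h0, abs_zero] at this
    linarith
  refine (hasDerivAt_integral_of_dominated_loc_of_deriv_le (𝕜 := ℂ) (μ := volume)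
    (F := fun z ω => u ω / (z - I * ω)) (F' := fun z ω => -(u ω) / (z - I * ω) ^ 2)
    (x₀ := lam) (bound := fun ω => ‖u ω‖ / (|lam.re| / 2) ^ 2)
    (Metric.ball_mem_nhds lam hpos) ?_ (integrable_div_sub hu h) ?_ ?_
    (hu.norm.div_const _) ?_).2.differentiableAt
  · filter_upwards [Metric.ball_mem_nhds lam hpos] with z hz
    exact (integrable_div_sub hu (hre z hz)).aestronglyMeasurable
  · simp_rw [div_eq_mul_inv]
    refine hu.aestronglyMeasurable.neg.mul (Continuous.aestronglyMeasurable ?_)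
    exact Continuous.inv₀ (by fun_prop) fun ω => pow_ne_zero _ (sub_I_mul_ne_zero h ω)
  · refine Eventually.of_forall fun ω z hz => ?_
    rw [norm_div, norm_neg, norm_pow]
    gcongr
    exact (hball z hz).trans (abs_re_le_norm_sub z ω)
  · refine Eventually.of_forall fun ω z hz => ?_
    have hne := sub_I_mul_ne_zero (hre z hz) ω
    have h1 : HasDerivAt (fun z : ℂ => z - I * ω) 1 z := (hasDerivAt_id z).sub_const _
    refine ((hasDerivAt_const z (u ω)).div h1 hne).congr_deriv ?_
    simp

theorem analyticAt_cauchyTransform {u : ℝ → ℂ} (hu : Integrable u) {lam : ℂ}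
    (h : lam.re ≠ 0) : AnalyticAt ℂ (cauchyTransform u) lam := by
  have hopen : IsOpen {z : ℂ | z.re ≠ 0} := isOpen_ne_fun Complex.continuous_re continuous_const
  exact DifferentiableOn.analyticAt (s := {z : ℂ | z.re ≠ 0})
    (fun z hz => (differentiableAt_cauchyTransform hu hz).differentiableWithinAt)
    (hopen.mem_nhds h)

theorem continuous_charTransform {u : ℝ → ℂ} (hu : Integrable u) :
    Continuous (charTransform u) := by
  refine continuous_of_dominated (bound := fun ω => ‖u ω‖) (fun t => ?_) (fun t => ?_) hu.norm ?_
  · exact (Continuous.aestronglyMeasurable (by fun_prop)).mul hu.aestronglyMeasurable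
  · exact Eventually.of_forall fun ω => by rw [norm_mul, norm_exp_I_mul, one_mul]
  · exact Eventually.of_forall fun ω => by fun_prop

theorem norm_charTransform_le (u : ℝ → ℂ) (t : ℝ) : ‖charTransform u t‖ ≤ ∫ ω, ‖u ω‖ := by
  refine (norm_integral_le_integral_norm _).trans (le_of_eq ?_)
  simp_rw [norm_mul, norm_exp_I_mul, one_mul]

theorem integrable_exp_I_mul {u : ℝ → ℂ} (hu : Integrable u) (t : ℝ) :
    Integrable fun ω : ℝ => Complex.exp (I * ω * t) * u ω :=
  hu.bdd_mul (c := 1) (Continuous.aestronglyMeasurable (by fun_prop))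
    (Eventually.of_forall fun ω => by rw [norm_exp_I_mul])

theorem integrableOn_exp_mul_charTransform {u : ℝ → ℂ} (hu : Integrable u) {lam : ℂ}
    (h : 0 < lam.re) :
    IntegrableOn (fun s : ℝ => Complex.exp (-(lam * s)) * charTransform u s) (Set.Ioi 0) := by
  have h1 : IntegrableOn (fun s : ℝ => Real.exp (-lam.re * s)) (Set.Ioi 0) :=
    exp_neg_integrableOn_Ioi 0 h
  have hc := continuous_charTransform hu
  refine Integrable.mono' (h1.mul_const (∫ ω, ‖u ω‖))
    (Continuous.aestronglyMeasurable (by fun_prop)) (Eventually.of_forall fun s => ?_)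
  rw [norm_mul, Complex.norm_exp]
  gcongr
  · simp
  · exact norm_charTransform_le u s

/-- The Laplace transform of the characteristic function is the Cauchy transform. -/
theorem integral_exp_mul_charTransform {u : ℝ → ℂ} (hu : Integrable u) {lam : ℂ}
    (h : 0 < lam.re) :
    ∫ s in Set.Ioi (0 : ℝ), Complex.exp (-(lam * s)) * charTransform u s =
      cauchyTransform u lam := by
  have h1 : IntegrableOn (fun s : ℝ => Real.exp (-lam.re * s)) (Set.Ioi 0) :=
    exp_neg_integrableOn_Ioi 0 h
  have hprod : Integrable (Function.uncurry fun (s ω : ℝ) =>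
      Complex.exp (-(lam * s)) * (Complex.exp (I * ω * s) * u ω))
      ((volume.restrict (Set.Ioi 0)).prod volume) := by
    have hb := Integrable.mul_prod (h1.integrable) hu.norm
    refine hb.mono' ?_ (Eventually.of_forall fun z => ?_)
    · refine AEStronglyMeasurable.mul (Continuous.aestronglyMeasurable (by fun_prop)) ?_
      refine AEStronglyMeasurable.mul (Continuous.aestronglyMeasurable (by fun_prop)) ?_
      exact hu.aestronglyMeasurable.comp_snd
    · simp only [Function.uncurry]
      rw [norm_mul, norm_mul, norm_exp_I_mul, one_mul, Complex.norm_exp]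
      simp
  have hsw := integral_integral_swap hprod
  simp_rw [integral_const_mul] at hsw
  unfold charTransform
  rw [hsw, cauchyTransform]
  refine integral_congr_ae (Eventually.of_forall fun ω => ?_)
  have hre : (-(lam - I * ω)).re < 0 := by simpa using h
  have := integral_exp_mul_complex_Ioi hre 0
  simp only [ofReal_zero, mul_zero, Complex.exp_zero] at this
  calc ∫ s in Set.Ioi (0 : ℝ), Complex.exp (-(lam * s)) * (Complex.exp (I * ω * s) * u ω)
      = ∫ s in Set.Ioi (0 : ℝ), Complex.exp (-(lam - I * ω) * s) * u ω := by
        refine integral_congr_ae (Eventually.of_forall fun s => ?_)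
        simp only
        rw [← mul_assoc, ← Complex.exp_add]
        congr 2
        ring
    _ = _ := by
        rw [integral_mul_const, this]
        rw [neg_div_neg_eq, one_div_mul_eq_div]

theorem continuous_cauchyTransform_line {u : ℝ → ℂ} (hu : Integrable u) {c : ℝ} (hc : c ≠ 0) :
    Continuous fun y : ℝ => cauchyTransform u (c + I * y) := by
  rw [continuous_iff_continuousAt]
  intro y
  have h := (differentiableAt_cauchyTransform hu (lam := c + I * y) (by simpa using hc)).continuousAt
  exact ContinuousAt.comp (f := fun y : ℝ => (c + I * y : ℂ)) h (by fun_prop)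

/-- The improper inverse Laplace integral of a Cauchy transform. -/
theorem tendsto_integral_exp_mul_cauchyTransform {u : ℝ → ℂ} (hu : Integrable u) {c : ℝ}
    (hc : c ≠ 0) {t : ℝ} (ht : 0 < t) :
    Tendsto (fun r : ℝ × ℝ => ∫ y in r.1..r.2,
        Complex.exp (I * y * t) * cauchyTransform u (c + I * y)) (atBot ×ˢ atTop)
      (𝓝 (if 0 < c then 2 * Real.pi * Complex.exp (-(c * t)) * charTransform u t else 0)) := by
  have hswap : ∀ r s : ℝ, ∫ y in r..s, Complex.exp (I * y * t) * cauchyTransform u (c + I * y) =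
      ∫ ω : ℝ, (∫ y in (r - ω)..(s - ω), Complex.exp (I * y * t) / (c + I * y)) *
        (Complex.exp (I * ω * t) * u ω) := by
    intro r s
    have e1 : ∀ y : ℝ, Complex.exp (I * y * t) * cauchyTransform u (c + I * y) =
        ∫ ω : ℝ, Complex.exp (I * y * t) / (c + I * y - I * ω) * u ω := by
      intro y
      rw [cauchyTransform, ← integral_const_mul]
      refine integral_congr_ae (Eventually.of_forall fun ω => ?_)
      simp only
      ring
    simp_rw [e1]
    rw [intervalIntegral_integral_swap]
    · refine integral_congr_ae (Eventually.of_forall fun ω => ?_)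
      simp only
      rw [intervalIntegral.integral_mul_const, integral_exp_div_line_shift]
      ring
    · have hfin : IsFiniteMeasure (volume.restrict (Set.uIoc r s)) := by
        rw [Set.uIoc]; infer_instance
      have hb : Integrable (fun z : ℝ × ℝ => |c|⁻¹ * ‖u z.2‖)
          ((volume.restrict (Set.uIoc r s)).prod volume) :=
        Integrable.mul_prod (integrable_const _) hu.norm
      refine hb.mono' ?_ (Eventually.of_forall fun z => ?_)
      · refine AEStronglyMeasurable.mul (Continuous.aestronglyMeasurable ?_)
          hu.aestronglyMeasurable.comp_snd
        refine Continuous.div (by fun_prop) (by fun_prop) fun z => ?_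
        exact sub_I_mul_ne_zero (by simpa using hc) _
      · simp only [Function.uncurry]
        rw [norm_mul, norm_div, norm_exp_I_mul, one_div]
        gcongr
        simpa using abs_re_le_norm_sub (c + I * z.1 : ℂ) z.2
  simp_rw [hswap]
  obtain ⟨M, hM⟩ := exists_bound_integral_exp_div_line hc ht
  have hlim := tendsto_integral_filter_of_dominated_convergence
    (l := (atBot ×ˢ atTop : Filter (ℝ × ℝ))) (μ := volume)
    (F := fun r ω => (∫ y in (r.1 - ω)..(r.2 - ω), Complex.exp (I * y * t) / (c + I * y)) *
        (Complex.exp (I * ω * t) * u ω))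
    (f := fun ω => (if 0 < c then 2 * Real.pi * Complex.exp (-(c * t)) else 0) *
        (Complex.exp (I * ω * t) * u ω))
    (fun ω => M * ‖u ω‖) (Eventually.of_forall fun r => ?_)
    (Eventually.of_forall fun r => Eventually.of_forall fun ω => ?_) (hu.norm.const_mul M)
    (Eventually.of_forall fun ω => ?_)
  · refine hlim.trans (le_of_eq ?_)
    rw [integral_const_mul]
    split_ifs
    · rfl
    · simp
  · refine AEStronglyMeasurable.mul (Continuous.aestronglyMeasurable ?_)
      (integrable_exp_I_mul hu t).aestronglyMeasurable
    have hcont : Continuous fun y : ℝ => Complex.exp (I * y * t) / (c + I * y) :=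
      Continuous.div (by fun_prop) (by fun_prop) (line_ne_zero hc)
    have h2 := intervalIntegral.continuous_primitive (μ := volume) (a := 0)
     
      (fun a b => hcont.intervalIntegrable a b)
    have h3 : (fun ω : ℝ => ∫ y in (r.1 - ω)..(r.2 - ω), Complex.exp (I * y * t) / (c + I * y)) =
        fun ω => (∫ y in (0 : ℝ)..(r.2 - ω), Complex.exp (I * y * t) / (c + I * y)) -
          ∫ y in (0 : ℝ)..(r.1 - ω), Complex.exp (I * y * t) / (c + I * y) := by
      ext ω
      rw [intervalIntegral.integral_interval_sub_left (hcont.intervalIntegrable _ _)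
        (hcont.intervalIntegrable _ _)]
    rw [h3]
    exact (h2.comp (by fun_prop)).sub (h2.comp (by fun_prop))
  · rw [norm_mul, norm_mul, norm_exp_I_mul, one_mul]
    gcongr
    exact hM _ _
  · exact ((tendsto_integral_exp_div_line hc ht).comp
      (tendsto_sub_const_atBot_prod_atTop ω)).mul_const _

end Kuramoto

namespace Kuramoto

/-! ### The continuation of the density in a strip -/

/-- Far out in a horizontal strip of the upper half plane one is in the two sectors around the
real half lines. -/
theorem exists_forall_mem_sector {δ : ℝ} (hδ : 0 < δ) (P : ℝ) :
    ∃ Y : ℝ, 0 < Y ∧ ∀ z : ℂ, 0 ≤ z.im → z.im ≤ P → Y ≤ |z.re| →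
      |arg z| ≤ δ ∨ |arg z - Real.pi| ≤ δ := by
  have h1 : ContinuousAt arg (1 : ℂ) := Complex.continuousAt_arg (by simp [Complex.slitPlane])
  have h2 : ContinuousWithinAt arg {z : ℂ | 0 ≤ z.im} (-1 : ℂ) :=
    Complex.continuousWithinAt_arg_of_re_neg_of_im_zero (by simp) (by simp)
  obtain ⟨η₁, hη₁, H1⟩ := Metric.continuousAt_iff.mp h1 δ hδ
  obtain ⟨η₂, hη₂, H2⟩ := Metric.continuousWithinAt_iff.mp h2 δ hδ
  refine ⟨|P| / min η₁ η₂ + 1, by positivity, fun z h0 hP hY => ?_⟩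
  have hmin : 0 < min η₁ η₂ := lt_min hη₁ hη₂
  have hr : 0 < |z.re| := lt_of_lt_of_le (by positivity) hY
  have hsmall : z.im / |z.re| < min η₁ η₂ := by
    rw [div_lt_iff₀ hr]
    have : |P| < min η₁ η₂ * |z.re| := by
      have h3 : |P| / min η₁ η₂ < |z.re| := by linarith
      rwa [div_lt_iff₀' hmin] at h3
    linarith [le_abs_self P]
  have hnn : 0 ≤ z.im / |z.re| := by positivity
  have harg : arg (((|z.re|⁻¹ : ℝ) : ℂ) * z) = arg z := Complex.arg_real_mul z (by positivity)
  rcases lt_or_gt_of_ne (abs_pos.mp hr) with hneg | hpos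
  · right
    have hw : ((|z.re|⁻¹ : ℝ) : ℂ) * z = -1 + (z.im / |z.re| : ℝ) * I := by
      apply Complex.ext
      · rw [Complex.re_ofReal_mul, abs_of_neg hneg]
        simp only [add_re, neg_re, one_re, mul_re, ofReal_re, I_re, mul_zero, ofReal_im, I_im,
          mul_one, sub_self, add_zero]
        rw [inv_neg, neg_mul, inv_mul_cancel₀ hneg.ne]
      · rw [Complex.im_ofReal_mul]
        simp; ring
    have := H2 (x := ((|z.re|⁻¹ : ℝ) : ℂ) * z) (by rw [hw]; simpa using hnn) (by
      rw [hw, dist_eq_norm]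
      simpa [abs_of_nonneg h0] using hsmall.trans_le (min_le_right _ _))
    rw [harg, Complex.arg_neg_one, Real.dist_eq] at this
    exact this.le
  · left
    have hw : ((|z.re|⁻¹ : ℝ) : ℂ) * z = 1 + (z.im / |z.re| : ℝ) * I := by
      apply Complex.ext
      · rw [Complex.re_ofReal_mul, abs_of_pos hpos]
        simp [hpos.ne']
      · rw [Complex.im_ofReal_mul]
        simp; ring
    have := H1 (x := ((|z.re|⁻¹ : ℝ) : ℂ) * z) (by
      rw [hw, dist_eq_norm]
      simpa [abs_of_nonneg h0] using hsmall.trans_le (min_le_left _ _))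
    rw [harg, Complex.arg_one, Real.dist_eq, sub_zero] at this
    exact this.le

theorem analyticAt_of_bounded_of_meromorphicNFAt {f : ℂ → ℂ} {z : ℂ} (hf : MeromorphicNFAt f z)
    {C : ℝ} (hC : ∀ᶠ w in 𝓝[≠] z, ‖f w‖ ≤ C) : AnalyticAt ℂ f z := by
  rw [← hf.meromorphicOrderAt_nonneg_iff_analyticAt]
  by_contra hneg
  have h1 := (tendsto_cobounded_iff_meromorphicOrderAt_neg hf.meromorphicAt).mpr (not_le.mp hneg)
  have h2 := (tendsto_norm_atTop_iff_cobounded.mpr h1).eventually (eventually_gt_atTop C)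
  obtain ⟨w, hw1, hw2⟩ := (hC.and h2).exists
  linarith

/-- The behaviour of the continuation `gc` of the density in the strip `0 ≤ Im z ≤ p`: it is
analytic for `0 ≤ Im z ≤ ε`. -/
structure StripContinuation (g : ℝ → ℝ) (gc : ℂ → ℂ) (p ε : ℝ) : Prop where
  eps_pos : 0 < ε
  eps_le : ε ≤ p
  eq_real : ∀ x : ℝ, gc x = g x
  meromorphic : ∀ z : ℂ, 0 ≤ z.im → MeromorphicNFAt gc z
  analytic_low : ∀ z : ℂ, 0 ≤ z.im → z.im ≤ ε → AnalyticAt ℂ gc z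
  far : ∃ Y : ℝ, (∀ z : ℂ, 0 ≤ z.im → z.im ≤ p → Y ≤ |z.re| → AnalyticAt ℂ gc z) ∧
    ∀ γ : ℝ, ∃ C : ℝ, ∀ z : ℂ, 0 ≤ z.im → z.im ≤ p → Y ≤ |z.re| →
      ‖gc z‖ ≤ C * Real.exp (-γ * ‖z‖)

theorem isCompact_box (c₁ c₂ Y : ℝ) : IsCompact {z : ℂ | c₁ ≤ z.im ∧ z.im ≤ c₂ ∧ |z.re| ≤ Y} := by
  refine Metric.isCompact_of_isClosed_isBounded ?_ ?_
  · exact (isClosed_le continuous_const Complex.continuous_im).inter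
      ((isClosed_le Complex.continuous_im continuous_const).inter
        (isClosed_le Complex.continuous_re.abs continuous_const))
  · refine (Metric.isBounded_closedBall (x := (0 : ℂ)) (r := Y + (|c₁| + |c₂|))).subset ?_
    intro z hz
    rw [mem_closedBall_zero_iff]
    refine (Complex.norm_le_abs_re_add_abs_im z).trans (add_le_add hz.2.2 ?_)
    rw [abs_le]
    constructor
    · linarith [hz.1, neg_abs_le c₁, abs_nonneg c₂]
    · linarith [hz.2.1, le_abs_self c₂, abs_nonneg c₁]

theorem exists_stripContinuation {g : ℝ → ℝ} {gc : ℂ → ℂ} (hA1 : HasMeromorphicContinuation g gc)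
    (hA3 : DecaysInSectors gc) {p : ℝ} (hp : 0 < p) : ∃ ε, StripContinuation g gc p ε := by
  obtain ⟨-, hmero, hreal⟩ := hA1
  obtain ⟨δ, hδ, hdec⟩ := hA3
  obtain ⟨Y, hY, hsec⟩ := exists_forall_mem_sector hδ (p + 1)
  have hfar : ∀ z : ℂ, 0 ≤ z.im → z.im ≤ p → Y + 1 ≤ |z.re| → AnalyticAt ℂ gc z := by
    intro z h0 hzp hzY
    rcases h0.eq_or_lt with h | h
    · have hz : z = ((z.re : ℝ) : ℂ) := Complex.ext (by simp) (by simp [← h])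
      rw [hz]
      exact (hreal z.re).1
    · obtain ⟨C, hC, hb⟩ := hdec 1 one_pos
      refine analyticAt_of_bounded_of_meromorphicNFAt (hmero h0) (C := C) ?_
      refine Filter.Eventually.filter_mono nhdsWithin_le_nhds ?_
      have e1 : ∀ᶠ w : ℂ in 𝓝 z, 0 < w.im :=
        Complex.continuous_im.continuousAt.eventually_const_lt h
      have e2 : ∀ᶠ w : ℂ in 𝓝 z, w.im < p + 1 :=
        Complex.continuous_im.continuousAt.eventually_lt_const (by linarith)
      have e3 : ∀ᶠ w : ℂ in 𝓝 z, Y < |w.re| :=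
        Complex.continuous_re.abs.continuousAt.eventually_const_lt (by linarith)
      filter_upwards [e1, e2, e3] with w h1 h2 h3
      refine (hb w h1.le (hsec w h1.le h2.le h3.le)).le.trans ?_
      refine mul_le_of_le_one_right hC.le (Real.exp_le_one_iff.mpr ?_)
      have := norm_nonneg w
      linarith
  obtain ⟨ε₀, hε₀, hlow⟩ : ∃ ε₀ : ℝ, 0 < ε₀ ∧ ∀ z : ℂ, 0 ≤ z.im → z.im ≤ ε₀ → |z.re| ≤ Y + 1 →
      AnalyticAt ℂ gc z := by
    have hK := isCompact_box 0 0 (Y + 1)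
    have hsub : {z : ℂ | 0 ≤ z.im ∧ z.im ≤ 0 ∧ |z.re| ≤ Y + 1} ⊆ {z | AnalyticAt ℂ gc z} := by
      intro z hz
      have hz' : z = ((z.re : ℝ) : ℂ) := Complex.ext (by simp) (by simpa using le_antisymm hz.2.1 hz.1)
      rw [hz']
      exact (hreal z.re).1
    obtain ⟨ε₀, hε₀, hthick⟩ := hK.exists_cthickening_subset_open (isOpen_analyticAt ℂ gc) hsub
    refine ⟨ε₀, hε₀, fun z h0 h1 h2 => hthick ?_⟩
    refine Metric.mem_cthickening_of_dist_le z ((z.re : ℝ) : ℂ) ε₀ _ (by simpa using h2) ?_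
    rw [dist_eq_norm]
    have : z - ((z.re : ℝ) : ℂ) = z.im * I := by
      conv_lhs => lhs; rw [← Complex.re_add_im z]
      ring
    rw [this]
    simpa [abs_of_nonneg h0] using h1
  refine ⟨min ε₀ p, lt_min hε₀ hp, min_le_right _ _, fun x => (hreal x).2, fun z hz => hmero hz,
    fun z h0 h1 => ?_, Y + 1, hfar, fun γ => ?_⟩
  · rcases le_total |z.re| (Y + 1) with h | h
    · exact hlow z h0 (h1.trans (min_le_left _ _)) h
    · exact hfar z h0 (h1.trans (min_le_right _ _)) h
  · obtain ⟨C, hC, hb⟩ := hdec (max γ 1) (lt_of_lt_of_le one_pos (le_max_right _ _))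
    refine ⟨C, fun z h0 h1 h2 => ?_⟩
    refine (hb z h0 (hsec z h0 (by linarith) (by linarith))).le.trans ?_
    gcongr
    exact le_max_left _ _

/-- Functions holomorphic and of exponential growth in a neighbourhood of the closed strip. -/
def ExpHolomorphic (p : ℝ) (h : ℂ → ℂ) : Prop :=
  ∃ η : ℝ, 0 < η ∧ ∃ A β : ℝ, DifferentiableOn ℂ h (openStrip p η) ∧
    ∀ z ∈ openStrip p η, ‖h z‖ ≤ A * Real.exp (β * ‖z‖)

theorem ExpHolomorphic.one (p : ℝ) : ExpHolomorphic p fun _ => 1 :=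
  ⟨1, one_pos, 1, 0, differentiableOn_const 1, fun z _ => by simp⟩

theorem ExpHolomorphic.mul {p : ℝ} {h k : ℂ → ℂ} (hh : ExpHolomorphic p h)
    (hk : ExpHolomorphic p k) : ExpHolomorphic p fun z => h z * k z := by
  obtain ⟨η, hη, A, β, d, b⟩ := hh
  obtain ⟨η', hη', A', β', d', b'⟩ := hk
  have s1 := openStrip_mono (p := p) (min_le_left η η')
  have s2 := openStrip_mono (p := p) (min_le_right η η')
  refine ⟨min η η', lt_min hη hη', A * A', β + β', (d.mono s1).mul (d'.mono s2), fun z hz => ?_⟩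
  rw [norm_mul, add_mul, Real.exp_add]
  calc ‖h z‖ * ‖k z‖ ≤ (A * Real.exp (β * ‖z‖)) * (A' * Real.exp (β' * ‖z‖)) :=
        mul_le_mul (b z (s1 hz)) (b' z (s2 hz)) (norm_nonneg _)
          ((norm_nonneg _).trans (b z (s1 hz)))
    _ = _ := by ring

theorem isOpen_openStrip (p η : ℝ) : IsOpen (openStrip p η) :=
  (isOpen_lt continuous_const Complex.continuous_im).inter
    (isOpen_lt Complex.continuous_im continuous_const)

theorem strip_subset_openStrip {p η : ℝ} (hη : 0 < η) : strip p 0 ⊆ openStrip p η :=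
  fun z hz => ⟨by linarith [hz.1], by linarith [hz.2]⟩

theorem mem_strip_zero {p : ℝ} {z : ℂ} : z ∈ strip p 0 ↔ 0 ≤ z.im ∧ z.im ≤ p := by
  simp [strip]

theorem ExpHolomorphic.analyticAt {p : ℝ} {h : ℂ → ℂ} (hh : ExpHolomorphic p h) {z : ℂ}
    (h0 : 0 ≤ z.im) (hp : z.im ≤ p) : AnalyticAt ℂ h z := by
  obtain ⟨η, hη, A, β, d, b⟩ := hh
  exact d.analyticAt ((isOpen_openStrip p η).mem_nhds
    (strip_subset_openStrip hη (mem_strip_zero.mpr ⟨h0, hp⟩)))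

theorem ExpHolomorphic.bound {p : ℝ} {h : ℂ → ℂ} (hh : ExpHolomorphic p h) :
    ∃ A β : ℝ, ∀ z : ℂ, 0 ≤ z.im → z.im ≤ p → ‖h z‖ ≤ A * Real.exp (β * ‖z‖) := by
  obtain ⟨η, hη, A, β, d, b⟩ := hh
  exact ⟨A, β, fun z h0 hp => b z (strip_subset_openStrip hη (mem_strip_zero.mpr ⟨h0, hp⟩))⟩

variable {g : ℝ → ℝ} {gc : ℂ → ℂ} {p ε : ℝ}

/-- Decay of `h gc` in a closed substrip without poles. -/
theorem StripContinuation.exists_decay (hs : StripContinuation g gc p ε) {h : ℂ → ℂ}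
    (hh : ExpHolomorphic p h) {c₁ c₂ : ℝ} (h1 : 0 ≤ c₁) (h2 : c₂ ≤ p)
    (han : ∀ z : ℂ, c₁ ≤ z.im → z.im ≤ c₂ → AnalyticAt ℂ gc z) (γ : ℝ) :
    ∃ C : ℝ, ∀ z : ℂ, c₁ ≤ z.im → z.im ≤ c₂ → ‖h z * gc z‖ ≤ C * Real.exp (-γ * ‖z‖) := by
  obtain ⟨Y, -, hY⟩ := hs.far
  obtain ⟨A, β, hb⟩ := hh.bound
  obtain ⟨C, hC⟩ := hY (γ + β)
  have hcont : ContinuousOn (fun z => ‖h z * gc z‖ * Real.exp (γ * ‖z‖))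
      {z : ℂ | c₁ ≤ z.im ∧ z.im ≤ c₂ ∧ |z.re| ≤ Y} := by
    intro z hz
    have a1 := (hh.analyticAt (h1.trans hz.1) (hz.2.1.trans h2)).continuousAt
    have a2 := (han z hz.1 hz.2.1).continuousAt
    refine ContinuousAt.continuousWithinAt ?_
    exact (a1.mul a2).norm.mul (by fun_prop)
  obtain ⟨B, hB⟩ := (isCompact_box c₁ c₂ Y).bddAbove_image hcont
  refine ⟨max B (A * C), fun z hz1 hz2 => ?_⟩
  rcases le_total |z.re| Y with hre | hre
  · have := hB (Set.mem_image_of_mem _ ⟨hz1, hz2, hre⟩)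
    have h3 : ‖h z * gc z‖ * Real.exp (γ * ‖z‖) ≤ max B (A * C) := this.trans (le_max_left _ _)
    rw [neg_mul, Real.exp_neg]
    exact (le_mul_inv_iff₀ (Real.exp_pos _)).mpr h3
  · have b1 := hb z (h1.trans hz1) (hz2.trans h2)
    have b2 := hC z (h1.trans hz1) (hz2.trans h2) hre
    rw [norm_mul]
    calc ‖h z‖ * ‖gc z‖ ≤ (A * Real.exp (β * ‖z‖)) * (C * Real.exp (-(γ + β) * ‖z‖)) :=
          mul_le_mul b1 b2 (norm_nonneg _) ((norm_nonneg _).trans b1)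
      _ = A * C * (Real.exp (β * ‖z‖) * Real.exp (-(γ + β) * ‖z‖)) := by ring
      _ = A * C * Real.exp (-γ * ‖z‖) := by rw [← Real.exp_add]; congr 2; ring
      _ ≤ _ := by gcongr; exact le_max_right _ _

theorem norm_add_mul_I_ge (ω c : ℝ) : |ω| ≤ ‖(ω + c * I : ℂ)‖ := by
  simpa using Complex.abs_re_le_norm (ω + c * I : ℂ)

/-- The restriction of `h gc` to a horizontal line without poles decays rapidly. -/
theorem StripContinuation.rapidDecay (hs : StripContinuation g gc p ε) {h : ℂ → ℂ}
    (hh : ExpHolomorphic p h) {c : ℝ} (h1 : 0 ≤ c) (h2 : c ≤ p)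
    (han : ∀ z : ℂ, z.im = c → AnalyticAt ℂ gc z) :
    RapidDecay fun ω : ℝ => h (ω + c * I) * gc (ω + c * I) := by
  constructor
  · rw [continuous_iff_continuousAt]
    intro ω
    have a1 := (hh.analyticAt (z := ω + c * I) (by simpa) (by simpa)).continuousAt
    have a2 := (han (ω + c * I) (by simp)).continuousAt
    exact ContinuousAt.comp (f := fun ω : ℝ => (ω + c * I : ℂ)) (a1.mul a2) (by fun_prop)
  · intro γ
    obtain ⟨C, hC⟩ := hs.exists_decay hh h1 h2
      (fun z hz1 hz2 => han z (le_antisymm hz2 hz1)) |γ|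
    refine ⟨C, fun ω => ?_⟩
    have hz := hC (ω + c * I) (by simp) (by simp)
    have hCnn : 0 ≤ C := by
      have := (norm_nonneg _).trans hz
      exact nonneg_of_mul_nonneg_left this (Real.exp_pos _)
    refine hz.trans ?_
    gcongr C * Real.exp ?_
    have e1 := norm_add_mul_I_ge ω c
    have e2 : |γ| * |ω| ≤ |γ| * ‖(ω + c * I : ℂ)‖ := by gcongr
    have e3 : γ * |ω| ≤ |γ| * |ω| := by gcongr; exact le_abs_self γ
    linarith

/-- The restriction of `h g` to the real line. -/
theorem StripContinuation.rapidDecay_real (hs : StripContinuation g gc p ε) {h : ℂ → ℂ}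
    (hh : ExpHolomorphic p h) : RapidDecay fun ω : ℝ => h ω * g ω := by
  have := hs.rapidDecay hh le_rfl (hs.eps_pos.le.trans hs.eps_le)
    (fun z hz => hs.analytic_low z hz.ge (hz.le.trans hs.eps_pos.le))
  simpa [hs.eq_real] using this

theorem StripContinuation.rapidDecay_eps (hs : StripContinuation g gc p ε) {h : ℂ → ℂ}
    (hh : ExpHolomorphic p h) : RapidDecay fun ω : ℝ => h (ω + ε * I) * gc (ω + ε * I) :=
  hs.rapidDecay hh hs.eps_pos.le hs.eps_le
    (fun z hz => hs.analytic_low z (hs.eps_pos.le.trans hz.ge) hz.le)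

end Kuramoto

namespace Kuramoto

/-! ### Continuation of Cauchy transforms across the imaginary axis -/

theorem hasDerivAt_I_mul_log_sub {lam : ℂ} (h : 0 < lam.re) (y : ℝ) :
    HasDerivAt (fun y : ℝ => I * Complex.log (lam - I * y)) (1 / (lam - I * y)) y := by
  have hs : lam - I * y ∈ Complex.slitPlane := Or.inl (by simpa using h)
  have h1 : HasDerivAt (fun w : ℂ => I * Complex.log (lam - I * w))
      (I * ((-(I * 1)) / (lam - I * y))) (y : ℂ) :=
    ((((hasDerivAt_id _).const_mul I).const_sub lam).clog hs).const_mul I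
  refine h1.comp_ofReal.congr_deriv ?_
  rw [mul_one, ← mul_div_assoc, mul_neg, I_mul_I, neg_neg]

theorem tendsto_integral_inv_sub_of_pos {lam : ℂ} (h : 0 < lam.re) :
    Tendsto (fun T : ℝ => ∫ y in (-T)..T, 1 / (lam - I * y)) atTop (𝓝 Real.pi) := by
  have hcont : Continuous fun y : ℝ => 1 / (lam - I * y) :=
    continuous_const.div (by fun_prop) (sub_I_mul_ne_zero h.ne')
  have e1 : ∀ T : ℝ, ∫ y in (-T)..T, 1 / (lam - I * y) =
      I * Complex.log (lam - I * T) - I * Complex.log (lam + I * T) := by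
    intro T
    rw [intervalIntegral.integral_eq_sub_of_hasDerivAt
      (fun y _ => hasDerivAt_I_mul_log_sub h y) (hcont.intervalIntegrable _ _)]
    push_cast
    rw [mul_neg, sub_neg_eq_add]
  simp_rw [e1]
  have hinv : Tendsto (fun T : ℝ => lam / (T : ℂ)) atTop (𝓝 0) := by
    have : Tendsto (fun T : ℝ => ((T⁻¹ : ℝ) : ℂ)) atTop (𝓝 ((0 : ℝ) : ℂ)) :=
      (Complex.continuous_ofReal.tendsto _).comp tendsto_inv_atTop_zero
    simpa [div_eq_mul_inv] using this.const_mul lam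
  have l1 : Tendsto (fun T : ℝ => Complex.log (lam / T - I)) atTop (𝓝 (Complex.log (0 - I))) :=
    (hinv.sub_const I).clog (Or.inr (by simp))
  have l2 : Tendsto (fun T : ℝ => Complex.log (lam / T + I)) atTop (𝓝 (Complex.log (0 + I))) :=
    (hinv.add_const I).clog (Or.inr (by simp))
  have hlim := (l1.const_mul I).sub (l2.const_mul I)
  have hval : I * Complex.log (0 - I) - I * Complex.log (0 + I) = (Real.pi : ℂ) := by
    rw [zero_sub, zero_add, Complex.log_neg_I, Complex.log_I]
    linear_combination (-(Real.pi : ℂ)) * I_mul_I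
  rw [hval] at hlim
  refine hlim.congr' ?_
  filter_upwards [eventually_gt_atTop 0] with T hT
  have hT0 : (T : ℂ) ≠ 0 := by exact_mod_cast hT.ne'
  have aux : ∀ w : ℂ, w ≠ 0 → Complex.log (T * w) = Real.log T + Complex.log w :=
    fun w hw => Complex.log_ofReal_mul hT hw
  have n1 : lam / T - I ≠ 0 := fun h0 => by
    have : ((T : ℂ) * (lam / T - I)).re = 0 := by rw [h0, mul_zero, zero_re]
    rw [mul_sub, mul_div_cancel₀ _ hT0] at this
    simp at this; linarith
  have n2 : lam / T + I ≠ 0 := fun h0 => by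
    have : ((T : ℂ) * (lam / T + I)).re = 0 := by rw [h0, mul_zero, zero_re]
    rw [mul_add, mul_div_cancel₀ _ hT0] at this
    simp at this; linarith
  have m1 : lam - I * T = T * (lam / T - I) := by field_simp
  have m2 : lam + I * T = T * (lam / T + I) := by field_simp
  rw [m1, m2, aux _ n1, aux _ n2]
  ring

theorem tendsto_integral_inv_sub_of_neg {lam : ℂ} (h : lam.re < 0) :
    Tendsto (fun T : ℝ => ∫ y in (-T)..T, 1 / (lam - I * y)) atTop (𝓝 (-Real.pi)) := by
  have h1 := (tendsto_integral_inv_sub_of_pos (lam := -lam) (by simpa using h)).neg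
  refine h1.congr fun T => ?_
  have := intervalIntegral.integral_comp_neg (a := -T) (b := T)
    (fun y : ℝ => 1 / (lam - I * y))
  rw [neg_neg] at this
  rw [← this, ← intervalIntegral.integral_neg]
  refine intervalIntegral.integral_congr fun y _ => ?_
  rw [show lam - I * ((-y : ℝ) : ℂ) = -(-lam - I * y) by push_cast; ring, div_neg]

theorem tendsto_neg_prodMk_atTop :
    Tendsto (fun T : ℝ => (-T, T)) atTop (atBot ×ˢ atTop) :=
  tendsto_neg_atTop_atBot.prodMk tendsto_id

theorem tendsto_symm_integral {u : ℝ → ℂ} (hu : Integrable u) :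
    Tendsto (fun T : ℝ => ∫ y in (-T)..T, u y) atTop (𝓝 (∫ y, u y)) :=
  intervalIntegral_tendsto_integral hu tendsto_neg_atTop_atBot tendsto_id

/-- Decay of quotients in a vertical strip. -/
theorem exists_norm_le_of_norm_mul_le {k : ℂ → ℂ} {lam : ℂ} {c₁ c₂ B : ℝ}
    (h : ∀ z : ℂ, c₁ ≤ z.re → z.re ≤ c₂ → ‖k z‖ * ‖lam - z‖ ≤ B) (δ : ℝ) (hδ : 0 < δ) :
    ∃ Y : ℝ, ∀ z : ℂ, c₁ ≤ z.re → z.re ≤ c₂ → Y ≤ |z.im| → ‖k z‖ ≤ δ := by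
  refine ⟨|lam.im| + (|B| / δ + 1), fun z h1 h2 hY => ?_⟩
  have e1 : |z.im| - |lam.im| ≤ ‖lam - z‖ := by
    have := Complex.abs_im_le_norm (lam - z)
    rw [Complex.sub_im] at this
    have h3 := abs_sub_abs_le_abs_sub z.im lam.im
    rw [abs_sub_comm] at h3
    linarith
  have e2 : |B| / δ + 1 ≤ ‖lam - z‖ := by linarith
  have e3 : |B| / δ < ‖lam - z‖ := by linarith
  rw [div_lt_iff₀ hδ] at e3
  by_contra hcon
  push Not at hcon
  have hpos : 0 < ‖lam - z‖ := lt_of_lt_of_le (by positivity) e2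
  have := h z h1 h2
  have e4 : δ * ‖lam - z‖ < ‖k z‖ * ‖lam - z‖ := by gcongr
  linarith [le_abs_self B]

variable {g : ℝ → ℝ} {gc : ℂ → ℂ} {p ε : ℝ}

/-- The continuation of `λ ↦ ∫ h(ω) g(ω) / (λ - iω) dω` from the right half plane, obtained for
`-ε < Re λ` by moving the line of integration to `Im z = ε`. -/
noncomputable def continuedTransform (g : ℝ → ℝ) (gc : ℂ → ℂ) (ε : ℝ) (h : ℂ → ℂ) (lam : ℂ) : ℂ :=
  if -ε < lam.re then
    cauchyTransform (fun ω : ℝ => h (ω + ε * I) * gc (ω + ε * I)) (lam + ε)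
  else cauchyTransform (fun ω : ℝ => h ω * g ω) lam +
    2 * Real.pi * (h (-I * lam) * gc (-I * lam))

theorem neg_I_mul_im (z : ℂ) : (-I * z).im = -z.re := by simp
theorem neg_I_mul_re (z : ℂ) : (-I * z).re = z.im := by simp
theorem norm_neg_I_mul (z : ℂ) : ‖-I * z‖ = ‖z‖ := by simp

theorem ExpHolomorphic.analyticAt_rotate {h : ℂ → ℂ}
    (hh : ExpHolomorphic p h) {z : ℂ} (h0 : z.re ≤ 0) (hp : -p ≤ z.re)
    (han : AnalyticAt ℂ gc (-I * z)) : AnalyticAt ℂ (fun z => h (-I * z) * gc (-I * z)) z := by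
  have hlin : AnalyticAt ℂ (fun z : ℂ => -I * z) z := analyticAt_const.mul analyticAt_id
  have a1 := hh.analyticAt (z := -I * z) (by rw [neg_I_mul_im]; linarith)
    (by rw [neg_I_mul_im]; linarith)
  exact (AnalyticAt.comp (g := h) a1 hlin).mul (AnalyticAt.comp (g := gc) han hlin)

theorem StripContinuation.analytic_low_rotate (hs : StripContinuation g gc p ε) {z : ℂ}
    (h0 : z.re ≤ 0) (hε : -ε ≤ z.re) : AnalyticAt ℂ gc (-I * z) :=
  hs.analytic_low _ (by rw [neg_I_mul_im]; linarith) (by rw [neg_I_mul_im]; linarith)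

theorem StripContinuation.exists_bound_rotate (hs : StripContinuation g gc p ε) {h : ℂ → ℂ}
    (hh : ExpHolomorphic p h) :
    ∃ B : ℝ, ∀ z : ℂ, -ε ≤ z.re → z.re ≤ 0 → ‖h (-I * z) * gc (-I * z)‖ ≤ B := by
  obtain ⟨C, hC⟩ := hs.exists_decay hh le_rfl hs.eps_le hs.analytic_low 0
  exact ⟨C, fun z h1 h2 => by
    simpa using hC (-I * z) (by rw [neg_I_mul_im]; linarith) (by rw [neg_I_mul_im]; linarith)⟩

theorem StripContinuation.cauchyTransform_shift_of_pos (hs : StripContinuation g gc p ε)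
    {h : ℂ → ℂ} (hh : ExpHolomorphic p h) {lam : ℂ} (hlam : 0 < lam.re) :
    cauchyTransform (fun ω : ℝ => h (ω + ε * I) * gc (ω + ε * I)) (lam + ε) =
      cauchyTransform (fun ω : ℝ => h ω * g ω) lam := by
  have hε := hs.eps_pos
  have hεp := hs.eps_le
  obtain ⟨B, hB⟩ := hs.exists_bound_rotate hh
  have hne : ∀ z : ℂ, z.re ≤ 0 → lam - z ≠ 0 := fun z hz h0 => by
    have : (lam - z).re = 0 := by rw [h0, zero_re]
    rw [sub_re] at this
    linarith
  have hd : ∀ z : ℂ, -ε ≤ z.re → z.re ≤ 0 →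
      DifferentiableAt ℂ (fun z => h (-I * z) * gc (-I * z) / (lam - z)) z := fun z h1 h2 =>
    (hh.analyticAt_rotate h2 (by linarith) (hs.analytic_low_rotate h2 h1)).differentiableAt.div
      (by fun_prop) (hne z h2)
  have hv := tendsto_integral_vertical_sub (c₁ := -ε) (c₂ := 0)
    (k := fun z => h (-I * z) * gc (-I * z) / (lam - z)) (by linarith)
    (fun z hz => (hd z hz.1 hz.2).continuousAt.continuousWithinAt)
    (fun z h1 h2 => hd z h1.le h2.le)
    (fun δ hδ => exists_norm_le_of_norm_mul_le (B := B) (lam := lam) (fun z h1 h2 => by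
      rw [norm_div, div_mul_cancel₀ _ (norm_ne_zero_iff.mpr (hne z h2))]
      exact hB z h1 h2) δ hδ)
  have hv' := hv.comp tendsto_neg_prodMk_atTop
  have i0 := (tendsto_symm_integral (integrable_div_sub (hs.rapidDecay_real hh).integrable
    hlam.ne')).sub (tendsto_symm_integral (integrable_div_sub (lam := lam + ε)
      (hs.rapidDecay_eps hh).integrable (by simp; linarith)))
  have := tendsto_nhds_unique (i0.congr fun T => ?_) hv'
  · exact (sub_eq_zero.mp this).symm
  · simp only [Function.comp]
    congr 1
    · refine intervalIntegral.integral_congr fun y _ => ?_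
      rw [show -I * ((0 : ℝ) + I * y : ℂ) = y by push_cast; linear_combination (-y : ℂ) * I_mul_I,
        hs.eq_real]
      simp
    · refine intervalIntegral.integral_congr fun y _ => ?_
      rw [show -I * ((-ε : ℝ) + I * y : ℂ) = y + ε * I by
        push_cast; linear_combination (-y : ℂ) * I_mul_I]
      congr 1
      push_cast; ring

theorem StripContinuation.cauchyTransform_shift_of_neg (hs : StripContinuation g gc p ε)
    {h : ℂ → ℂ} (hh : ExpHolomorphic p h) {lam : ℂ} (hlam : lam.re < 0) (hlam' : -ε < lam.re) :
    cauchyTransform (fun ω : ℝ => h (ω + ε * I) * gc (ω + ε * I)) (lam + ε) =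
      cauchyTransform (fun ω : ℝ => h ω * g ω) lam +
        2 * Real.pi * (h (-I * lam) * gc (-I * lam)) := by
  have hε := hs.eps_pos
  have hεp := hs.eps_le
  obtain ⟨B, hB⟩ := hs.exists_bound_rotate hh
  set f : ℂ → ℂ := fun z => h (-I * z) * gc (-I * z) with hf
  have hfd : ∀ z : ℂ, -ε ≤ z.re → z.re ≤ 0 → AnalyticAt ℂ f z := fun z h1 h2 =>
    hh.analyticAt_rotate h2 (by linarith) (hs.analytic_low_rotate h2 h1)
  have hdiff : DifferentiableOn ℂ f {z | -ε < z.re ∧ z.re < 0} := fun z hz =>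
    (hfd z hz.1.le hz.2.le).differentiableAt.differentiableWithinAt
  have hopen : IsOpen {z : ℂ | -ε < z.re ∧ z.re < 0} :=
    (isOpen_lt continuous_const Complex.continuous_re).inter
      (isOpen_lt Complex.continuous_re continuous_const)
  have hd1 : DifferentiableOn ℂ (dslope f lam) {z | -ε < z.re ∧ z.re < 0} :=
    (Complex.differentiableOn_dslope (hopen.mem_nhds ⟨hlam', hlam⟩)).mpr hdiff
  have hslope : ∀ z : ℂ, z ≠ lam → -dslope f lam z = (f z - f lam) / (lam - z) := fun z hz => by
    rw [dslope_of_ne _ hz, slope_def_field, ← div_neg, neg_sub]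
  have hnelam : ∀ z : ℂ, z.re ≠ lam.re → z ≠ lam := fun z hz h0 => hz (by rw [h0])
  have hv := tendsto_integral_vertical_sub (c₁ := -ε) (c₂ := 0)
    (k := fun z => -dslope f lam z) (by linarith) ?_
    (fun z h1 h2 => (hd1.differentiableAt (hopen.mem_nhds ⟨h1, h2⟩)).neg)
    (fun δ hδ => exists_norm_le_of_norm_mul_le (B := B + B) (lam := lam) (fun z h1 h2 => ?_) δ hδ)
  · have hv' := hv.comp tendsto_neg_prodMk_atTop
    have a1 := integrable_div_sub (hs.rapidDecay_real hh).integrable hlam.ne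
    have hre : (lam + ε).re ≠ 0 := by simp; linarith
    have hre' : 0 < (lam + ε).re := by simp; linarith
    have a2 := integrable_div_sub (lam := lam + ε) (hs.rapidDecay_eps hh).integrable hre
    have b1 : Continuous fun y : ℝ => 1 / (lam - I * y) :=
      continuous_const.div (by fun_prop) (sub_I_mul_ne_zero hlam.ne)
    have b2 : Continuous fun y : ℝ => 1 / (lam + ε - I * y) :=
      continuous_const.div (by fun_prop) (sub_I_mul_ne_zero hre)
    have i1 := (tendsto_symm_integral a1).sub
      ((tendsto_integral_inv_sub_of_neg hlam).const_mul (f lam))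
    have i2 := (tendsto_symm_integral a2).sub
      ((tendsto_integral_inv_sub_of_pos hre').const_mul (f lam))
    have := tendsto_nhds_unique ((i1.sub i2).congr fun T => ?_) hv'
    · unfold cauchyTransform
      linear_combination -this
    · simp only [Function.comp]
      rw [← intervalIntegral.integral_const_mul, ← intervalIntegral.integral_const_mul,
        ← intervalIntegral.integral_sub a1.intervalIntegrable
          ((b1.const_mul _).intervalIntegrable _ _),
        ← intervalIntegral.integral_sub a2.intervalIntegrable
          ((b2.const_mul _).intervalIntegrable _ _)]
      congr 1
      · refine intervalIntegral.integral_congr fun y _ => ?_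
        rw [hslope _ (hnelam _ (by simpa using hlam.ne'))]
        simp only [hf]
        rw [show -I * ((0 : ℝ) + I * y : ℂ) = y by
          push_cast; linear_combination (-y : ℂ) * I_mul_I, hs.eq_real]
        rw [mul_one_div, ← sub_div]
        simp
      · refine intervalIntegral.integral_congr fun y _ => ?_
        rw [hslope _ (hnelam _ (by simpa using hlam'.ne))]
        simp only [hf]
        rw [show -I * ((-ε : ℝ) + I * y : ℂ) = y + ε * I by
          push_cast; linear_combination (-y : ℂ) * I_mul_I]
        rw [mul_one_div, ← sub_div]
        congr 1
        push_cast; ring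
  · intro z hz
    refine ContinuousAt.continuousWithinAt (ContinuousAt.neg ?_)
    by_cases hzl : z = lam
    · rw [hzl, continuousAt_dslope_same]
      exact (hfd lam hlam'.le hlam.le).differentiableAt
    · rw [continuousAt_dslope_of_ne hzl]
      exact (hfd z hz.1 hz.2).continuousAt
  · by_cases hzl : z = lam
    · rw [hzl, sub_self, norm_zero, mul_zero]
      have := (norm_nonneg _).trans (hB z h1 h2)
      linarith
    · have hne : ‖lam - z‖ ≠ 0 := norm_ne_zero_iff.mpr (sub_ne_zero.mpr (Ne.symm hzl))
      rw [hslope z hzl, norm_div, div_mul_cancel₀ _ hne]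
      exact (norm_sub_le _ _).trans (add_le_add (hB z h1 h2) (hB lam hlam'.le hlam.le))

theorem StripContinuation.continuedTransform_of_pos (hs : StripContinuation g gc p ε)
    {h : ℂ → ℂ} (hh : ExpHolomorphic p h) {lam : ℂ} (hlam : 0 < lam.re) :
    continuedTransform g gc ε h lam = cauchyTransform (fun ω : ℝ => h ω * g ω) lam := by
  have := hs.eps_pos
  rw [continuedTransform, if_pos (by linarith), hs.cauchyTransform_shift_of_pos hh hlam]

theorem StripContinuation.continuedTransform_of_neg (hs : StripContinuation g gc p ε)
    {h : ℂ → ℂ} (hh : ExpHolomorphic p h) {lam : ℂ} (hlam : lam.re < 0) :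
    continuedTransform g gc ε h lam = cauchyTransform (fun ω : ℝ => h ω * g ω) lam +
      2 * Real.pi * (h (-I * lam) * gc (-I * lam)) := by
  rw [continuedTransform]
  split_ifs with h1
  · exact hs.cauchyTransform_shift_of_neg hh hlam h1
  · rfl

theorem StripContinuation.analyticAt_continuedTransform_right (hs : StripContinuation g gc p ε)
    {h : ℂ → ℂ} (hh : ExpHolomorphic p h) {lam : ℂ} (hlam : -ε < lam.re) :
    AnalyticAt ℂ (continuedTransform g gc ε h) lam := by
  have h1 : AnalyticAt ℂ (cauchyTransform (fun ω : ℝ => h (ω + ε * I) * gc (ω + ε * I)))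
      (lam + ε) := analyticAt_cauchyTransform (hs.rapidDecay_eps hh).integrable (by simp; linarith)
  have h2 : AnalyticAt ℂ (fun z : ℂ => z + ε) lam := analyticAt_id.add analyticAt_const
  refine (AnalyticAt.comp (f := fun z : ℂ => z + ε) h1 h2).congr ?_
  filter_upwards [Complex.continuous_re.continuousAt.eventually_const_lt hlam] with z hz
  simp only [Function.comp, continuedTransform]
  rw [if_pos hz]

theorem StripContinuation.continuedTransform_eventuallyEq (hs : StripContinuation g gc p ε)
    {h : ℂ → ℂ} (hh : ExpHolomorphic p h) {lam : ℂ} (hlam : lam.re < 0) :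
    continuedTransform g gc ε h =ᶠ[𝓝 lam] fun lam =>
      cauchyTransform (fun ω : ℝ => h ω * g ω) lam +
      2 * Real.pi * (h (-I * lam) * gc (-I * lam)) := by
  filter_upwards [Complex.continuous_re.continuousAt.eventually_lt_const hlam] with z hz
  exact hs.continuedTransform_of_neg hh hz

theorem StripContinuation.analyticAt_continuedTransform (hs : StripContinuation g gc p ε)
    {h : ℂ → ℂ} (hh : ExpHolomorphic p h) {lam : ℂ} (hp : -p ≤ lam.re)
    (han : lam.re ≤ 0 → AnalyticAt ℂ gc (-I * lam)) :
    AnalyticAt ℂ (continuedTransform g gc ε h) lam := by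
  rcases lt_or_ge lam.re 0 with h1 | h1
  · refine AnalyticAt.congr ?_ (hs.continuedTransform_eventuallyEq hh h1).symm
    exact (analyticAt_cauchyTransform (hs.rapidDecay_real hh).integrable h1.ne).add
      (analyticAt_const.mul (hh.analyticAt_rotate h1.le hp (han h1.le)))
  · exact hs.analyticAt_continuedTransform_right hh (by linarith [hs.eps_pos])

theorem StripContinuation.meromorphicAt_continuedTransform (hs : StripContinuation g gc p ε)
    {h : ℂ → ℂ} (hh : ExpHolomorphic p h) {lam : ℂ} (hp : -p ≤ lam.re) :
    MeromorphicAt (continuedTransform g gc ε h) lam := by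
  rcases lt_or_ge lam.re 0 with h1 | h1
  · refine MeromorphicAt.congr ?_ ((hs.continuedTransform_eventuallyEq hh h1).symm.filter_mono
      nhdsWithin_le_nhds)
    have hlin : AnalyticAt ℂ (fun z : ℂ => -I * z) lam := analyticAt_const.mul analyticAt_id
    have a1 := hh.analyticAt (z := -I * lam) (by rw [neg_I_mul_im]; linarith)
      (by rw [neg_I_mul_im]; linarith)
    have a2 : MeromorphicAt gc (-I * lam) :=
      (hs.meromorphic _ (by rw [neg_I_mul_im]; linarith)).meromorphicAt
    have m1 := (AnalyticAt.comp (g := h) a1 hlin).meromorphicAt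
    have m2 := MeromorphicAt.comp_analyticAt (f := gc) (g := fun z : ℂ => -I * z) a2 hlin
    exact (analyticAt_cauchyTransform (hs.rapidDecay_real hh).integrable h1.ne).meromorphicAt.add
      ((MeromorphicAt.const _ _).mul (m1.mul m2))
  · exact (hs.analyticAt_continuedTransform_right hh (by linarith [hs.eps_pos])).meromorphicAt

theorem StripContinuation.exists_norm_mul_continuedTransform_le_right
    (hs : StripContinuation g gc p ε) {h : ℂ → ℂ} (hh : ExpHolomorphic p h) :
    ∃ C : ℝ, ∀ lam : ℂ, -(ε / 2) ≤ lam.re → ‖lam‖ * ‖continuedTransform g gc ε h lam‖ ≤ C := by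
  have hε := hs.eps_pos
  refine ⟨3 * ∫ ω : ℝ, ‖h (ω + ε * I) * gc (ω + ε * I)‖ * (1 + |ω| / (ε / 2)), fun lam hl => ?_⟩
  have hre : ε / 2 ≤ |(lam + ε).re| := by
    refine le_trans ?_ (le_abs_self _)
    simp; linarith
  have h1 := norm_mul_norm_cauchyTransform_le
    ((hs.rapidDecay_eps hh).integrable_one_add_abs_mul (ε / 2)) (by linarith) hre
  have h2 : ‖lam‖ ≤ 3 * ‖lam + ε‖ := by
    have e1 : ‖lam‖ ≤ ‖lam + ε‖ + ε := by
      calc ‖lam‖ = ‖(lam + ε) - ε‖ := by ring_nf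
        _ ≤ ‖lam + ε‖ + ‖(ε : ℂ)‖ := norm_sub_le _ _
        _ = _ := by rw [Complex.norm_real, Real.norm_of_nonneg hε.le]
    have e2 := hre.trans (Complex.abs_re_le_norm (lam + ε))
    linarith
  rw [continuedTransform, if_pos (by linarith)]
  calc _ ≤ (3 * ‖lam + ε‖) * _ := by gcongr
    _ ≤ _ := by rw [mul_assoc]; gcongr

theorem StripContinuation.exists_norm_mul_continuedTransform_le
    (hs : StripContinuation g gc p ε) {h : ℂ → ℂ} (hh : ExpHolomorphic p h) :
    ∃ C Y : ℝ, (∀ z : ℂ, 0 ≤ z.im → z.im ≤ p → Y ≤ |z.re| → AnalyticAt ℂ gc z) ∧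
      ∀ lam : ℂ, -p ≤ lam.re → Y ≤ |lam.im| →
        ‖lam‖ * ‖continuedTransform g gc ε h lam‖ ≤ C := by
  have hε := hs.eps_pos
  obtain ⟨C₁, hC₁⟩ := hs.exists_norm_mul_continuedTransform_le_right hh
  obtain ⟨Y, hYa, hY⟩ := hs.far
  obtain ⟨A, β, hb⟩ := hh.bound
  obtain ⟨C₃, hC₃⟩ := hY (β + 1)
  refine ⟨max C₁ ((∫ ω : ℝ, ‖h ω * g ω‖ * (1 + |ω| / (ε / 2))) + 2 * Real.pi * (A * C₃)), Y, hYa,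
    fun lam hp hlY => ?_⟩
  rcases le_total (-(ε / 2)) lam.re with h1 | h1
  · exact (hC₁ lam h1).trans (le_max_left _ _)
  · refine le_trans ?_ (le_max_right _ _)
    rw [hs.continuedTransform_of_neg hh (by linarith)]
    have e1 := norm_mul_norm_cauchyTransform_le
      ((hs.rapidDecay_real hh).integrable_one_add_abs_mul (ε / 2)) (by linarith) (lam := lam)
      (by rw [le_abs]; right; linarith)
    have z1 : 0 ≤ (-I * lam).im := by rw [neg_I_mul_im]; linarith
    have z2 : (-I * lam).im ≤ p := by rw [neg_I_mul_im]; linarith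
    have e2 := hb _ z1 z2
    have e3 := hC₃ _ z1 z2 (by rwa [neg_I_mul_re])
    rw [norm_neg_I_mul] at e2 e3
    have e4 : ‖h (-I * lam) * gc (-I * lam)‖ ≤ A * C₃ * Real.exp (-‖lam‖) := by
      rw [norm_mul]
      calc _ ≤ (A * Real.exp (β * ‖lam‖)) * (C₃ * Real.exp (-(β + 1) * ‖lam‖)) :=
            mul_le_mul e2 e3 (norm_nonneg _) ((norm_nonneg _).trans e2)
        _ = A * C₃ * (Real.exp (β * ‖lam‖) * Real.exp (-(β + 1) * ‖lam‖)) := by ring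
        _ = _ := by rw [← Real.exp_add]; congr 2; ring
    have hAC : 0 ≤ A * C₃ := nonneg_of_mul_nonneg_left ((norm_nonneg _).trans e4) (Real.exp_pos _)
    have e5 : ‖lam‖ * Real.exp (-‖lam‖) ≤ 1 := by
      rw [Real.exp_neg, mul_inv_le_iff₀ (Real.exp_pos _)]
      linarith [Real.add_one_le_exp ‖lam‖]
    calc _ ≤ ‖lam‖ * (‖cauchyTransform (fun ω : ℝ => h ω * g ω) lam‖ +
          2 * Real.pi * (A * C₃ * Real.exp (-‖lam‖))) := by
          gcongr
          refine (norm_add_le _ _).trans ?_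
          gcongr
          rw [norm_mul]
          have : ‖(2 * Real.pi : ℂ)‖ = 2 * Real.pi := by
            simp [abs_of_pos Real.pi_pos]
          rw [this]
          gcongr
      _ = ‖lam‖ * ‖cauchyTransform (fun ω : ℝ => h ω * g ω) lam‖ +
          2 * Real.pi * (A * C₃ * (‖lam‖ * Real.exp (-‖lam‖))) := by ring
      _ ≤ (∫ ω : ℝ, ‖h ω * g ω‖ * (1 + |ω| / (ε / 2))) + 2 * Real.pi * (A * C₃ * 1) := by
          gcongr
      _ = _ := by ring

end Kuramoto

namespace Kuramoto

/-! ### The dispersion function -/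

variable {g : ℝ → ℝ} {gc : ℂ → ℂ} {p ε : ℝ}

theorem D_eq_cauchyTransform (g : ℝ → ℝ) (lam : ℂ) :
    D g lam = cauchyTransform (fun ω : ℝ => 1 * g ω) lam := by
  simp [D, cauchyTransform]

/-- The continuation of `D` from the right half plane. -/
noncomputable def continuedD (g : ℝ → ℝ) (gc : ℂ → ℂ) (ε : ℝ) : ℂ → ℂ :=
  continuedTransform g gc ε fun _ => 1

theorem StripContinuation.D_of_pos (hs : StripContinuation g gc p ε) {lam : ℂ} (h : 0 < lam.re) :
    D g lam = continuedD g gc ε lam := by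
  rw [D_eq_cauchyTransform, continuedD, hs.continuedTransform_of_pos (ExpHolomorphic.one p) h]

theorem StripContinuation.D_add_of_neg (hs : StripContinuation g gc p ε) {lam : ℂ}
    (h : lam.re < 0) : D g lam + 2 * Real.pi * gc (-I * lam) = continuedD g gc ε lam := by
  rw [D_eq_cauchyTransform, continuedD, hs.continuedTransform_of_neg (ExpHolomorphic.one p) h,
    one_mul]

theorem tendsto_add_ofReal (lam : ℂ) : Tendsto (fun x : ℝ => lam + x) (𝓝 0) (𝓝 lam) := by
  have : ContinuousAt (fun x : ℝ => lam + x) 0 := by fun_prop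
  simpa [ContinuousAt] using this

theorem StripContinuation.tendsto_continuedTransform_add (hs : StripContinuation g gc p ε)
    {h : ℂ → ℂ} (hh : ExpHolomorphic p h) {lam : ℂ} (h0 : lam.re = 0) :
    Tendsto (fun x : ℝ => continuedTransform g gc ε h (lam + x)) (𝓝 0)
      (𝓝 (continuedTransform g gc ε h lam)) :=
  (hs.analyticAt_continuedTransform_right hh
    (by rw [h0]; linarith [hs.eps_pos])).continuousAt.tendsto.comp (tendsto_add_ofReal lam)

theorem StripContinuation.tendsto_D_right (hs : StripContinuation g gc p ε) {lam : ℂ}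
    (h : lam.re = 0) :
    Tendsto (fun x : ℝ => D g (lam + x)) (𝓝[>] 0) (𝓝 (continuedD g gc ε lam)) := by
  refine ((hs.tendsto_continuedTransform_add (ExpHolomorphic.one p) h).mono_left
    nhdsWithin_le_nhds).congr' ?_
  filter_upwards [self_mem_nhdsWithin] with x hx
  rw [hs.D_of_pos (by simpa [h] using hx), continuedD]

theorem StripContinuation.tendsto_D_left (hs : StripContinuation g gc p ε) {lam : ℂ}
    (h : lam.re = 0) :
    Tendsto (fun x : ℝ => D g (lam + x) + 2 * Real.pi * gc (-I * (lam + x))) (𝓝[<] 0)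
      (𝓝 (continuedD g gc ε lam)) := by
  refine ((hs.tendsto_continuedTransform_add (ExpHolomorphic.one p) h).mono_left
    nhdsWithin_le_nhds).congr' ?_
  filter_upwards [self_mem_nhdsWithin] with x hx
  rw [hs.D_add_of_neg (by simpa [h] using hx), continuedD]

theorem StripContinuation.Dcont_eq (hs : StripContinuation g gc p ε) :
    Dcont g gc = continuedD g gc ε := by
  ext lam
  rw [Dcont]
  split_ifs with h1 h2
  · exact hs.D_of_pos h1
  · exact hs.D_add_of_neg h2
  · exact (hs.tendsto_D_right (le_antisymm (not_lt.mp h1) (not_lt.mp h2))).limUnder_eq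

theorem StripContinuation.G_eq (hs : StripContinuation g gc p ε) (K : ℝ) :
    G K g gc = fun lam => 1 - (K / 2 : ℂ) * continuedD g gc ε lam := by
  ext lam
  rw [G, hs.Dcont_eq]

theorem StripContinuation.G_eq_zero_iff (hs : StripContinuation g gc p ε) {K : ℝ} (hK : K ≠ 0)
    (lam : ℂ) : G K g gc lam = 0 ↔ continuedD g gc ε lam = 2 / K := by
  have hK' : (K : ℂ) ≠ 0 := by exact_mod_cast hK
  rw [hs.G_eq, sub_eq_zero, eq_div_iff hK']
  constructor
  · intro h; linear_combination -2 * h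
  · intro h; linear_combination (-1 / 2 : ℂ) * h

theorem StripContinuation.analyticAt_of_re_eq_zero (hs : StripContinuation g gc p ε) {lam : ℂ}
    (h : lam.re = 0) : AnalyticAt ℂ gc (-I * lam) :=
  hs.analytic_low_rotate h.le (by rw [h]; linarith [hs.eps_pos])

theorem StripContinuation.isResonancePole_iff (hs : StripContinuation g gc p ε) {K : ℝ}
    (hK : K ≠ 0) (lam : ℂ) : IsResonancePole K g gc lam ↔
      lam.re ≤ 0 ∧ AnalyticAt ℂ gc (-I * lam) ∧ G K g gc lam = 0 := by
  rw [hs.G_eq_zero_iff hK]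
  constructor
  · rintro (⟨h1, h2, h3⟩ | ⟨h1, h2, -⟩)
    · exact ⟨h1.le, h2, by rw [← hs.D_add_of_neg h1, h3]⟩
    · exact ⟨h1.le, hs.analyticAt_of_re_eq_zero h1, tendsto_nhds_unique (hs.tendsto_D_right h1) h2⟩
  · rintro ⟨h1, h2, h3⟩
    rcases h1.lt_or_eq with h | h
    · exact Or.inl ⟨h, h2, by rw [hs.D_add_of_neg h, h3]⟩
    · exact Or.inr ⟨h, h3 ▸ hs.tendsto_D_right h, h3 ▸ hs.tendsto_D_left h⟩

theorem D_neg_conj (g : ℝ → ℝ) (x y : ℝ) :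
    D g (-x + I * y) = -conj (D g (x + I * y)) := by
  unfold D
  rw [← integral_conj, ← integral_neg]
  refine integral_congr_ae (Eventually.of_forall fun ω => ?_)
  simp only [map_div₀, map_sub, map_add, map_mul, conj_ofReal, conj_I]
  rw [← div_neg]
  congr 1
  ring

theorem im_D_eq (hg : Integrable g) {x : ℝ} (hx : 0 < x) (y : ℝ) :
    (D g (I * y + x)).im = ∫ ω : ℝ, (ω - y) / (x ^ 2 + (ω - y) ^ 2) * g ω := by
  have hi := integrable_div_sub hg.ofReal (lam := I * y + x) (by simpa using hx.ne')
  have := integral_im hi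
  simp only [RCLike.im_to_complex] at this
  rw [D]
  refine Eq.trans this.symm (integral_congr_ae (Eventually.of_forall fun ω => ?_))
  simp only [coe_algebraMap]
  rw [Complex.div_im, Complex.normSq_apply]
  simp
  ring

/-- On the imaginary axis the boundary value of `D` is `π g(y)` plus an imaginary number. -/
theorem StripContinuation.re_continuedD (hs : StripContinuation g gc p ε) (y : ℝ) :
    (continuedD g gc ε (I * y)).re = Real.pi * g y := by
  have h0 : (I * y : ℂ).re = 0 := by simp
  have h1 := hs.tendsto_D_right h0
  have h2 := (hs.tendsto_D_left h0).comp (tendsto_neg_nhdsGT_neg (a := (0 : ℝ)) |>.mono_left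
    (by rw [neg_zero]) : Tendsto Neg.neg (𝓝[>] (0 : ℝ)) (𝓝[<] (0 : ℝ)))
  have h3 : Tendsto (fun x : ℝ => gc (-I * (I * y + x))) (𝓝 0) (𝓝 (g y)) := by
    have a1 := (hs.analyticAt_of_re_eq_zero h0).continuousAt
    have : -I * (I * y : ℂ) = y := by linear_combination (-y : ℂ) * I_mul_I
    rw [ContinuousAt, this, hs.eq_real] at a1
    refine a1.comp ?_
    have : ContinuousAt (fun x : ℝ => -I * (I * y + x : ℂ)) 0 := by fun_prop
    rw [ContinuousAt] at this
    convert this using 2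
    push_cast
    linear_combination (y : ℂ) * I_mul_I
  have h4 : Tendsto (fun x : ℝ => gc (-I * (I * y + ((-x : ℝ) : ℂ)))) (𝓝[>] 0) (𝓝 (g y)) := by
    refine h3.comp (f := fun x : ℝ => -x) ?_
    have : Tendsto (fun x : ℝ => -x) (𝓝 0) (𝓝 (-0)) := (continuous_neg.tendsto (0 : ℝ))
    rw [neg_zero] at this
    exact this.mono_left nhdsWithin_le_nhds
  have h5 : Tendsto (fun x : ℝ => -conj (D g (I * y + x)) +
      2 * Real.pi * gc (-I * (I * y + ((-x : ℝ) : ℂ)))) (𝓝[>] 0)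
      (𝓝 (-conj (continuedD g gc ε (I * y)) + 2 * Real.pi * (g y : ℂ))) :=
    (((Complex.continuous_conj.tendsto _).comp h1).neg).add (h4.const_mul _)
  have h6 := tendsto_nhds_unique (h2.congr fun x => ?_) h5
  · have := congrArg Complex.re h6
    simp at this
    linarith
  · simp only [Function.comp]
    congr 1
    have := D_neg_conj g x y
    rw [add_comm (I * (y : ℂ)) x, ← this]
    congr 1
    push_cast; ring

theorem bddAbove_image_of_decay (hA2 : DecaysSuperexponentially g) (s : Set ℝ) :
    BddAbove (g '' s) := by
  obtain ⟨C, hC, h⟩ := hA2 1 one_pos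
  refine ⟨C, ?_⟩
  rintro _ ⟨ω, -, rfl⟩
  refine (le_abs_self _).trans ((h ω).le.trans (mul_le_of_le_one_right hC.le ?_))
  rw [Real.exp_le_one_iff]
  have := abs_nonneg ω
  linarith

/-- A point where the largest real value at least `w₀ > 0` of `D` is attained lies on the
imaginary axis. -/
theorem StripContinuation.re_eq_zero_of_isMax (hs : StripContinuation g gc p ε) {w : ℝ}
    (hw : 0 < w) {lam : ℂ} (h0 : 0 ≤ lam.re) (hval : continuedD g gc ε lam = w)
    (hmax : ∀ z : ℂ, 0 ≤ z.re → ∀ v : ℝ, continuedD g gc ε z = v → v ≤ w) : lam.re = 0 := by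
  by_contra hne
  have hpos : 0 < lam.re := lt_of_le_of_ne h0 (Ne.symm hne)
  have hone := ExpHolomorphic.one p
  have han : AnalyticOnNhd ℂ (continuedD g gc ε) {z | 0 < z.re} := fun z hz =>
    hs.analyticAt_continuedTransform_right hone (by linarith [hs.eps_pos, Set.mem_ofPred_eq ▸ hz])
  rcases (han lam hpos).eventually_constant_or_nhds_le_map_nhds with hconst | hopen
  · have hpre : IsPreconnected {z : ℂ | 0 < z.re} := (convex_halfSpace_re_gt 0).isPreconnected
    have heq := han.eqOn_of_preconnected_of_eventuallyEq (analyticOnNhd_const (v := (w : ℂ)))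
      hpre hpos (hconst.mono fun z hz => by rw [hz, hval])
    obtain ⟨C, hC⟩ := hs.exists_norm_mul_continuedTransform_le_right hone
    have hpt : (0 : ℝ) < |C| / w + 1 := by positivity
    have h1 := hC ((|C| / w + 1 : ℝ) : ℂ) (by rw [ofReal_re]; linarith [hs.eps_pos])
    have h2 := heq (x := ((|C| / w + 1 : ℝ) : ℂ)) (by simpa using hpt)
    simp only [continuedD] at h2
    rw [h2, Complex.norm_real, Complex.norm_real, Real.norm_of_nonneg hpt.le,
      Real.norm_of_nonneg hw.le, add_mul, div_mul_cancel₀ _ hw.ne'] at h1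
    linarith [le_abs_self C]
  · have hmem : {z : ℂ | 0 < z.re} ∈ 𝓝 lam :=
      (isOpen_lt continuous_const Complex.continuous_re).mem_nhds hpos
    have himg := hopen (image_mem_map hmem)
    rw [hval] at himg
    have hcont : Tendsto (fun v : ℝ => (v : ℂ)) (𝓝 w) (𝓝 (w : ℂ)) :=
      Complex.continuous_ofReal.tendsto w
    have hev := (hcont.mono_left (nhdsWithin_le_nhds (s := Set.Ioi w))).eventually himg
    obtain ⟨v, ⟨z, hz, hzv⟩, hv⟩ := (hev.and self_mem_nhdsWithin).exists
    have hz' : (0 : ℝ) < z.re := hz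
    exact absurd (hmax z hz'.le v hzv) (not_le.mpr hv)

/-- For `K ≤ K_c` there are no generalized eigenvalues in the right half plane. -/
theorem StripContinuation.G_ne_zero_of_pos (hs : StripContinuation g gc p ε)
    (hg : Integrable g) (hA2 : DecaysSuperexponentially g) {K : ℝ} (hK : 0 < K)
    (hKc : K ≤ criticalCoupling g) {lam : ℂ} (hlam : 0 < lam.re) : G K g gc lam ≠ 0 := by
  rw [Ne, hs.G_eq_zero_iff hK.ne']
  intro hval
  have hone := ExpHolomorphic.one p
  set w₀ : ℝ := 2 / K with hw₀
  have hw₀pos : 0 < w₀ := by positivity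
  have hval' : continuedD g gc ε lam = (w₀ : ℂ) := by rw [hval, hw₀]; push_cast; rfl
  obtain ⟨C, hC⟩ := hs.exists_norm_mul_continuedTransform_le_right hone
  set T : Set ℂ := {z | 0 ≤ z.re ∧ ‖z‖ ≤ C / w₀ ∧ (continuedD g gc ε z).im = 0 ∧
    w₀ ≤ (continuedD g gc ε z).re} with hT
  have hnorm : ∀ z : ℂ, 0 ≤ z.re → ∀ v : ℝ, continuedD g gc ε z = v → w₀ ≤ v → z ∈ T := by
    intro z hz v hv hwv
    refine ⟨hz, ?_, by rw [hv, ofReal_im], by rwa [hv, ofReal_re]⟩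
    have := hC z (by linarith [hs.eps_pos])
    rw [← continuedD, hv, Complex.norm_real, Real.norm_of_nonneg (by linarith)] at this
    rw [le_div_iff₀ hw₀pos]
    exact (mul_le_mul_of_nonneg_left hwv (norm_nonneg z)).trans this
  have hcontOn : ContinuousOn (continuedD g gc ε) {z | 0 ≤ z.re} := fun z hz =>
    (hs.analyticAt_continuedTransform_right hone (by
      have : (0 : ℝ) ≤ z.re := hz
      linarith [hs.eps_pos])).continuousAt.continuousWithinAt
  have hK₀ : IsCompact ({z : ℂ | 0 ≤ z.re} ∩ Metric.closedBall 0 (C / w₀)) :=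
    (isCompact_closedBall 0 _).inter_left (isClosed_le continuous_const Complex.continuous_re)
  have hcontK := hcontOn.mono (Set.inter_subset_left (t := Metric.closedBall 0 (C / w₀)))
  have hTeq : T = ({z : ℂ | 0 ≤ z.re} ∩ Metric.closedBall 0 (C / w₀)) ∩
      (continuedD g gc ε) ⁻¹' {v : ℂ | v.im = 0 ∧ w₀ ≤ v.re} := by
    ext z
    simp only [hT, Set.mem_ofPred_eq, Set.mem_inter_iff, mem_closedBall_zero_iff, Set.mem_preimage]
    tauto
  have hTc : IsCompact T := by
    rw [hTeq]
    refine hK₀.of_isClosed_subset ?_ Set.inter_subset_left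
    refine hcontK.preimage_isClosed_of_isClosed hK₀.isClosed ?_
    exact (isClosed_eq Complex.continuous_im continuous_const).inter
      (isClosed_le continuous_const Complex.continuous_re)
  have hlamT : lam ∈ T := hnorm lam hlam.le w₀ hval' le_rfl
  have hTsub : T ⊆ {z | 0 ≤ z.re} := fun z hz => hz.1
  obtain ⟨m, hmT, hmax⟩ := hTc.exists_isMaxOn ⟨lam, hlamT⟩
    (Complex.continuous_re.comp_continuousOn (hcontOn.mono hTsub))
  have hm : continuedD g gc ε m = ((continuedD g gc ε m).re : ℂ) :=
    Complex.ext (by simp) (by simpa using hmT.2.2.1)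
  have hmax' : ∀ z : ℂ, 0 ≤ z.re → ∀ v : ℝ, continuedD g gc ε z = v →
      v ≤ (continuedD g gc ε m).re := by
    intro z hz v hv
    rcases le_total w₀ v with h | h
    · have := hmax (hnorm z hz v hv h)
      simpa [hv] using this
    · exact h.trans hmT.2.2.2
  set w := (continuedD g gc ε m).re with hw
  have hw₀w : w₀ < w := by
    refine lt_of_le_of_ne hmT.2.2.2 fun h => ?_
    have := hs.re_eq_zero_of_isMax hw₀pos hlam.le hval' (fun z hz v hv => h ▸ hmax' z hz v hv)
    linarith
  have hmre := hs.re_eq_zero_of_isMax (hw₀pos.trans hw₀w) hmT.1 hm hmax'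
  obtain ⟨y, rfl⟩ : ∃ y : ℝ, m = I * y := ⟨m.im, Complex.ext (by simp [hmre]) (by simp)⟩
  have hgy := hs.re_continuedD y
  rw [← hw] at hgy
  have hcrit : y ∈ criticalFrequencies g := by
    have h1 := (Complex.continuous_im.tendsto _).comp (hs.tendsto_D_right hmre)
    rw [hm, ofReal_im] at h1
    refine h1.congr' ?_
    filter_upwards [self_mem_nhdsWithin] with x hx
    exact im_D_eq hg hx y
  have hsup : g y ≤ sSup (g '' criticalFrequencies g) :=
    le_csSup (bddAbove_image_of_decay hA2 _) ⟨y, hcrit, rfl⟩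
  have hpi := Real.pi_pos
  have h1 : w₀ < Real.pi * sSup (g '' criticalFrequencies g) := by
    calc w₀ < w := hw₀w
      _ = Real.pi * g y := hgy
      _ ≤ _ := by gcongr
  have h2 : criticalCoupling g < K := by
    rw [criticalCoupling, div_lt_iff₀ (hw₀pos.trans h1)]
    rw [hw₀, div_lt_iff₀ hK] at h1
    linarith
  exact absurd hKc (not_le.mpr h2)

end Kuramoto

namespace Kuramoto

/-! ### The matrix elements of the resolvent and their singularities -/

variable {g : ℝ → ℝ} {gc : ℂ → ℂ} {p ε : ℝ}

/-- The ends `|Im z| → ∞` of the half plane `c ≤ Re z`. -/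
def verticalEnds (c : ℝ) : Filter ℂ :=
  comap (fun z : ℂ => |z.im|) atTop ⊓ 𝓟 {z | c ≤ z.re}

theorem eventually_verticalEnds {c : ℝ} {P : ℂ → Prop} :
    (∀ᶠ z in verticalEnds c, P z) ↔ ∃ Y : ℝ, ∀ z : ℂ, c ≤ z.re → Y ≤ |z.im| → P z := by
  rw [verticalEnds, eventually_inf_principal, eventually_comap]
  constructor
  · intro h
    obtain ⟨Y, hY⟩ := eventually_atTop.mp h
    exact ⟨Y, fun z hz hzY => hY _ hzY z rfl hz⟩
  · rintro ⟨Y, hY⟩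
    filter_upwards [eventually_ge_atTop Y] with y hy z hz hre
    exact hY z hre (hz ▸ hy)

theorem verticalEnds_anti {c c' : ℝ} (h : c ≤ c') : verticalEnds c' ≤ verticalEnds c :=
  inf_le_inf_left _ (principal_mono.mpr fun _ hz => h.trans hz)

theorem tendsto_norm_verticalEnds (c : ℝ) :
    Tendsto (fun z : ℂ => ‖z‖) (verticalEnds c) atTop :=
  tendsto_atTop_mono (fun z => Complex.abs_im_le_norm z) (tendsto_comap.mono_left inf_le_left)

theorem tendsto_zero_verticalEnds_of_norm_mul_le {f : ℂ → ℂ} {c C : ℝ}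
    (h : ∀ᶠ z in verticalEnds c, ‖z‖ * ‖f z‖ ≤ C) : Tendsto f (verticalEnds c) (𝓝 0) := by
  have h1 : Tendsto (fun z : ℂ => C * ‖z‖⁻¹) (verticalEnds c) (𝓝 0) := by
    simpa using (tendsto_inv_atTop_zero.comp (tendsto_norm_verticalEnds c)).const_mul C
  refine squeeze_zero_norm' ?_ h1
  filter_upwards [h, (tendsto_norm_verticalEnds c).eventually (eventually_gt_atTop 0)] with z hz h0
  rw [← div_eq_mul_inv, le_div_iff₀ h0, mul_comm]
  exact hz

theorem tendsto_div_sub_verticalEnds (c : ℝ) (a w : ℂ) :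
    Tendsto (fun z => a / (z - w)) (verticalEnds c) (𝓝 0) := by
  have h1 : Tendsto (fun z : ℂ => ‖z - w‖) (verticalEnds c) atTop := by
    refine tendsto_atTop_mono (fun z => ?_)
      (tendsto_atTop_add_const_right _ (-‖w‖) (tendsto_norm_verticalEnds c))
    have := norm_sub_norm_le z w
    linarith
  refine tendsto_zero_iff_norm_tendsto_zero.mpr ?_
  simpa [div_eq_mul_inv] using (tendsto_inv_atTop_zero.comp h1).const_mul ‖a‖

theorem StripContinuation.tendsto_continuedTransform (hs : StripContinuation g gc p ε)
    {h : ℂ → ℂ} (hh : ExpHolomorphic p h) :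
    Tendsto (continuedTransform g gc ε h) (verticalEnds (-p)) (𝓝 0) := by
  obtain ⟨C, Y, -, hC⟩ := hs.exists_norm_mul_continuedTransform_le hh
  exact tendsto_zero_verticalEnds_of_norm_mul_le (eventually_verticalEnds.mpr ⟨Y, hC⟩)

theorem StripContinuation.eventually_analyticAt (hs : StripContinuation g gc p ε) :
    ∀ᶠ z in verticalEnds (-p), z.re ≤ 0 → AnalyticAt ℂ gc (-I * z) := by
  obtain ⟨Y, hY, -⟩ := hs.far
  refine eventually_verticalEnds.mpr ⟨Y, fun z h1 h2 h3 => hY _ ?_ ?_ ?_⟩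
  · rw [neg_I_mul_im]; linarith
  · rw [neg_I_mul_im]; linarith
  · rwa [neg_I_mul_re]

theorem StripContinuation.tendsto_G (hs : StripContinuation g gc p ε) (K : ℝ) :
    Tendsto (G K g gc) (verticalEnds (-p)) (𝓝 1) := by
  rw [hs.G_eq]
  simpa [continuedD] using ((hs.tendsto_continuedTransform (ExpHolomorphic.one p)).const_mul
    (K / 2 : ℂ)).const_sub 1

theorem StripContinuation.analyticAt_G (hs : StripContinuation g gc p ε) (K : ℝ) {lam : ℂ}
    (hp : -p ≤ lam.re) (han : lam.re ≤ 0 → AnalyticAt ℂ gc (-I * lam)) :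
    AnalyticAt ℂ (G K g gc) lam := by
  rw [hs.G_eq]
  exact analyticAt_const.sub (analyticAt_const.mul
    (hs.analyticAt_continuedTransform (ExpHolomorphic.one p) hp han))

theorem StripContinuation.meromorphicAt_G (hs : StripContinuation g gc p ε) (K : ℝ) {lam : ℂ}
    (hp : -p ≤ lam.re) : MeromorphicAt (G K g gc) lam := by
  rw [hs.G_eq]
  exact (MeromorphicAt.const _ _).sub ((MeromorphicAt.const _ _).mul
    (hs.meromorphicAt_continuedTransform (ExpHolomorphic.one p) hp))

/-- Simple resonance poles do not accumulate in the strip. -/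
theorem StripContinuation.finite_resonancePoles (hs : StripContinuation g gc p ε) {K a : ℝ}
    (hK : 0 < K) (hap : a ≤ p)
    (hsimple : ∀ lam ∈ resonancePoles K g gc a, IsSimpleRoot K g gc lam) :
    (resonancePoles K g gc a).Finite := by
  have hzero : ∀ lam ∈ resonancePoles K g gc a, G K g gc lam = 0 := fun lam hl =>
    ((hs.isResonancePole_iff hK.ne' lam).mp hl.1).2.2
  obtain ⟨Y, hY⟩ := eventually_verticalEnds.mp ((hs.tendsto_G K).eventually_ne one_ne_zero)
  have hcomp : IsCompact (Complex.reProdIm (Set.Icc (-a) 0) (Set.Icc (-Y) Y)) :=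
    isCompact_Icc.reProdIm isCompact_Icc
  have hsub : resonancePoles K g gc a ⊆ Complex.reProdIm (Set.Icc (-a) 0) (Set.Icc (-Y) Y) := by
    intro lam hl
    refine ⟨⟨hl.2.1.le, hl.2.2⟩, abs_le.mp ?_⟩
    by_contra hcon
    exact hY lam (by linarith [hl.2.1]) (not_le.mp hcon).le (hzero lam hl)
  by_contra hinf
  obtain ⟨x, hx, hacc⟩ := Set.Infinite.exists_accPt_of_subset_isCompact hinf hcomp hsub
  have hxp : -p ≤ x.re := by
    have : -a ≤ x.re := hx.1.1
    linarith
  have hfreq := accPt_iff_frequently_nhdsNE.mp hacc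
  rcases (hs.meromorphicAt_G K hxp).eventually_eq_zero_or_eventually_ne_zero with h | h
  · rw [← eventually_eventually_nhdsWithin] at h
    obtain ⟨z, hzR, hz, hzx⟩ := (hfreq.and_eventually (h.and self_mem_nhdsWithin)).exists
    rw [(isOpen_compl_singleton).nhdsWithin_eq hzx] at hz
    obtain ⟨d, hd, hlim⟩ := hsimple z hzR
    refine hd (tendsto_nhds_unique hlim (tendsto_const_nhds.congr' ?_))
    filter_upwards [hz.filter_mono nhdsWithin_le_nhds] with w hw
    rw [hw, mul_zero]
  · obtain ⟨z, hzR, hz⟩ := (hfreq.and_eventually h).exists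
    exact hz (hzero z hzR)

/-- The matrix elements of the resolvent of `T₁`, continued to the left half plane. -/
noncomputable def resolventElement (K : ℝ) (g : ℝ → ℝ) (gc : ℂ → ℂ) (ε : ℝ) (h k : ℂ → ℂ)
    (lam : ℂ) : ℂ :=
  continuedTransform g gc ε (fun z => h z * k z) lam + (K / 2 : ℂ) *
    (continuedTransform g gc ε h lam * continuedTransform g gc ε k lam / G K g gc lam)

theorem StripContinuation.analyticAt_resolventElement (hs : StripContinuation g gc p ε) {K : ℝ}
    {h k : ℂ → ℂ} (hh : ExpHolomorphic p h) (hk : ExpHolomorphic p k) {lam : ℂ}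
    (hp : -p ≤ lam.re) (han : lam.re ≤ 0 → AnalyticAt ℂ gc (-I * lam)) (hG : G K g gc lam ≠ 0) :
    AnalyticAt ℂ (resolventElement K g gc ε h k) lam :=
  (hs.analyticAt_continuedTransform (hh.mul hk) hp han).add (analyticAt_const.mul
    (((hs.analyticAt_continuedTransform hh hp han).mul
      (hs.analyticAt_continuedTransform hk hp han)).div (hs.analyticAt_G K hp han) hG))

theorem StripContinuation.meromorphicAt_resolventElement (hs : StripContinuation g gc p ε)
    {K : ℝ} {h k : ℂ → ℂ} (hh : ExpHolomorphic p h) (hk : ExpHolomorphic p k) {lam : ℂ}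
    (hp : -p ≤ lam.re) : MeromorphicAt (resolventElement K g gc ε h k) lam :=
  (hs.meromorphicAt_continuedTransform (hh.mul hk) hp).add ((MeromorphicAt.const _ _).mul
    (((hs.meromorphicAt_continuedTransform hh hp).mul
      (hs.meromorphicAt_continuedTransform hk hp)).div (hs.meromorphicAt_G K hp)))

theorem StripContinuation.tendsto_resolventElement (hs : StripContinuation g gc p ε) (K : ℝ)
    {h k : ℂ → ℂ} (hh : ExpHolomorphic p h) (hk : ExpHolomorphic p k) :
    Tendsto (resolventElement K g gc ε h k) (verticalEnds (-p)) (𝓝 0) := by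
  have := (hs.tendsto_continuedTransform (hh.mul hk)).add
    ((((hs.tendsto_continuedTransform hh).mul (hs.tendsto_continuedTransform hk)).div
      (hs.tendsto_G K) one_ne_zero).const_mul (K / 2 : ℂ))
  rw [mul_zero, zero_div, mul_zero, add_zero] at this
  exact this

theorem tendsto_sub_mul_of_tendsto {X : ℂ → ℂ} {x c : ℂ} (h : Tendsto X (𝓝[≠] x) (𝓝 c)) :
    Tendsto (fun z => (z - x) * X z) (𝓝[≠] x) (𝓝 0) := by
  have h1 : Tendsto (fun z : ℂ => z - x) (𝓝[≠] x) (𝓝 0) := by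
    have : Tendsto (fun z : ℂ => z - x) (𝓝 x) (𝓝 (x - x)) := (continuous_id.sub continuous_const).tendsto x
    rw [sub_self] at this
    exact this.mono_left nhdsWithin_le_nhds
  simpa using h1.mul h

theorem meromorphicOrderAt_nonneg_of_tendsto {X : ℂ → ℂ} {x : ℂ} (hX : MeromorphicAt X x)
    (h : Tendsto (fun z => (z - x) * X z) (𝓝[≠] x) (𝓝 0)) : 0 ≤ meromorphicOrderAt X x := by
  have hid : MeromorphicAt (fun z : ℂ => z - x) x :=
    (analyticAt_id.sub analyticAt_const).meromorphicAt
  have h1 := (tendsto_zero_iff_meromorphicOrderAt_pos (hid.mul hX)).mp h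
  rw [meromorphicOrderAt_mul hid hX] at h1
  have h2 : meromorphicOrderAt (fun z : ℂ => z - x) x = 1 := meromorphicOrderAt_id_sub_const
  rw [h2] at h1
  by_cases h3 : meromorphicOrderAt X x = ⊤
  · rw [h3]; exact le_top
  · obtain ⟨n, hn⟩ := WithTop.ne_top_iff_exists.mp h3
    rw [← hn] at h1 ⊢
    have h4 : (0 : WithTop ℤ) < ((1 + n : ℤ) : WithTop ℤ) := by exact_mod_cast h1
    have h5 : 0 < 1 + n := by exact_mod_cast h4
    have h6 : (0 : ℤ) ≤ n := by omega
    exact_mod_cast h6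

/-- At a pole of the density the resolvent stays bounded. -/
theorem StripContinuation.exists_tendsto_resolventElement_of_pole
    (hs : StripContinuation g gc p ε) {K : ℝ} (hK : 0 < K)
    {h k : ℂ → ℂ} (hh : ExpHolomorphic p h) (hk : ExpHolomorphic p k) {lam : ℂ}
    (hp : -p ≤ lam.re) (h0 : lam.re < 0) (hpole : ¬ AnalyticAt ℂ gc (-I * lam)) :
    ∃ c, Tendsto (resolventElement K g gc ε h k) (𝓝[≠] lam) (𝓝 c) := by
  have him : 0 ≤ (-I * lam).im := by rw [neg_I_mul_im]; linarith
  have himp : (-I * lam).im ≤ p := by rw [neg_I_mul_im]; linarith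
  have hnf := hs.meromorphic _ him
  have hord : meromorphicOrderAt gc (-I * lam) < 0 := by
    rw [← hnf.meromorphicOrderAt_nonneg_iff_analyticAt] at hpole
    exact not_le.mp hpole
  have hcob := (tendsto_cobounded_iff_meromorphicOrderAt_neg hnf.meromorphicAt).mpr hord
  have hmap : Tendsto (fun z : ℂ => -I * z) (𝓝[≠] lam) (𝓝[≠] (-I * lam)) := by
    refine tendsto_nhdsWithin_iff.mpr ⟨?_, ?_⟩
    · exact ((continuous_const.mul continuous_id).tendsto lam).mono_left nhdsWithin_le_nhds
    · filter_upwards [self_mem_nhdsWithin] with z hz hz'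
      exact hz (mul_left_cancel₀ (neg_ne_zero.mpr I_ne_zero) hz')
  have hq := hcob.comp hmap
  have hr : Tendsto (fun z : ℂ => (gc (-I * z))⁻¹) (𝓝[≠] lam) (𝓝 0) :=
    tendsto_inv₀_cobounded.comp hq
  have hq0 : ∀ᶠ z in 𝓝[≠] lam, gc (-I * z) ≠ 0 := by
    have := (tendsto_norm_atTop_iff_cobounded.mpr hq).eventually (eventually_gt_atTop 0)
    filter_upwards [this] with z hz
    exact norm_pos_iff.mp hz
  have hd : ∀ {f : ℂ → ℂ}, ExpHolomorphic p f →
      Tendsto (cauchyTransform fun ω : ℝ => f ω * g ω) (𝓝[≠] lam)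
        (𝓝 (cauchyTransform (fun ω : ℝ => f ω * g ω) lam)) := fun hf =>
    (differentiableAt_cauchyTransform (hs.rapidDecay_real hf).integrable
      h0.ne).continuousAt.tendsto.mono_left nhdsWithin_le_nhds
  have hc : ∀ {f : ℂ → ℂ}, ExpHolomorphic p f →
      Tendsto (fun z => f (-I * z)) (𝓝[≠] lam) (𝓝 (f (-I * lam))) := fun hf =>
    (hf.analyticAt him himp).continuousAt.tendsto.comp (hmap.mono_right nhdsWithin_le_nhds)
  have hone := ExpHolomorphic.one p
  set d : (ℂ → ℂ) → ℂ → ℂ := fun f => cauchyTransform fun ω : ℝ => f ω * g ω with hdd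
  have hden : Tendsto (fun z => (1 - (K / 2 : ℂ) * d (fun _ => 1) z) * (gc (-I * z))⁻¹ -
      K * Real.pi) (𝓝[≠] lam) (𝓝 ((1 - (K / 2 : ℂ) * d (fun _ => 1) lam) * 0 - K * Real.pi)) :=
    ((((hd hone).const_mul _).const_sub 1).mul hr).sub_const _
  have hden0 : (1 - (K / 2 : ℂ) * d (fun _ => 1) lam) * 0 - K * Real.pi ≠ 0 := by
    rw [mul_zero, zero_sub, neg_ne_zero]
    exact_mod_cast (mul_pos hK Real.pi_pos).ne'
  have hnum : Tendsto (fun z => 2 * Real.pi * (h (-I * z) * k (-I * z)) *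
        (1 - (K / 2 : ℂ) * d (fun _ => 1) z) +
      (K / 2 : ℂ) * (d h z * d k z * (gc (-I * z))⁻¹ + 2 * Real.pi *
        (h (-I * z) * d k z + k (-I * z) * d h z))) (𝓝[≠] lam) (𝓝 _) :=
    ((((hc hh).mul (hc hk)).const_mul _).mul (((hd hone).const_mul _).const_sub 1)).add
      (((((hd hh).mul (hd hk)).mul hr).add
        ((((hc hh).mul (hd hk)).add ((hc hk).mul (hd hh))).const_mul _)).const_mul _)
  have hlim := (hd (hh.mul hk)).add (hnum.div hden hden0)
  refine ⟨_, hlim.congr' ?_⟩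
  have hneg : ∀ᶠ z in 𝓝[≠] lam, z.re < 0 :=
    (Complex.continuous_re.continuousAt.eventually_lt_const h0).filter_mono nhdsWithin_le_nhds
  filter_upwards [hq0, hden.eventually_ne hden0, hneg] with z hz1 hz2 hz3
  rw [resolventElement, hs.G_eq, continuedD, hs.continuedTransform_of_neg hh hz3,
    hs.continuedTransform_of_neg hk hz3, hs.continuedTransform_of_neg (hh.mul hk) hz3]
  simp only [hdd, Pi.div_apply] at hz2 ⊢
  rw [hs.continuedTransform_of_neg hone hz3]
  generalize cauchyTransform (fun ω : ℝ => h ω * k ω * g ω) z = dhk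
  generalize cauchyTransform (fun ω : ℝ => h ω * g ω) z = dh
  generalize cauchyTransform (fun ω : ℝ => k ω * g ω) z = dk
  generalize cauchyTransform (fun ω : ℝ => 1 * g ω) z = d1 at hz2 ⊢
  generalize gc (-I * z) = q at hz1 hz2 ⊢
  have e1 : 1 - (K / 2 : ℂ) * (d1 + 2 * Real.pi * (1 * q)) =
      q * ((1 - (K / 2 : ℂ) * d1) * q⁻¹ - K * Real.pi) := by
    field_simp
    ring
  rw [e1]
  generalize (1 - (K / 2 : ℂ) * d1) * q⁻¹ - K * Real.pi = E at hz2 ⊢ e1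
  rw [add_assoc]
  congr 1
  field_simp
  linear_combination (2 * Real.pi * (h (-(I * z)) * k (-(I * z))) * 2 * q) * e1

end Kuramoto

namespace Kuramoto

/-! ### Moving the contour of integration -/

variable {g : ℝ → ℝ} {gc : ℂ → ℂ} {p ε K a : ℝ}

/-- The residue of the resolvent at a simple resonance pole. -/
noncomputable def resolventResidue (K : ℝ) (g : ℝ → ℝ) (gc : ℂ → ℂ) (ε : ℝ) (h k : ℂ → ℂ)
    (lam : ℂ) : ℂ :=
  (K / 2 : ℂ) * (continuedTransform g gc ε h lam * continuedTransform g gc ε k lam /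
    residueConst K g gc lam)

theorem tendsto_sub_mul_of_analyticAt {X : ℂ → ℂ} {x : ℂ} (h : AnalyticAt ℂ X x) :
    Tendsto (fun z => (z - x) * X z) (𝓝[≠] x) (𝓝 0) :=
  tendsto_sub_mul_of_tendsto (h.continuousAt.tendsto.mono_left nhdsWithin_le_nhds)

theorem IsSimpleRoot.tendsto {lam : ℂ} (h : IsSimpleRoot K g gc lam) :
    residueConst K g gc lam ≠ 0 ∧
      Tendsto (fun z => (z - lam)⁻¹ * G K g gc z) (𝓝[≠] lam) (𝓝 (residueConst K g gc lam)) := by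
  obtain ⟨d, hd, hlim⟩ := h
  have : residueConst K g gc lam = d := hlim.limUnder_eq
  rw [this]
  exact ⟨hd, hlim⟩

theorem StripContinuation.tendsto_sub_mul_resolventElement (hs : StripContinuation g gc p ε)
    {h k : ℂ → ℂ} (hh : ExpHolomorphic p h) (hk : ExpHolomorphic p k) {lam : ℂ}
    (hp : -p ≤ lam.re) (han : lam.re ≤ 0 → AnalyticAt ℂ gc (-I * lam))
    (hroot : IsSimpleRoot K g gc lam) :
    Tendsto (fun z => (z - lam) * resolventElement K g gc ε h k z) (𝓝[≠] lam)
      (𝓝 (resolventResidue K g gc ε h k lam)) := by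
  obtain ⟨hd, hlim⟩ := hroot.tendsto
  have a0 := tendsto_sub_mul_of_analyticAt (hs.analyticAt_continuedTransform (hh.mul hk) hp han)
  have a1 := (hs.analyticAt_continuedTransform hh hp han).continuousAt.tendsto.mono_left
    (nhdsWithin_le_nhds (s := {lam}ᶜ))
  have a2 := (hs.analyticAt_continuedTransform hk hp han).continuousAt.tendsto.mono_left
    (nhdsWithin_le_nhds (s := {lam}ᶜ))
  have := a0.add (((a1.mul a2).div hlim hd).const_mul (K / 2 : ℂ))
  rw [zero_add] at this
  refine this.congr fun z => ?_
  rw [resolventElement, mul_add]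
  congr 1
  simp only [Pi.div_apply]
  rw [inv_mul_eq_div, div_div_eq_mul_div]
  ring

/-- After subtraction of the principal parts at the resonance poles, the resolvent extends
holomorphically to the closed half plane `Re λ ≥ -a`. -/
theorem StripContinuation.exists_holomorphic_extension (hs : StripContinuation g gc p ε)
    (hK : 0 < K) (hap : a ≤ p)
    (hright : ∀ lam : ℂ, 0 < lam.re → G K g gc lam ≠ 0)
    (hline : ∀ lam : ℂ, lam.re = -a → AnalyticAt ℂ gc (-I * lam) ∧ ¬ IsResonancePole K g gc lam)
    (hsimple : ∀ lam ∈ resonancePoles K g gc a, IsSimpleRoot K g gc lam)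
    (hfin : (resonancePoles K g gc a).Finite)
    {h k : ℂ → ℂ} (hh : ExpHolomorphic p h) (hk : ExpHolomorphic p k) :
    ∃ H : ℂ → ℂ, (∀ z : ℂ, -a ≤ z.re → AnalyticAt ℂ H z) ∧
      ∀ z : ℂ, -a ≤ z.re → (z.re ≤ 0 → AnalyticAt ℂ gc (-I * z)) → G K g gc z ≠ 0 →
        H z = resolventElement K g gc ε h k z -
          ∑ lam ∈ hfin.toFinset, resolventResidue K g gc ε h k lam / (z - lam) := by
  set P := hfin.toFinset with hP
  set c := resolventResidue K g gc ε h k with hc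
  set F := resolventElement K g gc ε h k with hF
  have hmemP : ∀ lam, lam ∈ P ↔ lam ∈ resonancePoles K g gc a := fun lam => hfin.mem_toFinset
  have hterm : ∀ lam z : ℂ, MeromorphicAt (fun z => c lam / (z - lam)) z := fun lam z =>
    (MeromorphicAt.const _ _).div ((MeromorphicAt.id z).sub (MeromorphicAt.const _ _))
  have hsum : ∀ (Q : Finset ℂ) (z : ℂ),
      MeromorphicAt (fun z => ∑ lam ∈ Q, c lam / (z - lam)) z := fun Q z =>
    MeromorphicAt.fun_sum fun lam _ => hterm lam z
  have hsuman : ∀ (Q : Finset ℂ) (z : ℂ), z ∉ Q →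
      AnalyticAt ℂ (fun z => ∑ lam ∈ Q, c lam / (z - lam)) z := fun Q z hz => by
    refine Finset.analyticAt_fun_sum Q fun lam hl => ?_
    refine analyticAt_const.div (analyticAt_id.sub analyticAt_const) (sub_ne_zero.mpr ?_)
    rintro rfl
    exact hz hl
  set H₀ : ℂ → ℂ := fun z => F z - ∑ lam ∈ P, c lam / (z - lam) with hH₀
  have hmer : MeromorphicOn H₀ {z | -a ≤ z.re} := fun z hz =>
    (hs.meromorphicAt_resolventElement hh hk (by
      have : -a ≤ z.re := hz
      linarith)).sub (hsum P z)
  have hpoleG : ∀ z ∈ P, G K g gc z = 0 := fun z hz =>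
    ((hs.isResonancePole_iff hK.ne' z).mp ((hmemP z).mp hz).1).2.2
  have hord : ∀ z : ℂ, -a ≤ z.re → 0 ≤ meromorphicOrderAt H₀ z := by
    intro z hz
    have hzp : -p ≤ z.re := by linarith
    refine meromorphicOrderAt_nonneg_of_tendsto (hmer z hz) ?_
    by_cases hzP : z ∈ P
    · have hzR := (hmemP z).mp hzP
      have han := ((hs.isResonancePole_iff hK.ne' z).mp hzR.1).2.1
      have h1 := hs.tendsto_sub_mul_resolventElement hh hk hzp (fun _ => han) (hsimple z hzR)
      have h2 := tendsto_sub_mul_of_analyticAt (hsuman (P.erase z) z (Finset.notMem_erase z P))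
      have h3 := (h1.sub (tendsto_const_nhds (x := c z))).sub h2
      rw [sub_self, sub_zero] at h3
      refine h3.congr' ?_
      filter_upwards [self_mem_nhdsWithin] with w hw
      have hw' : w - z ≠ 0 := sub_ne_zero.mpr hw
      simp only [hH₀]
      rw [← Finset.add_sum_erase P _ hzP, mul_sub, mul_add, mul_div_cancel₀ _ hw']
      ring
    · suffices hF0 : Tendsto (fun w => (w - z) * F w) (𝓝[≠] z) (𝓝 0) by
        have := hF0.sub (tendsto_sub_mul_of_analyticAt (hsuman P z hzP))
        rw [sub_zero] at this
        refine this.congr fun w => ?_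
        simp only [hH₀]
        ring
      by_cases han : z.re ≤ 0 → AnalyticAt ℂ gc (-I * z)
      · have hG : G K g gc z ≠ 0 := by
          intro hG0
          rcases lt_or_ge 0 z.re with h0 | h0
          · exact hright z h0 hG0
          · have hres := (hs.isResonancePole_iff hK.ne' z).mpr ⟨h0, han h0, hG0⟩
            rcases hz.lt_or_eq with h1 | h1
            · exact hzP ((hmemP z).mpr ⟨hres, h1, h0⟩)
            · exact (hline z h1.symm).2 hres
        exact tendsto_sub_mul_of_analyticAt (hs.analyticAt_resolventElement hh hk hzp han hG)
      · push Not at han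
        have h0 : z.re < 0 := by
          refine lt_of_le_of_ne han.1 fun h0 => han.2 (hs.analyticAt_of_re_eq_zero h0)
        obtain ⟨b, hb⟩ := hs.exists_tendsto_resolventElement_of_pole hK hh hk hzp h0 han.2
        exact tendsto_sub_mul_of_tendsto hb
  refine ⟨toMeromorphicNFOn H₀ {z | -a ≤ z.re}, fun z hz => ?_, fun z hz han hG => ?_⟩
  · have hnf := meromorphicNFOn_toMeromorphicNFOn H₀ {z | -a ≤ z.re} hz
    rw [← hnf.meromorphicOrderAt_nonneg_iff_analyticAt, meromorphicOrderAt_toMeromorphicNFOn hmer hz]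
    exact hord z hz
  · have hH0an : AnalyticAt ℂ H₀ z :=
      (hs.analyticAt_resolventElement hh hk (by linarith) han hG).sub
        (hsuman P z fun hzP => hG (hpoleG z hzP))
    rw [toMeromorphicNFOn_eq_toMeromorphicNFAt hmer hz,
      toMeromorphicNFAt_eq_self.mpr hH0an.meromorphicNFAt]

theorem exp_line_eq (c y t : ℝ) :
    Complex.exp ((c + I * y) * t) = Complex.exp (c * t) * Complex.exp (I * y * t) := by
  rw [← Complex.exp_add]; congr 1; ring

theorem StripContinuation.continuous_resolventElement_line (hs : StripContinuation g gc p ε)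
    {h k : ℂ → ℂ} (hh : ExpHolomorphic p h) (hk : ExpHolomorphic p k) {c : ℝ} (hc : -p ≤ c)
    (han : ∀ z : ℂ, z.re = c → z.re ≤ 0 → AnalyticAt ℂ gc (-I * z))
    (hG : ∀ z : ℂ, z.re = c → G K g gc z ≠ 0) :
    Continuous fun y : ℝ => resolventElement K g gc ε h k (c + I * y) := by
  rw [continuous_iff_continuousAt]
  intro y
  have := (hs.analyticAt_resolventElement hh hk (lam := c + I * y) (by simpa)
    (han _ (by simp)) (hG _ (by simp))).continuousAt
  exact ContinuousAt.comp (f := fun y : ℝ => (c + I * y : ℂ)) this (by fun_prop)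

theorem continuous_div_line_sub (c : ℝ) (b w : ℂ) (h : c ≠ w.re) :
    Continuous fun y : ℝ => b / (c + I * y - w) := by
  refine continuous_const.div (by fun_prop) fun y h0 => h ?_
  have := congrArg Complex.re h0
  simp at this
  linarith

theorem StripContinuation.G_ne_zero_line (hs : StripContinuation g gc p ε) (hK : 0 < K)
    (ha : 0 < a)
    (hline : ∀ lam : ℂ, lam.re = -a → AnalyticAt ℂ gc (-I * lam) ∧ ¬ IsResonancePole K g gc lam)
    {z : ℂ} (hz : z.re = -a) : G K g gc z ≠ 0 := fun h0 =>
  (hline z hz).2 ((hs.isResonancePole_iff hK.ne' z).mpr ⟨by linarith, (hline z hz).1, h0⟩)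

/-- The contour `Re λ = b` may be moved to `Re λ = -a` at the cost of the residues. -/
theorem StripContinuation.tendsto_integral_left (hs : StripContinuation g gc p ε)
    (hK : 0 < K) (ha : 0 < a) (hap : a ≤ p)
    (hright : ∀ lam : ℂ, 0 < lam.re → G K g gc lam ≠ 0)
    (hline : ∀ lam : ℂ, lam.re = -a → AnalyticAt ℂ gc (-I * lam) ∧ ¬ IsResonancePole K g gc lam)
    (hsimple : ∀ lam ∈ resonancePoles K g gc a, IsSimpleRoot K g gc lam)
    (hfin : (resonancePoles K g gc a).Finite)
    {h k : ℂ → ℂ} (hh : ExpHolomorphic p h) (hk : ExpHolomorphic p k)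
    {b t : ℝ} (hb : 0 < b) (ht : 0 < t) {L : ℂ}
    (hL : Tendsto (fun r : ℝ × ℝ => ∫ y in r.1..r.2,
      Complex.exp ((b + I * y) * t) * resolventElement K g gc ε h k (b + I * y))
      (atBot ×ˢ atTop) (𝓝 L)) :
    Tendsto (fun r : ℝ × ℝ => ∫ y in r.1..r.2,
      Complex.exp (((-a : ℝ) + I * y) * t) * resolventElement K g gc ε h k ((-a : ℝ) + I * y))
      (atBot ×ˢ atTop) (𝓝 (L - ∑ lam ∈ hfin.toFinset, resolventResidue K g gc ε h k lam *
        (2 * Real.pi * Complex.exp (lam * t)))) := by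
  obtain ⟨H, hHan, hHeq⟩ := hs.exists_holomorphic_extension hK hap hright hline hsimple hfin hh hk
  set P := hfin.toFinset with hP
  set c := resolventResidue K g gc ε h k with hc
  set F := resolventElement K g gc ε h k with hF
  have hmemP : ∀ lam ∈ P, -a < lam.re ∧ lam.re ≤ 0 := fun lam hl =>
    (hfin.mem_toFinset.mp hl).2
  have hHlim : Tendsto H (verticalEnds (-a)) (𝓝 0) := by
    have hle : verticalEnds (-a) ≤ verticalEnds (-p) := verticalEnds_anti (by linarith)
    have h1 := (hs.tendsto_resolventElement K hh hk).sub
      (tendsto_finsetSum P fun lam _ => tendsto_div_sub_verticalEnds (-p) (c lam) lam)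
    rw [Finset.sum_const_zero, sub_zero] at h1
    refine (h1.mono_left hle).congr' ?_
    have hre : ∀ᶠ z in verticalEnds (-a), -a ≤ z.re :=
      eventually_verticalEnds.mpr ⟨0, fun z hz _ => hz⟩
    filter_upwards [hs.eventually_analyticAt.filter_mono hle,
      ((hs.tendsto_G K).eventually_ne one_ne_zero).filter_mono hle, hre] with z h1 h2 h3
    exact (hHeq z h3 h1 h2).symm
  have hv := tendsto_integral_vertical_sub (c₁ := -a) (c₂ := b)
    (k := fun z => Complex.exp (z * t) * H z) (by linarith)
    (fun z hz => ((by fun_prop : ContinuousAt (fun z : ℂ => Complex.exp (z * t)) z).mul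
      (hHan z hz.1).continuousAt).continuousWithinAt)
    (fun z h1 h2 => (by fun_prop : DifferentiableAt ℂ (fun z : ℂ => Complex.exp (z * t)) z).mul
      (hHan z h1.le).differentiableAt) ?_
  · -- pass from `H` to the resolvent on both lines
    have hsplit : ∀ c₀ : ℝ, -a ≤ c₀ → (∀ z : ℂ, z.re = c₀ → z.re ≤ 0 → AnalyticAt ℂ gc (-I * z)) →
        (∀ z : ℂ, z.re = c₀ → G K g gc z ≠ 0) → (∀ lam ∈ P, c₀ ≠ lam.re) → ∀ r s : ℝ,
        (∫ y in r..s, Complex.exp ((c₀ + I * y) * t) * H (c₀ + I * y)) =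
        (∫ y in r..s, Complex.exp ((c₀ + I * y) * t) * F (c₀ + I * y)) -
          ∑ lam ∈ P, c lam * ∫ y in r..s, Complex.exp ((c₀ + I * y) * t) / (c₀ + I * y - lam) := by
      intro c₀ h1 h2 h3 h4 r s
      have hFc := hs.continuous_resolventElement_line hh hk (by linarith) h2 h3
      have i1 : IntervalIntegrable (fun y : ℝ => Complex.exp ((c₀ + I * y) * t) * F (c₀ + I * y))
          volume r s := Continuous.intervalIntegrable (Continuous.mul (by fun_prop) hFc) _ _
      have i2 : ∀ lam ∈ P, IntervalIntegrable (fun y : ℝ =>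
          c lam * (Complex.exp ((c₀ + I * y) * t) / (c₀ + I * y - lam))) volume r s := by
        intro lam hl
        refine Continuous.intervalIntegrable ?_ _ _
        have := continuous_div_line_sub c₀ 1 lam (h4 lam hl)
        refine continuous_const.mul (((by fun_prop : Continuous fun y : ℝ =>
          Complex.exp ((c₀ + I * y) * t)).mul this).congr fun y => ?_)
        simp only [Pi.mul_apply, mul_one_div]
      simp_rw [← intervalIntegral.integral_const_mul]
      rw [← intervalIntegral.integral_finsetSum i2, ← intervalIntegral.integral_sub i1
        (IntervalIntegrable.sum P i2 |>.congr (by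
          intro y _
          simp only [Finset.sum_apply]))]
      refine intervalIntegral.integral_congr fun y _ => ?_
      rw [hHeq _ (by simpa using h1) (h2 _ (by simp)) (h3 _ (by simp)), mul_sub, Finset.mul_sum]
      congr 1
      refine Finset.sum_congr rfl fun lam _ => ?_
      ring
    have hb1 := hsplit b (by linarith) (fun z hz h0 => absurd h0 (by linarith))
      (fun z hz => hright z (by linarith)) (fun lam hl => ((hmemP lam hl).2.trans_lt hb).ne')
    have ha1 := hsplit (-a) le_rfl (fun z hz _ => (hline z hz).1)
      (fun z hz => hs.G_ne_zero_line hK ha hline hz) (fun lam hl => (hmemP lam hl).1.ne)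
    have sb : Tendsto (fun r : ℝ × ℝ => ∑ lam ∈ P, c lam * ∫ y in r.1..r.2,
        Complex.exp ((b + I * y) * t) / (b + I * y - lam)) (atBot ×ˢ atTop)
        (𝓝 (∑ lam ∈ P, c lam * (2 * Real.pi * Complex.exp (lam * t)))) := by
      refine tendsto_finsetSum P fun lam hl => Tendsto.const_mul _ ?_
      have hlt : lam.re < b := by linarith [(hmemP lam hl).2]
      have := tendsto_integral_exp_div_sub (c := b) (w := lam) hlt.ne' ht
      rwa [if_pos hlt] at this
    have sa : Tendsto (fun r : ℝ × ℝ => ∑ lam ∈ P, c lam * ∫ y in r.1..r.2,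
        Complex.exp (((-a : ℝ) + I * y) * t) / ((-a : ℝ) + I * y - lam)) (atBot ×ˢ atTop)
        (𝓝 (∑ lam ∈ P, c lam * 0)) := by
      refine tendsto_finsetSum P fun lam hl => Tendsto.const_mul _ ?_
      have hlt : -a < lam.re := (hmemP lam hl).1
      have := tendsto_integral_exp_div_sub (c := -a) (w := lam) hlt.ne ht
      rwa [if_neg (not_lt.mpr hlt.le)] at this
    have hfinal := ((hL.sub sb).sub hv).add sa
    simp only [mul_zero, Finset.sum_const_zero, add_zero, sub_zero] at hfinal
    refine hfinal.congr fun r => ?_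
    rw [hb1, ha1]
    ring
  · intro δ hδ
    have h1 := (tendsto_zero_iff_norm_tendsto_zero.mp hHlim).const_mul (Real.exp (b * t))
    rw [mul_zero] at h1
    obtain ⟨Y, hY⟩ := eventually_verticalEnds.mp (h1.eventually (eventually_lt_nhds hδ))
    refine ⟨Y, fun z z1 z2 z3 => ?_⟩
    refine le_trans ?_ (hY z z1 z3).le
    rw [norm_mul, Complex.norm_exp]
    gcongr
    simpa using mul_le_mul_of_nonneg_right z2 ht.le

end Kuramoto

namespace Kuramoto

/-! ### The test function space and its dual -/

variable {p : ℝ}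

theorem FpStep.norm_apply_le {β n : ℕ} (f : FpStep p β n) (z : ℂ) :
    ‖f z‖ ≤ ‖f‖ * Real.exp (β * ‖z‖) := by
  have h := le_ciSup (FpStep.bddAbove f) z
  rw [← FpStep.norm_def, Real.exp_neg, mul_inv_le_iff₀ (Real.exp_pos _)] at h
  exact h

theorem FpStep.norm_le {β n : ℕ} (f : FpStep p β n) {C : ℝ}
    (h : ∀ z, ‖f z‖ ≤ C * Real.exp (β * ‖z‖)) : ‖f‖ ≤ C := by
  rw [FpStep.norm_def]
  refine ciSup_le fun z => ?_
  rw [Real.exp_neg, mul_inv_le_iff₀ (Real.exp_pos _)]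
  exact h z

theorem Fp.ext {φ ψ : Fp p} (h : ∀ z ∈ strip p 0, φ z = ψ z) : φ = ψ := by
  refine Subtype.ext (funext fun z => ?_)
  by_cases hz : z ∈ strip p 0
  · exact h z hz
  · have h1 := φ.2.1 z hz
    have h2 := ψ.2.1 z hz
    exact h1.trans h2.symm

theorem Fp.add_apply (φ ψ : Fp p) (z : ℂ) : (φ + ψ) z = φ z + ψ z := rfl
theorem Fp.sub_apply (φ ψ : Fp p) (z : ℂ) : (φ - ψ) z = φ z - ψ z := rfl
theorem Fp.smul_apply (c : ℂ) (φ : Fp p) (z : ℂ) : (c • φ) z = c * φ z := rfl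
theorem FpStep.add_apply {β n : ℕ} (f h : FpStep p β n) (z : ℂ) : (f + h) z = f z + h z := rfl
theorem FpStep.sub_apply {β n : ℕ} (f h : FpStep p β n) (z : ℂ) : (f - h) z = f z - h z := rfl

theorem Fp.ofStep_apply {β n : ℕ} (f : FpStep p β n) {z : ℂ} (hz : z ∈ strip p 0) :
    Fp.ofStep p β n f z = f z := Set.indicator_of_mem hz _

theorem Fp.norm_ofStep_apply_le {β n : ℕ} (f : FpStep p β n) (z : ℂ) :
    ‖Fp.ofStep p β n f z‖ ≤ ‖f‖ * Real.exp (β * ‖z‖) := by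
  by_cases hz : z ∈ strip p 0
  · rw [Fp.ofStep_apply f hz]
    exact f.norm_apply_le z
  · rw [(Fp.ofStep p β n f).2.1 z hz, norm_zero]
    have := norm_nonneg f
    positivity

theorem Fp.continuous_ofStep (p : ℝ) (β n : ℕ) : Continuous (Fp.ofStep p β n) := by
  rw [continuous_iff_coinduced_le]
  exact le_iSup_of_le β (le_iSup_of_le n le_rfl)

theorem Fp.continuous_iff {X : Type*} [TopologicalSpace X] {F : Fp p → X} :
    Continuous F ↔ ∀ β n, Continuous fun f => F (Fp.ofStep p β n f) := by
  constructor
  · exact fun h β n => h.comp (Fp.continuous_ofStep p β n)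
  · intro h
    exact continuous_iSup_dom.mpr fun β => continuous_iSup_dom.mpr fun n =>
      continuous_coinduced_dom.mpr (h β n)

theorem Fp.ofStep_add {β n : ℕ} (f h : FpStep p β n) :
    Fp.ofStep p β n (f + h) = Fp.ofStep p β n f + Fp.ofStep p β n h :=
  Fp.ext fun z hz => by
    rw [Fp.add_apply, Fp.ofStep_apply _ hz, Fp.ofStep_apply _ hz, Fp.ofStep_apply _ hz,
      FpStep.add_apply]

/-- Restriction of a function to a closed strip as an element of the step space. -/
theorem FpStep.exists_of_function {β n : ℕ} {f : ℂ → ℂ} {C : ℝ}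
    (hc : ContinuousOn f (strip p (1 / (n + 1)))) (hd : DifferentiableOn ℂ f (openStrip p (1 / (n + 1))))
    (hb : ∀ z ∈ strip p (1 / (n + 1)), ‖f z‖ ≤ C * Real.exp (β * ‖z‖)) :
    ∃ F : FpStep p β n, ∀ z ∈ strip p (1 / (n + 1)), F z = f z := by
  have hsub : openStrip p (1 / (n + 1)) ⊆ strip p (1 / (n + 1)) := fun z hz => ⟨hz.1.le, hz.2.le⟩
  have heq : Set.EqOn ((strip p (1 / (n + 1))).indicator f) f (strip p (1 / (n + 1))) :=
    fun z hz => Set.indicator_of_mem hz f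
  refine ⟨⟨(strip p (1 / (n + 1))).indicator f, fun z hz => Set.indicator_of_notMem hz f,
    hc.congr heq, hd.congr fun z hz => heq (hsub hz), |C|, fun z => ?_⟩, heq⟩
  by_cases hz : z ∈ strip p (1 / (n + 1))
  · rw [heq hz]
    exact (hb z hz).trans (by gcongr; exact le_abs_self C)
  · rw [Set.indicator_of_notMem hz, norm_zero]
    positivity

theorem Fp.exists_ofStep (φ : Fp p) : ∃ β n, ∃ f : FpStep p β n, Fp.ofStep p β n f = φ := by
  obtain ⟨n, β, C, f, hc, hd, hb, hf⟩ := φ.2.2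
  obtain ⟨F, hF⟩ := FpStep.exists_of_function hc hd hb
  refine ⟨β, n, F, Fp.ext fun z hz => ?_⟩
  rw [Fp.ofStep_apply F hz, hF z (strip_zero_subset p n hz)]
  exact (hf z hz).symm

theorem Fp.exists_expHolomorphic (φ : Fp p) :
    ∃ h, ExpHolomorphic p h ∧ ∀ z ∈ strip p 0, φ z = h z := by
  obtain ⟨n, β, C, f, hc, hd, hb, hf⟩ := φ.2.2
  exact ⟨f, ⟨1 / (n + 1), by positivity, C, β, hd, fun z hz => hb z ⟨hz.1.le, hz.2.le⟩⟩, hf⟩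

theorem Fp.exists_bound (φ : Fp p) : ∃ (β : ℕ) (M : ℝ), 0 ≤ M ∧
    ∀ z, ‖φ z‖ ≤ M * Real.exp (β * ‖z‖) := by
  obtain ⟨β, n, f, rfl⟩ := φ.exists_ofStep
  exact ⟨β, ‖f‖, norm_nonneg _, Fp.norm_ofStep_apply_le f⟩

theorem Fp.continuous_line (φ : Fp p) {c : ℝ} (h0 : 0 ≤ c) (hc : c ≤ p) :
    Continuous fun ω : ℝ => φ (ω + c * I) := by
  obtain ⟨h, hh, heq⟩ := φ.exists_expHolomorphic
  have e : (fun ω : ℝ => φ (ω + c * I)) = fun ω : ℝ => h (ω + c * I) :=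
    funext fun ω => heq _ (mem_strip_zero.mpr (by simp [h0, hc]))
  rw [e, continuous_iff_continuousAt]
  intro ω
  have := (hh.analyticAt (z := ω + c * I) (by simpa) (by simpa)).continuousAt
  exact ContinuousAt.comp (f := fun ω : ℝ => (ω + c * I : ℂ)) this (by fun_prop)

/-- A linear functional that is bounded on functions of each exponential growth is continuous. -/
theorem exists_dual (ℓ : Fp p → ℂ) (hadd : ∀ φ ψ, ℓ (φ + ψ) = ℓ φ + ℓ ψ)
    (hsmul : ∀ (c : ℂ) φ, ℓ (c • φ) = c * ℓ φ)
    (hb : ∀ β : ℕ, ∃ C : ℝ, ∀ (φ : Fp p) (M : ℝ), 0 ≤ M →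
      (∀ z, ‖φ z‖ ≤ M * Real.exp (β * ‖z‖)) → ‖ℓ φ‖ ≤ C * M) :
    ∃ μ : FpDual p, ∀ φ, pair φ μ = ℓ φ := by
  let L : Fp p →ₗ[ℂ] ℂ := { toFun := ℓ, map_add' := hadd, map_smul' := hsmul }
  have hcont : Continuous L := by
    refine Fp.continuous_iff.mpr fun β n => ?_
    obtain ⟨C, hC⟩ := hb β
    let A : FpStep p β n →+ ℂ := AddMonoidHom.mk' (fun f => ℓ (Fp.ofStep p β n f)) fun f h => by
      rw [Fp.ofStep_add, hadd]
    exact AddMonoidHomClass.continuous_of_bound A C fun f =>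
      hC _ _ (norm_nonneg f) (Fp.norm_ofStep_apply_le f)
  exact ⟨(⟨L, hcont⟩ : Fp p →L[ℂ] ℂ), fun φ => rfl⟩

theorem pair_add_left (φ ψ : Fp p) (μ : FpDual p) : pair (φ + ψ) μ = pair φ μ + pair ψ μ :=
  map_add (show Fp p →L[ℂ] ℂ from μ) φ ψ

theorem pair_smul_left (c : ℂ) (φ : Fp p) (μ : FpDual p) : pair (c • φ) μ = c * pair φ μ :=
  map_smul (show Fp p →L[ℂ] ℂ from μ) c φ

theorem continuous_pair (μ : FpDual p) : Continuous fun φ : Fp p => pair φ μ :=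
  (show Fp p →L[ℂ] ℂ from μ).continuous

theorem FpDual.ext {μ ν : FpDual p} (h : ∀ φ, pair φ μ = pair φ ν) : μ = ν :=
  ContinuousLinearMap.ext (f := (show Fp p →L[ℂ] ℂ from μ)) h

theorem tendsto_dual_iff {X : Type*} {l : Filter X} {f : X → FpDual p} {μ : FpDual p} :
    Tendsto f l (𝓝 μ) ↔ ∀ φ, Tendsto (fun x => pair φ (f x)) l (𝓝 (pair φ μ)) := by
  rw [nhds_induced, tendsto_comap_iff, tendsto_pi_nhds]
  rfl

theorem pair_zero (φ : Fp p) : pair φ (0 : FpDual p) = 0 := rfl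

theorem pair_sum {ι : Type*} (φ : Fp p) (s : Finset ι) (f : ι → FpDual p) :
    pair φ (∑ i ∈ s, f i) = ∑ i ∈ s, pair φ (f i) := by
  let e : FpDual p →+ ℂ := AddMonoidHom.mk' (fun μ => pair φ μ) fun μ ν => pair_add φ μ ν
  exact map_sum e f s

/-- Evaluation at a point. -/
theorem exists_dual_eval (p : ℝ) (z : ℂ) : ∃ μ : FpDual p, ∀ φ, pair φ μ = φ z := by
  refine exists_dual (fun φ => φ z) (fun φ ψ => rfl) (fun c φ => rfl) fun β =>
    ⟨Real.exp (β * ‖z‖), fun φ M _ h => ?_⟩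
  rw [mul_comm]
  exact h z

theorem norm_add_mul_I_le (ω : ℝ) {c : ℝ} (h : 0 ≤ c) : ‖(ω + c * I : ℂ)‖ ≤ |ω| + c := by
  refine (norm_add_le _ _).trans ?_
  simp [abs_of_nonneg h]

theorem Fp.bound_line {φ : Fp p} {β : ℕ} {M : ℝ} (hM : 0 ≤ M)
    (h : ∀ z, ‖φ z‖ ≤ M * Real.exp (β * ‖z‖)) {c : ℝ} (h0 : 0 ≤ c) (ω : ℝ) :
    ‖φ (ω + c * I)‖ ≤ M * Real.exp (β * c) * Real.exp (β * |ω|) := by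
  refine (h _).trans ?_
  rw [mul_assoc, ← Real.exp_add, ← mul_add]
  gcongr
  rw [add_comm c]
  exact norm_add_mul_I_le ω h0

theorem Fp.rapidDecay_mul (φ : Fp p) {w : ℝ → ℂ} (hw : RapidDecay w) {c : ℝ} (h0 : 0 ≤ c)
    (hc : c ≤ p) : RapidDecay fun ω : ℝ => φ (ω + c * I) * w ω := by
  obtain ⟨β, M, hM, hb⟩ := φ.exists_bound
  exact hw.mul_of_exp_bound (φ.continuous_line h0 hc) (Fp.bound_line hM hb h0)

/-- Integration against a rapidly decaying weight over a horizontal line. -/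
theorem exists_dual_integral {w : ℝ → ℂ} (hw : RapidDecay w) {c : ℝ} (h0 : 0 ≤ c) (hc : c ≤ p) :
    ∃ μ : FpDual p, ∀ φ, pair φ μ = ∫ ω : ℝ, φ (ω + c * I) * w ω := by
  refine exists_dual _ (fun φ ψ => ?_) (fun a φ => ?_) fun β => ?_
  · rw [← integral_add (φ.rapidDecay_mul hw h0 hc).integrable
      (ψ.rapidDecay_mul hw h0 hc).integrable]
    simp_rw [Fp.add_apply, add_mul]
  · rw [← integral_const_mul]
    simp_rw [Fp.smul_apply, mul_assoc]
  · refine ⟨Real.exp (β * c) * ∫ ω : ℝ, Real.exp (β * |ω|) * ‖w ω‖, fun φ M hM h => ?_⟩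
    have := norm_integral_le_of_norm_le (f := fun ω : ℝ => φ (ω + c * I) * w ω)
      ((hw.integrable_exp_mul β).const_mul (M * Real.exp (β * c)))
      (Eventually.of_forall fun ω => by
        rw [norm_mul, ← mul_assoc]
        gcongr
        exact Fp.bound_line hM h h0 ω)
    rw [integral_const_mul] at this
    linarith

end Kuramoto

namespace Kuramoto

/-! ### A Volterra equation -/

theorem integral_exp_mul_le {b : ℝ} (hb : 0 < b) (t : ℝ) :
    ∫ s in (0 : ℝ)..t, Real.exp (b * s) ≤ Real.exp (b * t) / b := by
  have : ∫ s in (0 : ℝ)..t, Real.exp (b * s) = b⁻¹ * (Real.exp (b * t) - 1) := by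
    rw [intervalIntegral.integral_comp_mul_left (fun x => Real.exp x) hb.ne', integral_exp]
    simp
  rw [this, div_eq_inv_mul]
  gcongr
  linarith

theorem norm_integral_volterra_le {κ η : ℝ → ℂ} {M B b t : ℝ} (hb : 0 < b) (hM : 0 ≤ M)
    (hB : 0 ≤ B) (hκb : ∀ s, ‖κ s‖ ≤ M) (ht : 0 ≤ t)
    (hη : ∀ s, 0 ≤ s → s ≤ t → ‖η s‖ ≤ B * Real.exp (b * s)) :
    ‖∫ s in (0 : ℝ)..t, κ (t - s) * η s‖ ≤ M / b * B * Real.exp (b * t) := by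
  calc _ ≤ ∫ s in (0 : ℝ)..t, M * B * Real.exp (b * s) := by
        refine intervalIntegral.norm_integral_le_of_norm_le ht ?_
          (Continuous.intervalIntegrable (by fun_prop) _ _)
        refine Eventually.of_forall fun s hs => ?_
        rw [norm_mul, mul_assoc]
        exact mul_le_mul (hκb _) (hη s hs.1.le hs.2) (norm_nonneg _) hM
    _ = M * B * ∫ s in (0 : ℝ)..t, Real.exp (b * s) := intervalIntegral.integral_const_mul _ _
    _ ≤ M * B * (Real.exp (b * t) / b) := by
        gcongr
        exact integral_exp_mul_le hb t
    _ = _ := by ring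

/-- The homogeneous Volterra equation has only the trivial solution. -/
theorem volterra_eq_zero {κ x : ℝ → ℂ} {M : ℝ} (hκb : ∀ s, ‖κ s‖ ≤ M) (hx : Continuous x)
    (heq : ∀ t, 0 ≤ t → x t = ∫ s in (0 : ℝ)..t, κ (t - s) * x s) (T : ℝ) (hT : 0 ≤ T) :
    x T = 0 := by
  have hM : 0 ≤ M := (norm_nonneg _).trans (hκb 0)
  have hb : 0 < 2 * M + 1 := by linarith
  obtain ⟨t₀, ht₀, hmax⟩ := isCompact_Icc.exists_isMaxOn (Set.nonempty_Icc.mpr hT)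
    (f := fun t => ‖x t‖ * Real.exp (-((2 * M + 1) * t))) (by fun_prop)
  set B := ‖x t₀‖ * Real.exp (-((2 * M + 1) * t₀)) with hB
  have hBnn : 0 ≤ B := by positivity
  have hle : ∀ s, 0 ≤ s → s ≤ T → ‖x s‖ ≤ B * Real.exp ((2 * M + 1) * s) := by
    intro s h0 h1
    have : ‖x s‖ * Real.exp (-((2 * M + 1) * s)) ≤ B := hmax (Set.mem_Icc.mpr ⟨h0, h1⟩)
    rw [Real.exp_neg, mul_inv_le_iff₀ (Real.exp_pos _)] at this
    exact this
  have h1 := norm_integral_volterra_le hb hM hBnn hκb ht₀.1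
    (fun s h0 h1 => hle s h0 (h1.trans ht₀.2))
  rw [← heq t₀ ht₀.1] at h1
  have h2 : B ≤ M / (2 * M + 1) * B := by
    rw [hB, Real.exp_neg, mul_inv_le_iff₀ (Real.exp_pos _), ← Real.exp_neg, ← hB]
    exact h1
  have h3 : M / (2 * M + 1) ≤ 1 / 2 := by
    rw [div_le_div_iff₀ hb two_pos]; linarith
  have h4 : M / (2 * M + 1) * B ≤ 1 / 2 * B := by gcongr
  have h5 : B = 0 := by linarith
  have h6 := hle T hT le_rfl
  rw [h5, zero_mul] at h6
  exact norm_le_zero_iff.mp h6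

theorem volterra_unique {κ a x y : ℝ → ℂ} {M : ℝ} (hκ : Continuous κ) (hκb : ∀ s, ‖κ s‖ ≤ M)
    (hx : Continuous x) (hy : Continuous y)
    (hxe : ∀ t, 0 ≤ t → x t = a t + ∫ s in (0 : ℝ)..t, κ (t - s) * x s)
    (hye : ∀ t, 0 ≤ t → y t = a t + ∫ s in (0 : ℝ)..t, κ (t - s) * y s) (t : ℝ) (ht : 0 ≤ t) :
    x t = y t := by
  refine sub_eq_zero.mp (volterra_eq_zero (x := fun t => x t - y t) hκb (hx.sub hy)
    (fun t ht => ?_) t ht)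
  rw [hxe t ht, hye t ht, add_sub_add_left_eq_sub, ← intervalIntegral.integral_sub
    (Continuous.intervalIntegrable (by fun_prop) _ _)
    (Continuous.intervalIntegrable (by fun_prop) _ _)]
  simp_rw [mul_sub]

/-- Solvability of the Volterra equation with bounded data, with an exponential bound. -/
theorem exists_volterra {κ a : ℝ → ℂ} {M A : ℝ} (hκ : Continuous κ) (hκb : ∀ s, ‖κ s‖ ≤ M)
    (ha : Continuous a) (hab : ∀ t, ‖a t‖ ≤ A) :
    ∃ η : ℝ → ℂ, Continuous η ∧
      (∀ t, 0 ≤ t → η t = a t + ∫ s in (0 : ℝ)..t, κ (t - s) * η s) ∧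
      ∀ t, 0 ≤ t → ‖η t‖ ≤ 2 * A * Real.exp ((2 * M + 1) * t) := by
  have hM : 0 ≤ M := (norm_nonneg _).trans (hκb 0)
  have hA : 0 ≤ A := (norm_nonneg _).trans (hab 0)
  set b : ℝ := 2 * M + 1 with hbdef
  have hb : 0 < b := by linarith
  have hMb : M / b ≤ 1 / 2 := by rw [div_le_div_iff₀ hb two_pos]; linarith
  -- the integral operator on bounded continuous functions, with weight `exp (-b t)`
  set V : (ℝ → ℂ) → ℝ → ℂ := fun x t => Real.exp (-(b * max t 0)) *
    ∫ s in (0 : ℝ)..(max t 0), κ (max t 0 - s) * (Real.exp (b * s) * x s) with hV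
  have hVc : ∀ x : ℝ → ℂ, Continuous x → Continuous (V x) := by
    intro x hx
    refine Continuous.mul (by fun_prop) ?_
    refine intervalIntegral.continuous_parametric_intervalIntegral_of_continuous
      (f := fun t s => κ (max t 0 - s) * (Real.exp (b * s) * x s)) ?_ (by fun_prop)
    simp only [Function.uncurry_def]
    fun_prop
  have hVb : ∀ (x : ℝ → ℂ) (B : ℝ), 0 ≤ B → (∀ s, ‖x s‖ ≤ B) → ∀ t, ‖V x t‖ ≤ 1 / 2 * B := by
    intro x B hB hx t
    have := norm_integral_volterra_le (η := fun s => Real.exp (b * s) * x s) (t := max t 0)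
      hb hM hB hκb (le_max_right _ _) (fun s _ _ => by
        rw [norm_mul, Complex.norm_real, Real.norm_of_nonneg (Real.exp_pos _).le, mul_comm]
        gcongr
        exact hx s)
    simp only [hV]
    rw [norm_mul, Complex.norm_real, Real.norm_of_nonneg (Real.exp_pos _).le, Real.exp_neg,
      inv_mul_le_iff₀ (Real.exp_pos _)]
    refine this.trans ?_
    rw [mul_comm]
    gcongr
  have hVsub : ∀ x y : ℝ → ℂ, Continuous x → Continuous y → ∀ t,
      V x t - V y t = V (fun s => x s - y s) t := by
    intro x y hx hy t
    simp only [hV]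
    rw [← mul_sub, ← intervalIntegral.integral_sub
      (Continuous.intervalIntegrable (by fun_prop) _ _)
      (Continuous.intervalIntegrable (by fun_prop) _ _)]
    congr 1
    refine intervalIntegral.integral_congr fun s _ => ?_
    ring
  have hac : Continuous fun t : ℝ => (Real.exp (-(b * max t 0)) : ℂ) * a (max t 0) := by fun_prop
  have hawb : ∀ t : ℝ, ‖(Real.exp (-(b * max t 0)) : ℂ) * a (max t 0)‖ ≤ A := by
    intro t
    rw [norm_mul, Complex.norm_real, Real.norm_of_nonneg (Real.exp_pos _).le]
    refine (mul_le_of_le_one_left (norm_nonneg _) ?_).trans (hab _)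
    rw [Real.exp_le_one_iff]
    have := le_max_right t 0
    nlinarith
  let Φ : BoundedContinuousFunction ℝ ℂ → BoundedContinuousFunction ℝ ℂ := fun x =>
    BoundedContinuousFunction.ofNormedAddCommGroup
      (fun t => (Real.exp (-(b * max t 0)) : ℂ) * a (max t 0) + V x t)
      (hac.add (hVc x x.continuous)) (A + 1 / 2 * ‖x‖) fun t =>
        (norm_add_le _ _).trans (add_le_add (hawb t)
          (hVb x ‖x‖ (norm_nonneg _) (fun s => x.norm_coe_le_norm s) t))
  have hcontr : ContractingWith (1 / 2 : ℝ≥0) Φ := by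
    refine ⟨by norm_num, LipschitzWith.of_dist_le_mul fun x y => ?_⟩
    rw [BoundedContinuousFunction.dist_le (by positivity)]
    intro t
    rw [dist_eq_norm]
    have e : Φ x t - Φ y t = V (fun s => x s - y s) t := by
      rw [← hVsub x y x.continuous y.continuous]
      change (_ + V x t) - (_ + V y t) = _
      ring
    rw [e]
    refine (hVb _ (dist x y) dist_nonneg (fun s => ?_) t).trans (by norm_num)
    rw [← dist_eq_norm]
    exact BoundedContinuousFunction.dist_coe_le_dist s
  set x := ContractingWith.fixedPoint Φ hcontr with hx
  have hfix : ∀ t, x t = (Real.exp (-(b * max t 0)) : ℂ) * a (max t 0) + V x t := fun t => by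
    have := hcontr.fixedPoint_isFixedPt (f := Φ)
    exact (congrArg (fun w : BoundedContinuousFunction ℝ ℂ => w t) this).symm
  have hxn : ‖x‖ ≤ 2 * A := by
    have h1 : ‖x‖ ≤ A + 1 / 2 * ‖x‖ := by
      rw [BoundedContinuousFunction.norm_le (by positivity)]
      intro t
      rw [hfix t]
      exact (norm_add_le _ _).trans (add_le_add (hawb t)
        (hVb x ‖x‖ (norm_nonneg _) (fun s => x.norm_coe_le_norm s) t))
    linarith
  have hxc := x.continuous
  refine ⟨fun t => (Real.exp (b * t) : ℂ) * x t, by fun_prop, fun t ht => ?_, fun t _ => ?_⟩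
  · have h1 := hfix t
    simp only [hV, max_eq_left ht] at h1
    have h2 : (Real.exp (b * t) : ℂ) * Real.exp (-(b * t)) = 1 := by
      rw [← ofReal_mul, ← Real.exp_add]; simp
    simp only
    rw [h1]
    linear_combination (a t + ∫ s in (0 : ℝ)..t, κ (t - s) * (Real.exp (b * s) * x s)) * h2
  · rw [norm_mul, Complex.norm_real, Real.norm_of_nonneg (Real.exp_pos _).le, mul_comm]
    gcongr
    exact (x.norm_coe_le_norm t).trans hxn

/-! ### Orbits -/

/-- The solution of `v' = iz v + c η` with `v(0) = w`. -/
noncomputable def orbit (c : ℂ) (η : ℝ → ℂ) (w z : ℂ) (t : ℝ) : ℂ :=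
  Complex.exp (I * z * t) * (w + c * ∫ s in (0 : ℝ)..t, Complex.exp (-(I * z * s)) * η s)

variable {c w z : ℂ} {η : ℝ → ℂ}

theorem orbit_zero (c : ℂ) (η : ℝ → ℂ) (w z : ℂ) : orbit c η w z 0 = w := by simp [orbit]

theorem hasDerivAt_orbit (hη : Continuous η) (c w z : ℂ) (t : ℝ) :
    HasDerivAt (orbit c η w z) (I * z * orbit c η w z t + c * η t) t := by
  have hc : Continuous fun s : ℝ => Complex.exp (-(I * z * s)) * η s := by fun_prop
  have h1 : HasDerivAt (fun t : ℝ => Complex.exp (I * z * t))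
      (Complex.exp (I * z * t) * (I * z * 1)) t :=
    (((hasDerivAt_id (t : ℂ)).const_mul (I * z)).cexp).comp_ofReal
  have h2 := ((intervalIntegral.integral_hasDerivAt_right (hc.intervalIntegrable 0 t)
    (hc.stronglyMeasurableAtFilter _ _) hc.continuousAt).const_mul c).const_add w
  refine (h1.mul h2).congr_deriv ?_
  have h3 : Complex.exp (I * z * t) * Complex.exp (-(I * z * t)) = 1 := by
    rw [← Complex.exp_add]; simp
  rw [orbit]
  linear_combination c * η t * h3

theorem orbit_eq (c : ℂ) (η : ℝ → ℂ) (w z : ℂ) (t : ℝ) : orbit c η w z t =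
    Complex.exp (I * z * t) * w + c * ∫ s in (0 : ℝ)..t, Complex.exp (I * z * (t - s)) * η s := by
  rw [orbit, mul_add, mul_left_comm, ← intervalIntegral.integral_const_mul]
  congr 3
  ext s
  rw [← mul_assoc, ← Complex.exp_add]
  congr 2
  ring

theorem orbit_add (hη : Continuous η) (c w z : ℂ) (t τ : ℝ) :
    orbit c η w z (t + τ) = orbit c (fun s => η (t + s)) (orbit c η w z t) z τ := by
  have hc : Continuous fun s : ℝ => Complex.exp (-(I * z * s)) * η s := by fun_prop
  rw [orbit, orbit, orbit, ← intervalIntegral.integral_add_adjacent_intervals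
    (hc.intervalIntegrable 0 t) (hc.intervalIntegrable t (t + τ))]
  have h1 : ∫ s in t..(t + τ), Complex.exp (-(I * z * s)) * η s =
      Complex.exp (-(I * z * t)) *
        ∫ s in (0 : ℝ)..τ, Complex.exp (-(I * z * s)) * η (t + s) := by
    have := intervalIntegral.integral_comp_add_left (a := 0) (b := τ)
      (fun s : ℝ => Complex.exp (-(I * z * s)) * η s) t
    rw [add_zero] at this
    rw [← this, ← intervalIntegral.integral_const_mul]
    refine intervalIntegral.integral_congr fun s _ => ?_
    rw [← mul_assoc, ← Complex.exp_add]
    congr 2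
    push_cast; ring
  have h2 : Complex.exp (I * z * ((t + τ : ℝ) : ℂ)) =
      Complex.exp (I * z * τ) * Complex.exp (I * z * t) := by
    rw [← Complex.exp_add]; congr 1; push_cast; ring
  have h3 : Complex.exp (I * z * t) * Complex.exp (-(I * z * t)) = 1 := by
    rw [← Complex.exp_add]; simp
  rw [h1, h2]
  linear_combination (Complex.exp (I * z * τ) * c *
    ∫ s in (0 : ℝ)..τ, Complex.exp (-(I * z * s)) * η (t + s)) * h3

theorem norm_exp_I_mul_le {z : ℂ} (hz : -1 ≤ z.im) {t : ℝ} (ht : 0 ≤ t) :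
    ‖Complex.exp (I * z * t)‖ ≤ Real.exp t := by
  rw [Complex.norm_exp]
  gcongr
  simp
  nlinarith

theorem norm_orbit_le (c w : ℂ) {z : ℂ} (hz : -1 ≤ z.im) {t B : ℝ} (ht : 0 ≤ t)
    (hη : ∀ s, 0 ≤ s → s ≤ t → ‖η s‖ ≤ B) :
    ‖orbit c η w z t‖ ≤ Real.exp t * (‖w‖ + ‖c‖ * (B * t)) := by
  have hB : 0 ≤ B := (norm_nonneg _).trans (hη 0 le_rfl ht)
  rw [orbit_eq, mul_add]
  refine (norm_add_le _ _).trans (add_le_add ?_ ?_)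
  · rw [norm_mul]
    gcongr
    exact norm_exp_I_mul_le hz ht
  · rw [norm_mul, mul_left_comm]
    gcongr
    have := intervalIntegral.norm_integral_le_of_norm_le_const (a := 0) (b := t)
      (f := fun s : ℝ => Complex.exp (I * z * (t - s)) * η s) (C := Real.exp t * B) (fun s hs => by
        rw [Set.uIoc_of_le ht] at hs
        rw [norm_mul]
        refine mul_le_mul ?_ (hη s hs.1.le hs.2) (norm_nonneg _) (Real.exp_pos _).le
        have := norm_exp_I_mul_le hz (t := t - s) (by linarith [hs.2])
        push_cast at this
        refine this.trans ?_
        gcongr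
        linarith [hs.1])
    rw [sub_zero, abs_of_nonneg ht] at this
    rwa [← mul_assoc]

theorem differentiable_integral_exp (hη : Continuous η) (t : ℝ) :
    Differentiable ℂ fun z : ℂ => ∫ s in (0 : ℝ)..t, Complex.exp (-(I * z * s)) * η s := by
  intro z₀
  obtain ⟨B, hB⟩ := (isCompact_closedBall z₀ 1 |>.prod (isCompact_uIcc (a := 0) (b := t))).bddAbove_image
    (f := fun q : ℂ × ℝ => ‖Complex.exp (-(I * q.1 * q.2)) * (-(I * q.2)) * η q.2‖) (by fun_prop)
  refine (intervalIntegral.hasDerivAt_integral_of_dominated_loc_of_deriv_le (𝕜 := ℂ)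
    (F := fun z (s : ℝ) => Complex.exp (-(I * z * s)) * η s)
    (F' := fun z (s : ℝ) => Complex.exp (-(I * z * s)) * (-(I * s)) * η s) (x₀ := z₀)
    (bound := fun _ => B) (Metric.closedBall_mem_nhds z₀ one_pos) ?_ ?_ ?_ ?_ ?_ ?_).2.differentiableAt
  · exact Eventually.of_forall fun z => Continuous.aestronglyMeasurable (by fun_prop)
  · exact Continuous.intervalIntegrable (by fun_prop) _ _
  · exact Continuous.aestronglyMeasurable (by fun_prop)
  · refine Eventually.of_forall fun s hs z hz => ?_
    exact hB ⟨(z, s), ⟨hz, Set.uIoc_subset_uIcc hs⟩, rfl⟩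
  · exact continuous_const.intervalIntegrable _ _
  · refine Eventually.of_forall fun s _ z _ => ?_
    have h1 : HasDerivAt (fun z : ℂ => -(I * z * s)) (-(I * 1 * s)) z :=
      (((hasDerivAt_id z).const_mul I).mul_const (s : ℂ)).neg
    exact (h1.cexp.mul_const (η s)).congr_deriv (by ring)

/-- Integration of an orbit against a weight. -/
theorem integral_orbit {u v : ℝ → ℂ} (hu : Integrable u) (hv : Integrable v) (hη : Continuous η)
    (c : ℂ) {t : ℝ} (ht : 0 ≤ t) :
    ∫ ω : ℝ, (Complex.exp (I * ω * t) * u ω +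
        c * (∫ s in (0 : ℝ)..t, Complex.exp (I * ω * (t - s)) * η s) * v ω) =
      charTransform u t + c * ∫ s in (0 : ℝ)..t, charTransform v (t - s) * η s := by
  have hfin : IsFiniteMeasure (volume.restrict (Set.uIoc 0 t)) := by
    rw [Set.uIoc]; infer_instance
  have hηi : Integrable η (volume.restrict (Set.uIoc 0 t)) := by
    rw [Set.uIoc_of_le ht]
    exact (hη.intervalIntegrable 0 t).1
  have hprod : Integrable (Function.uncurry fun (s ω : ℝ) =>
      Complex.exp (I * ω * (t - s)) * η s * v ω)
      ((volume.restrict (Set.uIoc 0 t)).prod volume) := by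
    refine (hηi.mul_prod hv).norm.mono' ?_ (Eventually.of_forall fun q => ?_)
    · refine AEStronglyMeasurable.mul (Continuous.aestronglyMeasurable ?_)
        hv.aestronglyMeasurable.comp_snd
      fun_prop
    · simp only [Function.uncurry]
      rw [norm_mul, norm_mul, norm_mul, ← ofReal_sub, norm_exp_I_mul, one_mul]
  have hsw := intervalIntegral_integral_swap hprod
  have e1 : ∀ ω : ℝ, ∫ s in (0 : ℝ)..t, Complex.exp (I * ω * (t - s)) * η s * v ω =
      (∫ s in (0 : ℝ)..t, Complex.exp (I * ω * (t - s)) * η s) * v ω := fun ω =>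
    intervalIntegral.integral_mul_const _ _
  have hi2 : Integrable fun ω : ℝ => (∫ s in (0 : ℝ)..t, Complex.exp (I * ω * (t - s)) * η s) * v ω := by
    have := hprod.integral_prod_right
    refine this.congr (Eventually.of_forall fun ω => ?_)
    simp only [Function.uncurry]
    rw [← e1, intervalIntegral.integral_of_le ht, Set.uIoc_of_le ht]
  simp_rw [mul_assoc c]
  rw [integral_add (integrable_exp_I_mul hu t) (hi2.const_mul c), integral_const_mul]
  congr 2
  simp_rw [← e1]
  rw [← hsw]
  refine intervalIntegral.integral_congr fun s _ => ?_
  simp only [charTransform]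
  rw [← integral_mul_const]
  refine integral_congr_ae (Eventually.of_forall fun ω => ?_)
  simp only
  push_cast
  ring

end Kuramoto

namespace Kuramoto

/-! ### Convergence in the test function space -/

variable {p : ℝ}

/-- Functions that define an element of the step space `F_p(β, n + 1)`. -/
structure IsStepFunction (p : ℝ) (β n : ℕ) (f : ℂ → ℂ) : Prop where
  continuousOn : ContinuousOn f (strip p (1 / (n + 1)))
  differentiableOn : DifferentiableOn ℂ f (openStrip p (1 / (n + 1)))
  bound : ∃ C : ℝ, 0 ≤ C ∧ ∀ z ∈ strip p (1 / (n + 1)), ‖f z‖ ≤ C * Real.exp (β * ‖z‖)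

theorem FpStep.isStepFunction {β n : ℕ} (f : FpStep p β n) : IsStepFunction p β n f :=
  ⟨f.2.2.1, f.2.2.2.1, ‖f‖, norm_nonneg f, fun z _ => f.norm_apply_le z⟩

theorem IsStepFunction.exists_step {β n : ℕ} {f : ℂ → ℂ} (hf : IsStepFunction p β n f) :
    ∃ F : FpStep p β n, ∀ z ∈ strip p (1 / (n + 1)), F z = f z := by
  obtain ⟨C, -, hC⟩ := hf.bound
  exact FpStep.exists_of_function hf.continuousOn hf.differentiableOn hC

theorem IsStepFunction.mono {β β' n : ℕ} {f : ℂ → ℂ} (hf : IsStepFunction p β n f) (h : β ≤ β') :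
    IsStepFunction p β' n f := by
  obtain ⟨C, hC0, hC⟩ := hf.bound
  refine ⟨hf.continuousOn, hf.differentiableOn, C, hC0, fun z hz => (hC z hz).trans ?_⟩
  gcongr

theorem IsStepFunction.sub {β n : ℕ} {f h : ℂ → ℂ} (hf : IsStepFunction p β n f)
    (hh : IsStepFunction p β n h) : IsStepFunction p β n fun z => f z - h z := by
  obtain ⟨C, hC0, hC⟩ := hf.bound
  obtain ⟨D, hD0, hD⟩ := hh.bound
  refine ⟨hf.continuousOn.sub hh.continuousOn, hf.differentiableOn.sub hh.differentiableOn, C + D,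
    by positivity, fun z hz => (norm_sub_le _ _).trans ?_⟩
  rw [add_mul]
  exact add_le_add (hC z hz) (hD z hz)

theorem IsStepFunction.const_mul {β n : ℕ} {f : ℂ → ℂ} (hf : IsStepFunction p β n f) (c : ℂ) :
    IsStepFunction p β n fun z => c * f z := by
  obtain ⟨C, hC0, hC⟩ := hf.bound
  refine ⟨continuousOn_const.mul hf.continuousOn, hf.differentiableOn.const_mul c, ‖c‖ * C,
    by positivity, fun z hz => ?_⟩
  rw [norm_mul, mul_assoc]
  gcongr
  exact hC z hz

theorem norm_le_exp_norm (z : ℂ) : ‖z‖ ≤ Real.exp ‖z‖ := by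
  linarith [Real.add_one_le_exp ‖z‖]

theorem exp_norm_mul_exp (β : ℕ) (z : ℂ) :
    Real.exp ‖z‖ * Real.exp (β * ‖z‖) = Real.exp ((β + 1 : ℕ) * ‖z‖) := by
  rw [← Real.exp_add]; congr 1; push_cast; ring

theorem IsStepFunction.mul_id_add_const {β n : ℕ} {f : ℂ → ℂ} (hf : IsStepFunction p β n f)
    (c : ℂ) : IsStepFunction p (β + 1) n fun z => I * z * f z + c := by
  obtain ⟨C, hC0, hC⟩ := hf.bound
  refine ⟨((continuousOn_const.mul continuousOn_id).mul hf.continuousOn).add continuousOn_const,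
    (((differentiableOn_const I).mul differentiableOn_id).mul hf.differentiableOn).add
      (differentiableOn_const c), C + ‖c‖, by positivity, fun z hz => ?_⟩
  refine (norm_add_le _ _).trans ?_
  rw [add_mul, norm_mul, norm_mul, norm_I, one_mul]
  refine add_le_add ?_ (le_mul_of_one_le_right (norm_nonneg c) (Real.one_le_exp (by positivity)))
  rw [← exp_norm_mul_exp, mul_left_comm C]
  exact mul_le_mul (norm_le_exp_norm z) (hC z hz) (norm_nonneg _) (Real.exp_pos _).le

theorem Fp.tendsto_of_bound {β n : ℕ} {X : Type*} {l : Filter X} {F : X → ℂ → ℂ} {F₀ : ℂ → ℂ}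
    (hF : ∀ x, IsStepFunction p β n (F x)) (hF₀ : IsStepFunction p β n F₀) {ξ : X → Fp p}
    {ξ₀ : Fp p} (hξ : ∀ x, ∀ z ∈ strip p 0, ξ x z = F x z) (hξ₀ : ∀ z ∈ strip p 0, ξ₀ z = F₀ z)
    (h : ∀ δ : ℝ, 0 < δ → ∀ᶠ x in l, ∀ z ∈ strip p (1 / (n + 1)),
      ‖F x z - F₀ z‖ ≤ δ * Real.exp (β * ‖z‖)) : Tendsto ξ l (𝓝 ξ₀) := by
  choose W hW using fun x => (hF x).exists_step
  obtain ⟨W₀, hW₀⟩ := hF₀.exists_step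
  have e : ∀ x, ξ x = Fp.ofStep p β n (W x) := fun x => Fp.ext fun z hz => by
    rw [hξ x z hz, Fp.ofStep_apply _ hz, hW x z (strip_zero_subset p n hz)]
  have e₀ : ξ₀ = Fp.ofStep p β n W₀ := Fp.ext fun z hz => by
    rw [hξ₀ z hz, Fp.ofStep_apply _ hz, hW₀ z (strip_zero_subset p n hz)]
  rw [e₀, funext e]
  refine (Fp.continuous_ofStep p β n).continuousAt.tendsto.comp ?_
  rw [Metric.tendsto_nhds]
  intro δ hδ
  filter_upwards [h (δ / 2) (by positivity)] with x hx
  rw [dist_eq_norm]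
  refine lt_of_le_of_lt (FpStep.norm_le _ fun z => ?_) (half_lt_self hδ)
  rw [FpStep.sub_apply]
  by_cases hz : z ∈ strip p (1 / (n + 1))
  · rw [hW x z hz, hW₀ z hz]
    exact hx z hz
  · rw [(W x).2.1 z hz, W₀.2.1 z hz, sub_self, norm_zero]
    positivity

/-! ### The semigroup generated by `T₁` -/

theorem neg_one_le_im {n : ℕ} {z : ℂ} (hz : z ∈ strip p (1 / (n + 1))) : -1 ≤ z.im := by
  have h1 : (1 : ℝ) / (n + 1) ≤ 1 := by
    rw [div_le_one (by positivity)]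
    have : (0 : ℝ) ≤ n := by positivity
    linarith
  linarith [hz.1]

theorem exists_norm_bound_on_Icc {η : ℝ → ℂ} (hη : Continuous η) (T : ℝ) :
    ∃ B : ℝ, 0 ≤ B ∧ ∀ s, 0 ≤ s → s ≤ T → ‖η s‖ ≤ B := by
  obtain ⟨B, hB⟩ := isCompact_Icc.exists_bound_of_continuousOn (s := Set.Icc 0 T) hη.continuousOn
  exact ⟨|B|, abs_nonneg B, fun s h0 h1 => (hB s ⟨h0, h1⟩).trans (le_abs_self B)⟩

theorem IsStepFunction.orbit {β n : ℕ} {f : ℂ → ℂ} (hf : IsStepFunction p β n f) {η : ℝ → ℂ}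
    (hη : Continuous η) (c : ℂ) {t : ℝ} (ht : 0 ≤ t) :
    IsStepFunction p β n fun z => orbit c η (f z) z t := by
  obtain ⟨C, hC0, hC⟩ := hf.bound
  obtain ⟨B, hB0, hB⟩ := exists_norm_bound_on_Icc hη t
  have hd := differentiable_integral_exp hη t
  have he : Differentiable ℂ fun z : ℂ => Complex.exp (I * z * t) := by fun_prop
  refine ⟨?_, ?_, Real.exp t * (C + ‖c‖ * (B * t)), by positivity, fun z hz => ?_⟩
  · exact he.continuous.continuousOn.mul
      (hf.continuousOn.add (continuousOn_const.mul hd.continuous.continuousOn))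
  · exact he.differentiableOn.mul (hf.differentiableOn.add (hd.differentiableOn.const_mul c))
  · refine (norm_orbit_le c (f z) (neg_one_le_im hz) ht hB).trans ?_
    rw [mul_assoc, add_mul]
    have e1 : ‖c‖ * (B * t) ≤ ‖c‖ * (B * t) * Real.exp (β * ‖z‖) :=
      le_mul_of_one_le_right (by positivity) (Real.one_le_exp (by positivity))
    exact mul_le_mul_of_nonneg_left (add_le_add (hC z hz) e1) (Real.exp_pos _).le

/-- Lipschitz dependence of an orbit on time. -/
theorem norm_orbit_sub_le {c w z : ℂ} {η : ℝ → ℂ} (hη : Continuous η) (hz : -1 ≤ z.im)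
    {T A B s t : ℝ} {β : ℕ} (hs : 0 ≤ s) (hst : s ≤ t) (htT : t ≤ T)
    (hB : ∀ s, 0 ≤ s → s ≤ T → ‖η s‖ ≤ B) (hw : ‖w‖ ≤ A * Real.exp (β * ‖z‖)) :
    ‖orbit c η w z t - orbit c η w z s‖ ≤
      (Real.exp T * (A + ‖c‖ * (B * T)) + ‖c‖ * B) * (t - s) *
        Real.exp ((β + 1 : ℕ) * ‖z‖) := by
  have hT : 0 ≤ T := by linarith
  have hB0 : 0 ≤ B := (norm_nonneg _).trans (hB 0 le_rfl hT)
  have h := Convex.norm_image_sub_le_of_norm_hasDerivWithin_le (s := Set.Icc s t)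
    (C := (Real.exp T * (A + ‖c‖ * (B * T)) + ‖c‖ * B) * Real.exp ((β + 1 : ℕ) * ‖z‖))
    (fun r _ => (hasDerivAt_orbit hη c w z r).hasDerivWithinAt) (fun r hr => ?_)
    (convex_Icc s t) (Set.left_mem_Icc.mpr hst) (Set.right_mem_Icc.mpr hst)
  · rw [Real.norm_of_nonneg (by linarith)] at h
    refine h.trans (le_of_eq (by ring))
  · have hr0 : 0 ≤ r := hs.trans hr.1
    have hrT : r ≤ T := hr.2.trans htT
    have h1 := norm_orbit_le (η := η) c w hz hr0 (fun s h0 h1 => hB s h0 (h1.trans hrT))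
    have h2 : ‖orbit c η w z r‖ ≤ Real.exp T * (A + ‖c‖ * (B * T)) * Real.exp (β * ‖z‖) := by
      refine h1.trans ?_
      rw [mul_assoc, add_mul]
      have e1 : ‖c‖ * (B * r) ≤ ‖c‖ * (B * T) * Real.exp (β * ‖z‖) :=
        (mul_le_mul_of_nonneg_left (mul_le_mul_of_nonneg_left hrT hB0) (norm_nonneg c)).trans
          (le_mul_of_one_le_right (by positivity) (Real.one_le_exp (by positivity)))
      gcongr
    refine (norm_add_le _ _).trans ?_
    rw [add_mul, norm_mul, norm_mul, norm_mul, norm_I, one_mul]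
    refine add_le_add ?_ ?_
    · rw [← exp_norm_mul_exp, mul_left_comm]
      exact mul_le_mul (norm_le_exp_norm z) h2 (norm_nonneg _) (Real.exp_pos _).le
    · refine le_trans ?_ (le_mul_of_one_le_right (by positivity) (Real.one_le_exp (by positivity)))
      gcongr
      exact hB r hr0 hrT

theorem Fp.tendsto_orbit {β n : ℕ} {f : ℂ → ℂ} (hf : IsStepFunction p β n f) {η : ℝ → ℂ}
    (hη : Continuous η) (c : ℂ) {ξ : ℝ≥0 → Fp p}
    (hξ : ∀ t : ℝ≥0, ∀ z ∈ strip p 0, ξ t z = orbit c η (f z) z t) : Continuous ξ := by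
  rw [continuous_iff_continuousAt]
  intro t₀
  obtain ⟨A, hA0, hA⟩ := hf.bound
  obtain ⟨B, hB0, hB⟩ := exists_norm_bound_on_Icc hη (t₀ + 1)
  have horb : ∀ t : ℝ≥0, IsStepFunction p (β + 1) n fun z => orbit c η (f z) z t := fun t =>
    (hf.orbit hη c t.2).mono (Nat.le_succ β)
  refine Fp.tendsto_of_bound horb (horb t₀) hξ (hξ t₀) fun δ hδ => ?_
  set C := Real.exp (t₀ + 1) * (A + ‖c‖ * (B * (t₀ + 1))) + ‖c‖ * B with hC
  have hC0 : 0 ≤ C := by positivity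
  have h1 : ∀ᶠ t : ℝ≥0 in 𝓝 t₀, t < t₀ + 1 := eventually_lt_nhds (by simp)
  have h2 : ∀ᶠ t : ℝ≥0 in 𝓝 t₀, dist t t₀ < δ / (C + 1) :=
    Metric.ball_mem_nhds t₀ (by positivity)
  filter_upwards [h1, h2] with t ht1 ht2 z hz
  have ht1' : (t : ℝ) ≤ t₀ + 1 := by exact_mod_cast ht1.le
  rw [NNReal.dist_eq, lt_div_iff₀ (by positivity)] at ht2
  have h3 : ‖orbit c η (f z) z t - orbit c η (f z) z t₀‖ ≤
      C * |(t : ℝ) - t₀| * Real.exp ((β + 1 : ℕ) * ‖z‖) := by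
    rcases le_total (t₀ : ℝ) t with h | h
    · rw [abs_of_nonneg (by linarith)]
      exact norm_orbit_sub_le hη (neg_one_le_im hz) t₀.2 h ht1' hB (hA z hz)
    · rw [norm_sub_rev, abs_of_nonpos (by linarith), neg_sub]
      exact norm_orbit_sub_le hη (neg_one_le_im hz) t.2 h (by linarith) hB (hA z hz)
  refine h3.trans ?_
  gcongr
  nlinarith [abs_nonneg ((t : ℝ) - t₀)]

theorem Fp.tendsto_orbit_deriv {β n : ℕ} {f : ℂ → ℂ} (hf : IsStepFunction p β n f) {η : ℝ → ℂ}
    (hη : Continuous η) (c : ℂ) {ξ : ℝ≥0 → Fp p} {φ ζ : Fp p}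
    (hξ : ∀ t : ℝ≥0, ∀ z ∈ strip p 0, ξ t z = orbit c η (f z) z t)
    (hφ : ∀ z ∈ strip p 0, φ z = f z) (hζ : ∀ z ∈ strip p 0, ζ z = I * z * f z + c * η 0) :
    Tendsto (fun h : ℝ≥0 => ((h : ℝ) : ℂ)⁻¹ • (ξ h - φ)) (𝓝[>] 0) (𝓝 ζ) := by
  obtain ⟨A, hA0, hA⟩ := hf.bound
  obtain ⟨B, hB0, hB⟩ := exists_norm_bound_on_Icc hη 1
  set C := Real.exp 1 * (A + ‖c‖ * (B * 1)) + ‖c‖ * B with hC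
  have hC0 : 0 ≤ C := by positivity
  refine Fp.tendsto_of_bound (β := β + 1 + 1) (n := n)
    (F := fun (h : ℝ≥0) z => ((h : ℝ) : ℂ)⁻¹ * (orbit c η (f z) z h - f z))
    (F₀ := fun z => I * z * f z + c * η 0)
    (fun h => (((hf.orbit hη c h.2).sub hf).const_mul _).mono (by omega))
    ((hf.mul_id_add_const _).mono (by omega)) (fun h z hz => ?_) hζ fun δ hδ => ?_
  · rw [Fp.smul_apply, Fp.sub_apply, hξ h z hz, hφ z hz]
  · obtain ⟨r, hr, hr'⟩ := Metric.continuousAt_iff.mp (hη.continuousAt (x := 0))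
      (δ / 2 / (‖c‖ + 1)) (by positivity)
    have h1 : ∀ᶠ h : ℝ≥0 in 𝓝[>] 0, (h : ℝ) < min (min r 1) (δ / 2 / (C + 1)) := by
      refine Filter.Eventually.filter_mono nhdsWithin_le_nhds ?_
      refine (NNReal.continuous_coe.tendsto 0).eventually (eventually_lt_nhds ?_)
      simp only [NNReal.coe_zero]
      positivity
    filter_upwards [h1, self_mem_nhdsWithin] with h hh hpos z hz
    have hpos' : (0 : ℝ) < h := by exact_mod_cast hpos
    have hne : ((h : ℝ) : ℂ) ≠ 0 := by exact_mod_cast hpos'.ne'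
    have hr1 : (h : ℝ) < r := hh.trans_le ((min_le_left _ _).trans (min_le_left _ _))
    have hr2 : (h : ℝ) ≤ 1 := (hh.trans_le ((min_le_left _ _).trans (min_le_right _ _))).le
    have hr3 : (h : ℝ) * (C + 1) < δ / 2 := by
      have := hh.trans_le (min_le_right _ _)
      rwa [lt_div_iff₀ (by positivity)] at this
    have hmv := Convex.norm_image_sub_le_of_norm_hasDerivWithin_le (s := Set.Icc (0 : ℝ) h)
      (f := fun s : ℝ => orbit c η (f z) z s - s * (I * z * f z + c * η 0))
      (f' := fun s => (I * z * orbit c η (f z) z s + c * η s) - 1 * (I * z * f z + c * η 0))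
      (C := δ * Real.exp ((β + 1 + 1 : ℕ) * ‖z‖)) (fun s _ =>
        ((hasDerivAt_orbit hη c (f z) z s).sub
          ((hasDerivAt_id (s : ℂ)).comp_ofReal.mul_const _)).hasDerivWithinAt) (fun s hs => ?_)
      (convex_Icc _ _) (Set.left_mem_Icc.mpr hpos'.le) (Set.right_mem_Icc.mpr hpos'.le)
    · rw [orbit_zero, Real.norm_of_nonneg (by linarith), sub_zero] at hmv
      have e : ((h : ℝ) : ℂ)⁻¹ * (orbit c η (f z) z h - f z) - (I * z * f z + c * η 0) =
          ((h : ℝ) : ℂ)⁻¹ * (orbit c η (f z) z h - (h : ℝ) * (I * z * f z + c * η 0) -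
            (f z - ((0 : ℝ) : ℂ) * (I * z * f z + c * η 0))) := by
        field_simp
        push_cast
        ring
      rw [e, norm_mul, norm_inv, Complex.norm_real, Real.norm_of_nonneg hpos'.le,
        inv_mul_le_iff₀ hpos']
      exact hmv.trans (le_of_eq (mul_comm _ _))
    · have hlip := norm_orbit_sub_le (c := c) (w := f z) hη (neg_one_le_im hz) le_rfl hs.1
        (hs.2.trans hr2) hB (hA z hz)
      rw [orbit_zero, sub_zero, ← hC] at hlip
      have hs0 := hr' (x := s) (by
        rw [dist_zero_right, Real.norm_of_nonneg hs.1]; exact hs.2.trans_lt hr1)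
      rw [dist_eq_norm, lt_div_iff₀ (by positivity)] at hs0
      have e : (I * z * orbit c η (f z) z s + c * η s) - 1 * (I * z * f z + c * η 0) =
          I * z * (orbit c η (f z) z s - f z) + c * (η s - η 0) := by ring
      rw [e]
      have b1 : ‖I * z * (orbit c η (f z) z s - f z)‖ ≤
          δ / 2 * Real.exp ((β + 1 + 1 : ℕ) * ‖z‖) := by
        rw [norm_mul, norm_mul, norm_I, one_mul, ← exp_norm_mul_exp (β + 1), mul_left_comm]
        refine mul_le_mul (norm_le_exp_norm z) (hlip.trans ?_) (norm_nonneg _) (Real.exp_pos _).le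
        gcongr
        have : C * s ≤ C * h := by gcongr; exact hs.2
        nlinarith
      have b2 : ‖c * (η s - η 0)‖ ≤ δ / 2 * Real.exp ((β + 1 + 1 : ℕ) * ‖z‖) := by
        refine le_trans ?_ (le_mul_of_one_le_right (by positivity)
          (Real.one_le_exp (by positivity)))
        rw [norm_mul]
        nlinarith [norm_nonneg (η s - η 0)]
      refine (norm_add_le _ _).trans ?_
      linarith

end Kuramoto

namespace Kuramoto

variable {p K : ℝ} {g : ℝ → ℝ}

theorem orbit_congr {c w z : ℂ} {η η' : ℝ → ℂ} {t : ℝ} (ht : 0 ≤ t)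
    (h : ∀ s, 0 ≤ s → s ≤ t → η s = η' s) : orbit c η w z t = orbit c η' w z t := by
  rw [orbit, orbit]
  congr 3
  refine intervalIntegral.integral_congr fun s hs => ?_
  rw [Set.uIcc_of_le ht] at hs
  rw [h s hs.1 hs.2]

theorem orbit_add_data {c : ℂ} {η η' : ℝ → ℂ} (hη : Continuous η) (hη' : Continuous η')
    (w w' z : ℂ) (t : ℝ) :
    orbit c (fun s => η s + η' s) (w + w') z t = orbit c η w z t + orbit c η' w' z t := by
  rw [orbit, orbit, orbit]
  simp_rw [mul_add]
  rw [intervalIntegral.integral_add (Continuous.intervalIntegrable (by fun_prop) _ _)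
    (Continuous.intervalIntegrable (by fun_prop) _ _)]
  ring

theorem orbit_smul_data (c : ℂ) (η : ℝ → ℂ) (a w z : ℂ) (t : ℝ) :
    orbit c (fun s => a * η s) (a * w) z t = a * orbit c η w z t := by
  rw [orbit, orbit]
  simp_rw [mul_left_comm _ a]
  rw [intervalIntegral.integral_const_mul]
  ring

theorem orbit_sub_data {c : ℂ} {η η' : ℝ → ℂ} (hη : Continuous η) (hη' : Continuous η')
    (w w' z : ℂ) (t : ℝ) :
    orbit c (fun s => η s - η' s) (w - w') z t = orbit c η w z t - orbit c η' w' z t := by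
  have h1 := orbit_add_data (c := c) (η' := fun s => (-1) * η' s) hη (continuous_const.mul hη')
    w ((-1) * w') z t
  rw [orbit_smul_data] at h1
  simp only [neg_one_mul, ← sub_eq_add_neg] at h1
  exact h1

/-- The product of a test function with the density, on the real line. -/
noncomputable def weighted (g : ℝ → ℝ) (φ : Fp p) (ω : ℝ) : ℂ := φ ω * g ω

theorem rapidDecay_weighted (hg : RapidDecay fun ω : ℝ => (g ω : ℂ)) (hp : 0 ≤ p) (φ : Fp p) :
    RapidDecay (weighted g φ) := by
  change RapidDecay fun ω : ℝ => φ ω * g ω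
  simpa using φ.rapidDecay_mul hg le_rfl hp

theorem integral_norm_weighted_le (hg : RapidDecay fun ω : ℝ => (g ω : ℂ)) {φ : Fp p} {β : ℕ}
    {M : ℝ} (h : ∀ z, ‖φ z‖ ≤ M * Real.exp (β * ‖z‖)) :
    ∫ ω, ‖weighted g φ ω‖ ≤ M * ∫ ω, Real.exp (β * |ω|) * ‖(g ω : ℂ)‖ := by
  rw [← integral_const_mul]
  refine integral_mono_of_nonneg (Eventually.of_forall fun ω => norm_nonneg _)
    ((hg.integrable_exp_mul β).const_mul M) (Eventually.of_forall fun ω => ?_)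
  simp only [weighted]
  rw [norm_mul, ← mul_assoc]
  gcongr
  simpa using h ω

/-- `η` is the mean of the solution with initial value `φ` of `v' = T₁ v` against the density. -/
structure IsFeedback (K : ℝ) (g : ℝ → ℝ) (φ : Fp p) (η : ℝ → ℂ) : Prop where
  continuous : Continuous η
  eq : ∀ t, 0 ≤ t → η t = ∫ ω : ℝ, orbit (K / 2) η (φ ω) ω t * g ω

/-- The kernel of the Volterra equation for the mean. -/
noncomputable def feedbackKernel (K : ℝ) (g : ℝ → ℝ) (t : ℝ) : ℂ :=
  (K / 2 : ℂ) * charTransform (fun ω => (g ω : ℂ)) t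

theorem continuous_feedbackKernel (hg : RapidDecay fun ω : ℝ => (g ω : ℂ)) (K : ℝ) :
    Continuous (feedbackKernel K g) :=
  continuous_const.mul (continuous_charTransform hg.integrable)

/-- A bound for the kernel of the Volterra equation. -/
noncomputable def feedbackBound (K : ℝ) (g : ℝ → ℝ) : ℝ := ‖(K / 2 : ℂ)‖ * ∫ ω, ‖(g ω : ℂ)‖

theorem norm_feedbackKernel_le (K : ℝ) (g : ℝ → ℝ) (t : ℝ) :
    ‖feedbackKernel K g t‖ ≤ feedbackBound K g := by
  rw [feedbackKernel, feedbackBound, norm_mul]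
  gcongr
  exact norm_charTransform_le _ t

theorem integral_orbit_mul (hg : RapidDecay fun ω : ℝ => (g ω : ℂ)) (hp : 0 ≤ p) (φ ψ : Fp p)
    {η : ℝ → ℂ} (hη : Continuous η) {t : ℝ} (ht : 0 ≤ t) :
    ∫ ω : ℝ, orbit (K / 2) η (φ ω) ω t * weighted g ψ ω =
      charTransform (fun ω : ℝ => φ ω * weighted g ψ ω) t +
        (K / 2 : ℂ) * ∫ s in (0 : ℝ)..t, charTransform (weighted g ψ) (t - s) * η s := by
  have hv := rapidDecay_weighted hg hp ψ
  have hu : RapidDecay fun ω : ℝ => φ ω * weighted g ψ ω := by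
    simpa using φ.rapidDecay_mul hv le_rfl hp
  rw [← integral_orbit hu.integrable hv.integrable hη _ ht]
  refine integral_congr_ae (Eventually.of_forall fun ω => ?_)
  simp only
  rw [orbit_eq]
  ring

theorem integral_orbit_density (hg : RapidDecay fun ω : ℝ => (g ω : ℂ)) (hp : 0 ≤ p) (φ : Fp p)
    {η : ℝ → ℂ} (hη : Continuous η) {t : ℝ} (ht : 0 ≤ t) :
    ∫ ω : ℝ, orbit (K / 2) η (φ ω) ω t * g ω =
      charTransform (weighted g φ) t + ∫ s in (0 : ℝ)..t, feedbackKernel K g (t - s) * η s := by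
  have hu := rapidDecay_weighted hg hp φ
  simp_rw [feedbackKernel, mul_assoc]
  rw [intervalIntegral.integral_const_mul, ← integral_orbit hu.integrable hg.integrable hη _ ht]
  refine integral_congr_ae (Eventually.of_forall fun ω => ?_)
  simp only [weighted]
  rw [orbit_eq]
  ring

theorem isFeedback_iff (hg : RapidDecay fun ω : ℝ => (g ω : ℂ)) (hp : 0 ≤ p) (φ : Fp p)
    {η : ℝ → ℂ} (hη : Continuous η) : IsFeedback K g φ η ↔ ∀ t, 0 ≤ t →
      η t = charTransform (weighted g φ) t + ∫ s in (0 : ℝ)..t, feedbackKernel K g (t - s) * η s :=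
  ⟨fun h t ht => (h.eq t ht).trans (integral_orbit_density hg hp φ hη ht),
    fun h => ⟨hη, fun t ht => (h t ht).trans (integral_orbit_density hg hp φ hη ht).symm⟩⟩

theorem IsFeedback.volterra (hg : RapidDecay fun ω : ℝ => (g ω : ℂ)) (hp : 0 ≤ p) {φ : Fp p}
    {η : ℝ → ℂ} (h : IsFeedback K g φ η) {t : ℝ} (ht : 0 ≤ t) :
    η t = charTransform (weighted g φ) t + ∫ s in (0 : ℝ)..t, feedbackKernel K g (t - s) * η s :=
  (isFeedback_iff hg hp φ h.continuous).mp h t ht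

theorem IsFeedback.unique (hg : RapidDecay fun ω : ℝ => (g ω : ℂ)) (hp : 0 ≤ p) {φ : Fp p}
    {η η' : ℝ → ℂ} (h : IsFeedback K g φ η) (h' : IsFeedback K g φ η') {t : ℝ} (ht : 0 ≤ t) :
    η t = η' t :=
  volterra_unique (continuous_feedbackKernel hg K) (norm_feedbackKernel_le K g) h.continuous
    h'.continuous (fun _ hs => h.volterra hg hp hs) (fun _ hs => h'.volterra hg hp hs) t ht

theorem exists_isFeedback (hg : RapidDecay fun ω : ℝ => (g ω : ℂ)) (hp : 0 ≤ p) (K : ℝ)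
    (φ : Fp p) : ∃ η, IsFeedback K g φ η ∧ ∀ t, 0 ≤ t →
      ‖η t‖ ≤ 2 * (∫ ω, ‖weighted g φ ω‖) * Real.exp ((2 * feedbackBound K g + 1) * t) := by
  obtain ⟨η, hc, he, hb⟩ := exists_volterra (continuous_feedbackKernel hg K)
    (norm_feedbackKernel_le K g) (continuous_charTransform (rapidDecay_weighted hg hp φ).integrable)
    (norm_charTransform_le _)
  exact ⟨η, (isFeedback_iff hg hp φ hc).mpr he, hb⟩

theorem IsFeedback.norm_le (hg : RapidDecay fun ω : ℝ => (g ω : ℂ)) (hp : 0 ≤ p) {φ : Fp p}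
    {η : ℝ → ℂ} (h : IsFeedback K g φ η) {t : ℝ} (ht : 0 ≤ t) :
    ‖η t‖ ≤ 2 * (∫ ω, ‖weighted g φ ω‖) * Real.exp ((2 * feedbackBound K g + 1) * t) := by
  obtain ⟨η', h', hb⟩ := exists_isFeedback hg hp K φ
  rw [h.unique hg hp h' ht]
  exact hb t ht

theorem IsFeedback.add (hg : RapidDecay fun ω : ℝ => (g ω : ℂ)) (hp : 0 ≤ p) {φ φ' : Fp p}
    {η η' : ℝ → ℂ} (h : IsFeedback K g φ η) (h' : IsFeedback K g φ' η') :
    IsFeedback K g (φ + φ') fun s => η s + η' s := by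
  refine (isFeedback_iff hg hp _ (η := fun s => η s + η' s) (h.continuous.add h'.continuous)).mpr fun t ht => ?_
  have hκ := continuous_feedbackKernel hg K
  have hc := h.continuous
  have hc' := h'.continuous
  simp_rw [mul_add]
  rw [intervalIntegral.integral_add (Continuous.intervalIntegrable (by fun_prop) _ _)
    (Continuous.intervalIntegrable (by fun_prop) _ _), h.volterra hg hp ht, h'.volterra hg hp ht]
  have e : charTransform (weighted g (φ + φ')) t =
      charTransform (weighted g φ) t + charTransform (weighted g φ') t := by
    rw [charTransform, charTransform, charTransform, ← integral_add
      (integrable_exp_I_mul (rapidDecay_weighted hg hp φ).integrable t)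
      (integrable_exp_I_mul (rapidDecay_weighted hg hp φ').integrable t)]
    refine integral_congr_ae (Eventually.of_forall fun ω => ?_)
    simp only [weighted, Fp.add_apply]
    ring
  rw [e]
  ring

theorem IsFeedback.smul (hg : RapidDecay fun ω : ℝ => (g ω : ℂ)) (hp : 0 ≤ p) {φ : Fp p}
    {η : ℝ → ℂ} (h : IsFeedback K g φ η) (a : ℂ) : IsFeedback K g (a • φ) fun s => a * η s := by
  refine (isFeedback_iff hg hp _ (η := fun s => a * η s)
    (continuous_const.mul h.continuous)).mpr fun t ht => ?_
  simp_rw [mul_left_comm _ a]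
  rw [intervalIntegral.integral_const_mul, h.volterra hg hp ht, mul_add]
  congr 1
  rw [charTransform, charTransform, ← integral_const_mul]
  refine integral_congr_ae (Eventually.of_forall fun ω => ?_)
  simp only [weighted, Fp.smul_apply]
  ring

theorem IsFeedback.sub (hg : RapidDecay fun ω : ℝ => (g ω : ℂ)) (hp : 0 ≤ p) {φ φ' : Fp p}
    {η η' : ℝ → ℂ} (h : IsFeedback K g φ η) (h' : IsFeedback K g φ' η') :
    IsFeedback K g (φ - φ') fun s => η s - η' s := by
  have := h.add hg hp (h'.smul hg hp (-1))
  simpa only [neg_smul, one_smul, neg_one_mul, ← sub_eq_add_neg] using this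

theorem real_mem_strip (hp : 0 ≤ p) (ω : ℝ) : (ω : ℂ) ∈ strip p 0 :=
  mem_strip_zero.mpr (by simp [hp])

/-- The operators of the semigroup are given by orbits. -/
def IsOrbitMap (K : ℝ) (g : ℝ → ℝ) (p t : ℝ) (S : Fp p → Fp p) : Prop :=
  ∀ φ η, IsFeedback K g φ η → ∀ z ∈ strip p 0, S φ z = orbit (K / 2) η (φ z) z t

theorem exists_isOrbitMap (hg : RapidDecay fun ω : ℝ => (g ω : ℂ)) (hp : 0 ≤ p) (K : ℝ) {t : ℝ}
    (ht : 0 ≤ t) : ∃ S : Fp p →L[ℂ] Fp p, IsOrbitMap K g p t S := by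
  choose η hη hηb using fun φ : Fp p => exists_isFeedback hg hp K φ
  have hex : ∀ φ : Fp p, ∃ ζ : Fp p, ∀ z ∈ strip p 0, ζ z = orbit (K / 2) (η φ) (φ z) z t := by
    intro φ
    obtain ⟨β, n, f, hf⟩ := φ.exists_ofStep
    obtain ⟨F, hF⟩ := (f.isStepFunction.orbit (hη φ).continuous (K / 2) ht).exists_step
    refine ⟨Fp.ofStep p β n F, fun z hz => ?_⟩
    rw [Fp.ofStep_apply _ hz, hF z (strip_zero_subset p n hz)]
    conv_rhs => rw [← hf, Fp.ofStep_apply _ hz]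
    rw [hf]
  choose S hS using hex
  have hSη : ∀ φ η', IsFeedback K g φ η' → ∀ z ∈ strip p 0,
      S φ z = orbit (K / 2) η' (φ z) z t := by
    intro φ η' h z hz
    rw [hS φ z hz]
    exact orbit_congr ht fun s hs _ => (hη φ).unique hg hp h hs
  let L : Fp p →ₗ[ℂ] Fp p :=
    { toFun := S
      map_add' := fun φ ψ => Fp.ext fun z hz => by
        rw [hSη _ _ ((hη φ).add hg hp (hη ψ)) z hz, Fp.add_apply, Fp.add_apply, hS φ z hz,
          hS ψ z hz, orbit_add_data (hη φ).continuous (hη ψ).continuous]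
      map_smul' := fun a φ => Fp.ext fun z hz => by
        rw [hSη _ _ ((hη φ).smul hg hp a) z hz, RingHom.id_apply, Fp.smul_apply, Fp.smul_apply,
          hS φ z hz, orbit_smul_data] }
  have hcont : Continuous L := by
    refine Fp.continuous_iff.mpr fun β n => continuous_iff_continuousAt.mpr fun f₀ => ?_
    set E := ∫ ω, Real.exp (β * |ω|) * ‖(g ω : ℂ)‖
    have hE : 0 ≤ E := integral_nonneg fun ω => by positivity
    set b := 2 * feedbackBound K g + 1
    have hb : 0 ≤ b := by
      have := (norm_nonneg _).trans (norm_feedbackKernel_le K g 0)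
      positivity
    set A := Real.exp t * (1 + ‖(K / 2 : ℂ)‖ * (2 * E * Real.exp (b * t) * t))
    have hA : 0 ≤ A := by positivity
    refine Fp.tendsto_of_bound (β := β) (n := n)
      (F := fun f z => orbit (K / 2) (η (Fp.ofStep p β n f)) (f z) z t)
      (fun f => f.isStepFunction.orbit (hη _).continuous _ ht)
      (f₀.isStepFunction.orbit (hη _).continuous _ ht)
      (fun f z hz => by rw [← Fp.ofStep_apply f hz]; exact hS _ z hz)
      (fun z hz => by rw [← Fp.ofStep_apply f₀ hz]; exact hS _ z hz) fun δ hδ => ?_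
    filter_upwards [Metric.ball_mem_nhds f₀ (show 0 < δ / (A + 1) by positivity)] with f hf z hz
    rw [Metric.mem_ball, dist_eq_norm, lt_div_iff₀ (by positivity)] at hf
    rw [← orbit_sub_data (hη _).continuous (hη _).continuous]
    set x := ‖f - f₀‖
    have hx : 0 ≤ x := norm_nonneg _
    have hd := (hη (Fp.ofStep p β n f)).sub hg hp (hη (Fp.ofStep p β n f₀))
    have hsub : ∀ z, ‖(Fp.ofStep p β n f - Fp.ofStep p β n f₀) z‖ ≤ x * Real.exp (β * ‖z‖) := by
      intro z
      have e : Fp.ofStep p β n f - Fp.ofStep p β n f₀ = Fp.ofStep p β n (f - f₀) :=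
        Fp.ext fun z hz => by
          rw [Fp.sub_apply, Fp.ofStep_apply _ hz, Fp.ofStep_apply _ hz, Fp.ofStep_apply _ hz,
            FpStep.sub_apply]
      rw [e]
      exact Fp.norm_ofStep_apply_le _ z
    have hw := integral_norm_weighted_le hg hsub
    have hb1 : ∀ s, 0 ≤ s → s ≤ t → ‖η (Fp.ofStep p β n f) s - η (Fp.ofStep p β n f₀) s‖ ≤
        2 * (x * E) * Real.exp (b * t) := by
      intro s h0 h1
      refine (hd.norm_le hg hp h0).trans ?_
      gcongr
    have h1 := norm_orbit_le (K / 2 : ℂ) (f z - f₀ z) (neg_one_le_im hz) ht hb1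
    have h2 : ‖f z - f₀ z‖ ≤ x * Real.exp (β * ‖z‖) := by
      rw [← FpStep.sub_apply]; exact FpStep.norm_apply_le _ z
    have h3 : ‖(K / 2 : ℂ)‖ * (2 * (x * E) * Real.exp (b * t) * t) ≤
        ‖(K / 2 : ℂ)‖ * (2 * (x * E) * Real.exp (b * t) * t) * Real.exp (β * ‖z‖) :=
      le_mul_of_one_le_right (by positivity) (Real.one_le_exp (by positivity))
    have h4 : A * x * Real.exp (β * ‖z‖) ≤ δ * Real.exp (β * ‖z‖) := by
      gcongr
      nlinarith
    refine h1.trans ((mul_le_mul_of_nonneg_left (add_le_add h2 h3) (Real.exp_pos _).le).trans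
      (le_of_eq_of_le ?_ h4))
    ring
  exact ⟨⟨L, hcont⟩, hSη⟩

/-- The mean of the solution that starts at time `t`. -/
theorem IsFeedback.shift (hp : 0 ≤ p) {φ : Fp p} {η : ℝ → ℂ} (h : IsFeedback K g φ η) {t : ℝ}
    (ht : 0 ≤ t) {ζ : Fp p} (hζ : ∀ z ∈ strip p 0, ζ z = orbit (K / 2) η (φ z) z t) :
    IsFeedback K g ζ fun s => η (t + s) := by
  refine ⟨by have := h.continuous; fun_prop, fun τ hτ => ?_⟩
  rw [h.eq _ (by positivity)]
  refine integral_congr_ae (Eventually.of_forall fun ω => ?_)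
  simp only
  rw [hζ _ (real_mem_strip hp ω), ← orbit_add h.continuous]

theorem T1_apply (φ : Fp p) {z : ℂ} (hz : z ∈ strip p 0) :
    T1 K g p φ z = I * z * φ z + (K / 2 : ℂ) * ∫ ω : ℝ, φ ω * g ω :=
  Set.indicator_of_mem hz fun z => I * z * φ z + (K / 2 : ℂ) * ∫ ω : ℝ, φ ω * g ω

theorem isSemigroupGeneratedBy_of_isOrbitMap (hg : RapidDecay fun ω : ℝ => (g ω : ℂ)) (hp : 0 ≤ p)
    {S : ℝ≥0 → Fp p →L[ℂ] Fp p} (hS : ∀ t : ℝ≥0, IsOrbitMap K g p t (S t)) :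
    IsSemigroupGeneratedBy (T1 K g p) S := by
  refine ⟨fun φ => ?_, fun s t φ => ?_, fun φ => ?_, fun φ => ?_⟩ <;>
    obtain ⟨η, hη, -⟩ := exists_isFeedback hg hp K φ
  · refine Fp.ext fun z hz => ?_
    rw [hS 0 φ η hη z hz, NNReal.coe_zero, orbit_zero]
  · refine Fp.ext fun z hz => ?_
    rw [hS _ φ η hη z hz, hS s _ _ (hη.shift hp t.2 (hS t φ η hη)) z hz, hS t φ η hη z hz,
      NNReal.coe_add, add_comm (s : ℝ)]
    exact orbit_add hη.continuous _ _ _ _ _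
  · obtain ⟨β, n, f, hf⟩ := φ.exists_ofStep
    refine Fp.tendsto_orbit f.isStepFunction hη.continuous (K / 2) fun t z hz => ?_
    rw [hS t φ η hη z hz, ← Fp.ofStep_apply f hz, hf]
  · obtain ⟨β, n, f, hf⟩ := φ.exists_ofStep
    have hfz : ∀ z ∈ strip p 0, φ z = f z := fun z hz => by rw [← Fp.ofStep_apply f hz, hf]
    refine Fp.tendsto_orbit_deriv f.isStepFunction hη.continuous (K / 2) (fun t z hz => ?_) hfz
      fun z hz => ?_
    · rw [hS t φ η hη z hz, hfz z hz]
    · have h0 := hη.eq 0 le_rfl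
      simp_rw [orbit_zero] at h0
      rw [h0, ← hfz z hz, T1_apply φ hz]

theorem IsSemigroupGeneratedBy.hasDerivWithinAt_apply {A : Fp p → Fp p}
    {S : ℝ≥0 → Fp p →L[ℂ] Fp p} (hS : IsSemigroupGeneratedBy A S) (φ : Fp p) (z : ℂ) {t : ℝ}
    (ht : 0 ≤ t) :
    HasDerivWithinAt (fun t : ℝ => S t.toNNReal φ z) (A (S t.toNNReal φ) z) (Set.Ici t) t := by
  obtain ⟨μ, hμ⟩ := exists_dual_eval p z
  rw [← hasDerivWithinAt_Ioi_iff_Ici, hasDerivWithinAt_iff_tendsto_slope' (by simp)]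
  have h1 := ((continuous_pair μ).tendsto _).comp (hS.generator (S t.toNNReal φ))
  have h2 : Tendsto (fun u : ℝ => (u - t).toNNReal) (𝓝[>] t) (𝓝[>] 0) := by
    refine tendsto_nhdsWithin_iff.mpr ⟨?_, ?_⟩
    · have : Tendsto (fun u : ℝ => (u - t).toNNReal) (𝓝 t) (𝓝 (t - t).toNNReal) :=
        Continuous.tendsto (by fun_prop) t
      rw [sub_self, Real.toNNReal_zero] at this
      exact this.mono_left nhdsWithin_le_nhds
    · filter_upwards [self_mem_nhdsWithin] with u hu
      exact Real.toNNReal_pos.mpr (sub_pos.mpr hu)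
  have h3 := h1.comp h2
  rw [hμ] at h3
  refine h3.congr' ?_
  filter_upwards [self_mem_nhdsWithin] with u hu
  have hu' : 0 ≤ u - t := (sub_pos.mpr hu).le
  have e : u.toNNReal = (u - t).toNNReal + t.toNNReal := by
    rw [← Real.toNNReal_add hu' ht, sub_add_cancel]
  simp only [Function.comp_apply]
  rw [hμ, Fp.smul_apply, Fp.sub_apply, ← hS.map_add, ← e, slope_def_module,
    Real.coe_toNNReal _ hu', ← ofReal_inv, Complex.real_smul]

theorem IsSemigroupGeneratedBy.isOrbitMap (hg : RapidDecay fun ω : ℝ => (g ω : ℂ)) (hp : 0 ≤ p)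
    {S : ℝ≥0 → Fp p →L[ℂ] Fp p} (hS : IsSemigroupGeneratedBy (T1 K g p) S) (t : ℝ≥0) :
    IsOrbitMap K g p t (S t) := by
  intro φ η' hη' z hz
  have hcS : Continuous fun t : ℝ => S t.toNNReal φ :=
    (hS.continuous φ).comp continuous_real_toNNReal
  set η : ℝ → ℂ := fun t => ∫ ω : ℝ, S t.toNNReal φ ω * g ω with hηdef
  have hηc : Continuous η := by
    obtain ⟨μ, hμ⟩ := exists_dual_integral hg le_rfl hp
    have e : η = fun t : ℝ => pair (S t.toNNReal φ) μ := by
      funext t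
      rw [hμ]
      simp [hηdef]
    rw [e]
    exact (continuous_pair μ).comp hcS
  have key : ∀ z ∈ strip p 0, ∀ t : ℝ, 0 ≤ t →
      S t.toNNReal φ z = orbit (K / 2) η (φ z) z t := by
    intro z hz t ht
    obtain ⟨μ, hμ⟩ := exists_dual_eval p z
    have hvc : Continuous fun t : ℝ => S t.toNNReal φ z := by
      have := (continuous_pair μ).comp hcS
      simpa only [Function.comp_def, hμ] using this
    have hoc : Continuous fun t : ℝ => orbit (K / 2) η (φ z) z t :=
      continuous_iff_continuousAt.mpr fun s => (hasDerivAt_orbit hηc _ _ _ s).continuousAt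
    have hexp : ∀ s : ℝ, HasDerivAt (fun s : ℝ => Complex.exp (-(I * z * s)))
        (Complex.exp (-(I * z * s)) * -(I * z * 1)) s := fun s =>
      ((((hasDerivAt_id (s : ℂ)).const_mul (I * z)).neg).cexp).comp_ofReal
    have hconst := constant_of_has_deriv_right_zero (a := 0) (b := t)
      (f := fun s : ℝ => Complex.exp (-(I * z * s)) *
        (S s.toNNReal φ z - orbit (K / 2) η (φ z) z s))
      (Continuous.mul (by fun_prop) (hvc.sub hoc)).continuousOn (fun s hs => ?_) t ⟨ht, le_rfl⟩
    · simp only [Real.toNNReal_zero, orbit_zero, hS.map_zero, sub_self, mul_zero] at hconst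
      exact sub_eq_zero.mp ((mul_eq_zero.mp hconst).resolve_left (Complex.exp_ne_zero _))
    · refine ((hexp s).hasDerivWithinAt.mul ((hS.hasDerivWithinAt_apply φ z hs.1).sub
        (hasDerivAt_orbit hηc (K / 2) (φ z) z s).hasDerivWithinAt)).congr_deriv ?_
      have e : T1 K g p (S s.toNNReal φ) z = I * z * S s.toNNReal φ z + (K / 2 : ℂ) * η s :=
        T1_apply _ hz
      rw [e, Pi.sub_apply]
      ring
  have hη : IsFeedback K g φ η := by
    refine ⟨hηc, fun s hs => ?_⟩
    simp only [hηdef]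
    refine integral_congr_ae (Eventually.of_forall fun ω => ?_)
    simp only
    rw [key _ (real_mem_strip hp ω) s hs]
  have := key z hz t t.2
  rw [Real.toNNReal_coe] at this
  rw [this]
  exact orbit_congr t.2 fun s hs _ => hη.unique hg hp hη' hs

theorem existsUnique_semigroup (hg : RapidDecay fun ω : ℝ => (g ω : ℂ)) (hp : 0 ≤ p) (K : ℝ) :
    ∃! S : ℝ≥0 → Fp p →L[ℂ] Fp p, IsSemigroupGeneratedBy (T1 K g p) S := by
  choose S hS using fun t : ℝ≥0 => exists_isOrbitMap hg hp K t.2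
  refine ⟨S, isSemigroupGeneratedBy_of_isOrbitMap hg hp hS, fun S' hS' => ?_⟩
  funext t
  refine ContinuousLinearMap.ext fun φ => Fp.ext fun z hz => ?_
  obtain ⟨η, hη, -⟩ := exists_isFeedback hg hp K φ
  exact (hS'.isOrbitMap hg hp t φ η hη z hz).trans (hS t φ η hη z hz).symm

end Kuramoto

namespace Kuramoto

/-! ### Laplace transforms -/

theorem exp_mul_convolution (lam : ℂ) (k η : ℝ → ℂ) (t : ℝ) :
    ∫ s in (0 : ℝ)..t, Complex.exp (-(lam * s)) * η s *
      (Complex.exp (-(lam * (t - s : ℝ))) * k (t - s)) =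
      Complex.exp (-(lam * t)) * ∫ s in (0 : ℝ)..t, k (t - s) * η s := by
  rw [← intervalIntegral.integral_const_mul]
  refine intervalIntegral.integral_congr fun s _ => ?_
  have : Complex.exp (-(lam * t)) =
      Complex.exp (-(lam * s)) * Complex.exp (-(lam * (t - s : ℝ))) := by
    rw [← Complex.exp_add]; congr 1; push_cast; ring
  rw [this]
  ring

theorem integrableOn_exp_mul_convolution {k η : ℝ → ℂ} {lam : ℂ}
    (hη : IntegrableOn (fun s : ℝ => Complex.exp (-(lam * s)) * η s) (Set.Ioi 0))
    (hk : IntegrableOn (fun s : ℝ => Complex.exp (-(lam * s)) * k s) (Set.Ioi 0)) :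
    IntegrableOn (fun t : ℝ => Complex.exp (-(lam * t)) * ∫ s in (0 : ℝ)..t, k (t - s) * η s)
      (Set.Ioi 0) := by
  have := (integrable_posConvolution hη hk (ContinuousLinearMap.mul ℝ ℂ)).integrableOn (s := Set.Ioi 0)
  refine this.congr_fun (fun t ht => ?_) measurableSet_Ioi
  rw [posConvolution, Set.indicator_of_mem ht]
  exact exp_mul_convolution lam k η t

theorem integral_exp_mul_convolution {k η : ℝ → ℂ} {lam : ℂ}
    (hη : IntegrableOn (fun s : ℝ => Complex.exp (-(lam * s)) * η s) (Set.Ioi 0))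
    (hk : IntegrableOn (fun s : ℝ => Complex.exp (-(lam * s)) * k s) (Set.Ioi 0)) :
    ∫ t in Set.Ioi (0 : ℝ), Complex.exp (-(lam * t)) * ∫ s in (0 : ℝ)..t, k (t - s) * η s =
      (∫ s in Set.Ioi (0 : ℝ), Complex.exp (-(lam * s)) * η s) *
        ∫ s in Set.Ioi (0 : ℝ), Complex.exp (-(lam * s)) * k s := by
  have := integral_posConvolution hη hk (ContinuousLinearMap.mul ℝ ℂ)
  simp only [ContinuousLinearMap.mul_apply'] at this
  rw [← this]
  simp_rw [exp_mul_convolution]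

theorem norm_cauchyTransform_le (u : ℝ → ℂ) {lam : ℂ} (hu : Integrable u) (h : 0 < lam.re) :
    ‖cauchyTransform u lam‖ ≤ (∫ ω, ‖u ω‖) / lam.re := by
  rw [cauchyTransform, ← integral_div]
  refine norm_integral_le_of_norm_le (hu.norm.div_const _) (Eventually.of_forall fun ω => ?_)
  rw [norm_div]
  gcongr
  have := abs_re_le_norm_sub lam ω
  rwa [abs_of_pos h] at this

variable {p K : ℝ} {g : ℝ → ℝ}

theorem IsFeedback.integrableOn_exp (hg : RapidDecay fun ω : ℝ => (g ω : ℂ)) (hp : 0 ≤ p)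
    {φ : Fp p} {η : ℝ → ℂ} (h : IsFeedback K g φ η) {lam : ℂ}
    (hlam : 2 * feedbackBound K g + 1 < lam.re) :
    IntegrableOn (fun s : ℝ => Complex.exp (-(lam * s)) * η s) (Set.Ioi 0) := by
  have h1 : IntegrableOn (fun s : ℝ => Real.exp (-(lam.re - (2 * feedbackBound K g + 1)) * s))
      (Set.Ioi 0) := exp_neg_integrableOn_Ioi 0 (by linarith)
  have hc := h.continuous
  refine Integrable.mono' (h1.const_mul (2 * ∫ ω, ‖weighted g φ ω‖))
    (Continuous.aestronglyMeasurable (by fun_prop)) ?_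
  refine (ae_restrict_iff' measurableSet_Ioi).mpr (Eventually.of_forall fun s hs => ?_)
  rw [norm_mul, Complex.norm_exp]
  have e : Real.exp (-(lam.re - (2 * feedbackBound K g + 1)) * s) =
      Real.exp (-(lam * s)).re * Real.exp ((2 * feedbackBound K g + 1) * s) := by
    rw [← Real.exp_add]; congr 1; simp; ring
  rw [e, mul_left_comm]
  gcongr
  exact h.norm_le hg hp (le_of_lt hs)

theorem feedbackBound_nonneg (K : ℝ) (g : ℝ → ℝ) : 0 ≤ feedbackBound K g :=
  (norm_nonneg _).trans (norm_feedbackKernel_le K g 0)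

/-- The denominator in the Laplace transform of the mean, for large `Re λ`. -/
noncomputable def dispersion (K : ℝ) (g : ℝ → ℝ) (lam : ℂ) : ℂ :=
  1 - (K / 2 : ℂ) * cauchyTransform (fun ω => (g ω : ℂ)) lam

theorem half_le_norm_dispersion (hg : RapidDecay fun ω : ℝ => (g ω : ℂ)) {lam : ℂ}
    (hlam : 2 * feedbackBound K g + 1 < lam.re) : 1 / 2 ≤ ‖dispersion K g lam‖ := by
  have hb := feedbackBound_nonneg K g
  have hpos : 0 < lam.re := by linarith
  have h1 : ‖(K / 2 : ℂ) * cauchyTransform (fun ω => (g ω : ℂ)) lam‖ ≤ 1 / 2 := by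
    rw [norm_mul]
    calc _ ≤ ‖(K / 2 : ℂ)‖ * ((∫ ω, ‖(g ω : ℂ)‖) / lam.re) := by
          gcongr
          exact norm_cauchyTransform_le _ hg.integrable hpos
      _ = feedbackBound K g / lam.re := by rw [feedbackBound]; ring
      _ ≤ 1 / 2 := by rw [div_le_div_iff₀ hpos two_pos]; linarith
  have h2 := norm_sub_norm_le (1 : ℂ) ((K / 2 : ℂ) * cauchyTransform (fun ω => (g ω : ℂ)) lam)
  rw [norm_one] at h2
  rw [dispersion]
  linarith

theorem IsFeedback.integral_exp (hg : RapidDecay fun ω : ℝ => (g ω : ℂ)) (hp : 0 ≤ p)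
    {φ : Fp p} {η : ℝ → ℂ} (h : IsFeedback K g φ η) {lam : ℂ}
    (hlam : 2 * feedbackBound K g + 1 < lam.re) :
    ∫ s in Set.Ioi (0 : ℝ), Complex.exp (-(lam * s)) * η s =
      cauchyTransform (weighted g φ) lam / dispersion K g lam := by
  have hpos : 0 < lam.re := by linarith [feedbackBound_nonneg K g]
  have hne : dispersion K g lam ≠ 0 := fun h0 => by
    have := half_le_norm_dispersion hg hlam
    rw [h0, norm_zero] at this
    norm_num at this
  have hi := h.integrableOn_exp hg hp hlam
  have hu := rapidDecay_weighted hg hp φ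
  have e1 : ∀ s : ℝ, Complex.exp (-(lam * s)) * feedbackKernel K g s =
      (K / 2 : ℂ) * (Complex.exp (-(lam * s)) * charTransform (fun ω => (g ω : ℂ)) s) := fun s => by
    rw [feedbackKernel]; ring
  have hk : IntegrableOn (fun s : ℝ => Complex.exp (-(lam * s)) * feedbackKernel K g s)
      (Set.Ioi 0) := by
    simp_rw [e1]
    exact (integrableOn_exp_mul_charTransform hg.integrable hpos).const_mul _
  have hk2 : ∫ s in Set.Ioi (0 : ℝ), Complex.exp (-(lam * s)) * feedbackKernel K g s =
      (K / 2 : ℂ) * cauchyTransform (fun ω => (g ω : ℂ)) lam := by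
    simp_rw [e1]
    rw [integral_const_mul, integral_exp_mul_charTransform hg.integrable hpos]
  have key : ∫ s in Set.Ioi (0 : ℝ), Complex.exp (-(lam * s)) * η s =
      cauchyTransform (weighted g φ) lam +
        (∫ s in Set.Ioi (0 : ℝ), Complex.exp (-(lam * s)) * η s) *
          ((K / 2 : ℂ) * cauchyTransform (fun ω => (g ω : ℂ)) lam) := by
    rw [← hk2, ← integral_exp_mul_convolution hi hk,
      ← integral_exp_mul_charTransform hu.integrable hpos, ← integral_add
      (integrableOn_exp_mul_charTransform hu.integrable hpos)
      (integrableOn_exp_mul_convolution hi hk)]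
    refine setIntegral_congr_fun measurableSet_Ioi fun s hs => ?_
    rw [h.volterra hg hp (le_of_lt hs), mul_add]
  rw [eq_div_iff hne, dispersion]
  linear_combination key

/-- The part of a matrix element of the semigroup that is due to the coupling. -/
noncomputable def coupledPart (K : ℝ) (g : ℝ → ℝ) (ψ : Fp p) (η : ℝ → ℂ) (t : ℝ) : ℂ :=
  (K / 2 : ℂ) * ∫ s in (0 : ℝ)..t, charTransform (weighted g ψ) (t - s) * η s

theorem IsFeedback.tendsto_integral_coupledPart (hg : RapidDecay fun ω : ℝ => (g ω : ℂ))
    (hp : 0 ≤ p) {φ : Fp p} {η : ℝ → ℂ} (h : IsFeedback K g φ η) (ψ : Fp p) {b : ℝ}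
    (hb : 2 * feedbackBound K g + 1 < b) {t : ℝ} (ht : 0 ≤ t) :
    Tendsto (fun r : ℝ × ℝ => ∫ y in r.1..r.2, Complex.exp (I * y * t) *
      ((K / 2 : ℂ) * (cauchyTransform (weighted g φ) (b + I * y) *
        cauchyTransform (weighted g ψ) (b + I * y) / dispersion K g (b + I * y))))
      (atBot ×ˢ atTop) (𝓝 (2 * Real.pi * (Complex.exp (-(b * t)) * coupledPart K g ψ η t))) := by
  have hb0 : 0 < b := by linarith [feedbackBound_nonneg K g]
  have hre : ∀ y : ℝ, ((b : ℂ) + I * y).re = b := fun y => by simp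
  have hu := rapidDecay_weighted hg hp φ
  have hv := rapidDecay_weighted hg hp ψ
  have hcη := h.continuous
  have hcv := continuous_charTransform hv.integrable
  set Φ : ℝ → ℂ := fun y => (K / 2 : ℂ) * (cauchyTransform (weighted g φ) (b + I * y) *
        cauchyTransform (weighted g ψ) (b + I * y) / dispersion K g (b + I * y)) with hΦ
  set q : ℝ → ℂ := fun t => coupledPart K g ψ η (max t 0) with hq
  have hqc : Continuous q := by
    refine continuous_const.mul ?_
    refine intervalIntegral.continuous_parametric_intervalIntegral_of_continuous
      (f := fun t s => charTransform (weighted g ψ) (max t 0 - s) * η s) ?_ (by fun_prop)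
    simp only [Function.uncurry_def]
    fun_prop
  have hq0 : ∀ s, s ∉ Set.Ioi (0 : ℝ) → q s = 0 := fun s hs => by
    have hs' : s ≤ 0 := by simpa using hs
    simp [hq, coupledPart, max_eq_right hs']
  set f : ℝ → ℂ := fun s => Complex.exp (-(b * s)) * q s with hf
  have hk : ∀ lam : ℂ, 0 < lam.re → IntegrableOn (fun s : ℝ => Complex.exp (-(lam * s)) *
      charTransform (weighted g ψ) s) (Set.Ioi 0) := fun lam hl =>
    integrableOn_exp_mul_charTransform hv.integrable hl
  have hfi : Integrable f := by
    rw [← integrableOn_iff_integrable_of_support_subset (s := Set.Ioi 0)]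
    · have h1 := integrableOn_exp_mul_convolution (lam := b)
        (h.integrableOn_exp hg hp (by simpa using hb)) (hk b (by simpa using hb0))
      refine IntegrableOn.congr_fun (h1.const_mul (K / 2 : ℂ)) (fun s hs => ?_) measurableSet_Ioi
      simp only [hf, hq, coupledPart, max_eq_left (le_of_lt (Set.mem_Ioi.mp hs))]
      ring
    · intro s hs
      by_contra hcon
      exact hs (by simp [hf, hq0 s hcon])
  have hFour : ∀ y : ℝ, ∫ s : ℝ, Complex.exp (-(I * y * s)) * f s = Φ y := by
    intro y
    have hl1 : 2 * feedbackBound K g + 1 < ((b : ℂ) + I * y).re := by rwa [hre]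
    have hl2 : 0 < ((b : ℂ) + I * y).re := by rwa [hre]
    rw [← setIntegral_eq_integral_of_forall_compl_eq_zero (s := Set.Ioi 0)
      (fun s hs => by simp [hf, hq0 s hs])]
    have h1 := integral_exp_mul_convolution (h.integrableOn_exp hg hp hl1) (hk _ hl2)
    rw [h.integral_exp hg hp hl1, integral_exp_mul_charTransform hv.integrable hl2] at h1
    have e : Φ y = (K / 2 : ℂ) * (cauchyTransform (weighted g φ) (b + I * y) /
        dispersion K g (b + I * y) * cauchyTransform (weighted g ψ) (b + I * y)) := by
      simp only [hΦ]; ring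
    rw [e, ← h1, ← integral_const_mul]
    refine setIntegral_congr_fun measurableSet_Ioi fun s hs => ?_
    simp only [hf, hq, coupledPart, max_eq_left (le_of_lt (Set.mem_Ioi.mp hs))]
    have e2 : Complex.exp (-((b + I * y) * s)) =
        Complex.exp (-(I * y * s)) * Complex.exp (-(b * s)) := by
      rw [← Complex.exp_add]; congr 1; ring
    rw [e2]
    ring
  have hdne : ∀ y : ℝ, dispersion K g (b + I * y) ≠ 0 := fun y h0 => by
    have := half_le_norm_dispersion hg (K := K) (lam := b + I * y) (by rwa [hre])
    rw [h0, norm_zero] at this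
    norm_num at this
  have hΦc : Continuous Φ := by
    have c1 := continuous_cauchyTransform_line hu.integrable hb0.ne'
    have c2 := continuous_cauchyTransform_line hv.integrable hb0.ne'
    have c3 := continuous_cauchyTransform_line hg.integrable hb0.ne'
    exact continuous_const.mul ((c1.mul c2).div
      (continuous_const.sub (continuous_const.mul c3)) hdne)
  have hΦi : Integrable Φ := by
    set A := ∫ ω : ℝ, ‖weighted g φ ω‖ * (1 + |ω| / b)
    set B := ∫ ω : ℝ, ‖weighted g ψ ω‖ * (1 + |ω| / b)
    refine ((integrable_inv_const_add_sq hb0.ne').const_mul (‖(K / 2 : ℂ)‖ * (2 * (A * B)))).mono'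
      hΦc.aestronglyMeasurable (Eventually.of_forall fun y => ?_)
    have hcre : b ≤ |((b : ℂ) + I * y).re| := by rw [hre]; exact le_abs_self b
    have h1 := norm_mul_norm_cauchyTransform_le (hu.integrable_one_add_abs_mul b) hb0 hcre
    have h2 := norm_mul_norm_cauchyTransform_le (hv.integrable_one_add_abs_mul b) hb0 hcre
    have h3 := half_le_norm_dispersion hg (K := K) (lam := b + I * y) (by rwa [hre])
    have h4 := norm_line_sq b y
    have h5 : 0 < ‖(b + I * y : ℂ)‖ := norm_pos_iff.mpr (line_ne_zero hb0.ne' y)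
    have h6 : ‖(b + I * y : ℂ)‖ ^ 2 * (‖cauchyTransform (weighted g φ) (b + I * y)‖ *
        ‖cauchyTransform (weighted g ψ) (b + I * y)‖) ≤ A * B := by
      have := mul_le_mul h1 h2 (by positivity) ((by positivity : (0:ℝ) ≤ _).trans h1)
      linarith
    rw [norm_mul, mul_assoc, ← h4]
    refine mul_le_mul_of_nonneg_left ?_ (norm_nonneg _)
    rw [norm_div, norm_mul, div_le_iff₀ (by linarith), mul_one_div, div_mul_eq_mul_div, le_div_iff₀ (by positivity)]
    have hAB : 0 ≤ A * B := (by positivity : (0:ℝ) ≤ _).trans h6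
    nlinarith
  have hint := integral_exp_mul_eq_of_fourier (by fun_prop) hfi hFour hΦi t
  have e : f t = Complex.exp (-(b * t)) * coupledPart K g ψ η t := by
    simp only [hf, hq, max_eq_left ht]
  rw [e] at hint
  rw [← hint]
  have hi2 : Integrable fun y : ℝ => Complex.exp (I * y * t) * Φ y :=
    integrable_exp_I_mul hΦi t
  exact intervalIntegral_tendsto_integral hi2 tendsto_fst tendsto_snd

variable {gc : ℂ → ℂ} {ε : ℝ}

/-- A matrix element of the semigroup as an inverse Laplace transform. -/
theorem StripContinuation.tendsto_integral_right (hs : StripContinuation g gc p ε) (hp : 0 ≤ p)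
    {φ ψ : Fp p} {h k : ℂ → ℂ} (hh : ExpHolomorphic p h) (hk : ExpHolomorphic p k)
    (hφ : ∀ z ∈ strip p 0, φ z = h z) (hψ : ∀ z ∈ strip p 0, ψ z = k z) {t b : ℝ} (ht : 0 < t)
    (hb : 2 * feedbackBound K g + 1 < b) {ζ : Fp p} {η : ℝ → ℂ} (hη : IsFeedback K g φ η)
    (hζ : ∀ z ∈ strip p 0, ζ z = orbit (K / 2) η (φ z) z t) :
    Tendsto (fun r : ℝ × ℝ => ∫ y in r.1..r.2, Complex.exp ((b + I * y) * t) *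
      resolventElement K g gc ε h k (b + I * y)) (atBot ×ˢ atTop)
      (𝓝 (2 * Real.pi * ∫ ω : ℝ, ζ ω * ψ ω * g ω)) := by
  have hg : RapidDecay fun ω : ℝ => (g ω : ℂ) := by
    simpa using hs.rapidDecay_real (ExpHolomorphic.one p)
  have hb0 : 0 < b := by linarith [feedbackBound_nonneg K g]
  have hre : ∀ y : ℝ, 0 < ((b : ℂ) + I * y).re := fun y => by simpa using hb0
  have hv := rapidDecay_weighted hg hp ψ
  have hu : RapidDecay fun ω : ℝ => φ ω * weighted g ψ ω := by
    simpa using φ.rapidDecay_mul hv le_rfl hp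
  have e1 : ∀ y : ℝ, Complex.exp ((b + I * y) * t) * resolventElement K g gc ε h k (b + I * y) =
      Complex.exp (b * t) * (Complex.exp (I * y * t) *
        cauchyTransform (fun ω : ℝ => φ ω * weighted g ψ ω) (b + I * y)) +
      Complex.exp (b * t) * (Complex.exp (I * y * t) *
      ((K / 2 : ℂ) * (cauchyTransform (weighted g φ) (b + I * y) *
        cauchyTransform (weighted g ψ) (b + I * y) / dispersion K g (b + I * y)))) := by
    intro y
    have a1 : (fun ω : ℝ => h ω * k ω * g ω) = fun ω : ℝ => φ ω * weighted g ψ ω := by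
      ext ω
      rw [weighted, hφ _ (real_mem_strip hp ω), hψ _ (real_mem_strip hp ω), mul_assoc]
    have a2 : (fun ω : ℝ => h ω * g ω) = weighted g φ := by
      ext ω
      rw [weighted, hφ _ (real_mem_strip hp ω)]
    have a3 : (fun ω : ℝ => k ω * g ω) = weighted g ψ := by
      ext ω
      rw [weighted, hψ _ (real_mem_strip hp ω)]
    have a4 : G K g gc (b + I * y) = dispersion K g (b + I * y) := by
      rw [hs.G_eq, continuedD]
      simp only
      rw [hs.continuedTransform_of_pos (ExpHolomorphic.one p) (hre y), dispersion]
      simp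
    rw [exp_line_eq, resolventElement, hs.continuedTransform_of_pos (hh.mul hk) (hre y),
      hs.continuedTransform_of_pos hh (hre y), hs.continuedTransform_of_pos hk (hre y), a1, a2, a3,
      a4]
    ring
  have hdne : ∀ y : ℝ, dispersion K g (b + I * y) ≠ 0 := fun y h0 => by
    have := half_le_norm_dispersion hg (K := K) (lam := b + I * y) (by simpa using hb)
    rw [h0, norm_zero] at this
    norm_num at this
  have c0 := continuous_cauchyTransform_line hu.integrable hb0.ne'
  have c1 := continuous_cauchyTransform_line (rapidDecay_weighted hg hp φ).integrable hb0.ne'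
  have c2 := continuous_cauchyTransform_line hv.integrable hb0.ne'
  have c3 := continuous_cauchyTransform_line hg.integrable hb0.ne'
  have c4 : Continuous fun y : ℝ => dispersion K g (b + I * y) :=
    continuous_const.sub (continuous_const.mul c3)
  have c5 := (c1.mul c2).div c4 hdne
  have t1 := (tendsto_integral_exp_mul_cauchyTransform hu.integrable hb0.ne' ht).const_mul
    (Complex.exp (b * t))
  have t2 := (hη.tendsto_integral_coupledPart hg hp ψ hb ht.le).const_mul (Complex.exp (b * t))
  rw [if_pos hb0] at t1
  have hlim : 2 * Real.pi * ∫ ω : ℝ, ζ ω * ψ ω * g ω =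
      Complex.exp (b * t) * (2 * Real.pi * Complex.exp (-(b * t)) *
        charTransform (fun ω : ℝ => φ ω * weighted g ψ ω) t) +
      Complex.exp (b * t) * (2 * Real.pi * (Complex.exp (-(b * t)) * coupledPart K g ψ η t)) := by
    have a1 : ∫ ω : ℝ, ζ ω * ψ ω * g ω =
        ∫ ω : ℝ, orbit (K / 2) η (φ ω) ω t * weighted g ψ ω := by
      refine integral_congr_ae (Eventually.of_forall fun ω => ?_)
      simp only
      rw [hζ _ (real_mem_strip hp ω), weighted, mul_assoc]
    have a2 : Complex.exp (b * t) * Complex.exp (-(b * t)) = 1 := by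
      rw [← Complex.exp_add]; simp
    rw [a1, integral_orbit_mul hg hp φ ψ hη.continuous ht.le, coupledPart]
    linear_combination (-(2 * Real.pi * (charTransform (fun ω : ℝ => φ ω * weighted g ψ ω) t +
      (K / 2 : ℂ) * ∫ s in (0 : ℝ)..t, charTransform (weighted g ψ) (t - s) * η s))) * a2
  rw [hlim]
  refine (t1.add t2).congr fun r => ?_
  rw [← intervalIntegral.integral_const_mul, ← intervalIntegral.integral_const_mul,
    ← intervalIntegral.integral_add]
  · exact intervalIntegral.integral_congr fun y _ => (e1 y).symm
  · exact Continuous.intervalIntegrable (by fun_prop) _ _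
  · refine Continuous.intervalIntegrable (continuous_const.mul (Continuous.mul (by fun_prop)
      (continuous_const.mul c5))) _ _

end Kuramoto

namespace Kuramoto

variable {g : ℝ → ℝ} {gc : ℂ → ℂ} {p ε K a : ℝ}

/-! ### Continued transforms as functionals -/

theorem StripContinuation.continuedTransform_congr (hs : StripContinuation g gc p ε) {h k : ℂ → ℂ}
    (heq : ∀ z ∈ strip p 0, h z = k z) {lam : ℂ} (hlam : -p ≤ lam.re) :
    continuedTransform g gc ε h lam = continuedTransform g gc ε k lam := by
  have h1 := hs.eps_pos
  have h2 := hs.eps_le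
  have e1 : ∀ ω : ℝ, h (ω + ε * I) = k (ω + ε * I) := fun ω =>
    heq _ (mem_strip_zero.mpr (by simp [h1.le, h2]))
  have e2 : ∀ ω : ℝ, h ω = k ω := fun ω => heq _ (real_mem_strip (h1.le.trans h2) ω)
  rw [continuedTransform, continuedTransform]
  split_ifs with hl
  · simp_rw [e1]
  · rw [heq (-I * lam) (mem_strip_zero.mpr (by rw [neg_I_mul_im]; constructor <;> linarith))]
    simp_rw [e2]

theorem RapidDecay.div_sub {u : ℝ → ℂ} (hu : RapidDecay u) {lam : ℂ} (h : lam.re ≠ 0) :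
    RapidDecay fun ω : ℝ => u ω / (lam - I * ω) := by
  have := hu.mul_of_exp_bound (v := fun ω : ℝ => 1 / (lam - I * ω)) (A := 1 / |lam.re|) (β := 0)
    (continuous_const.div (by fun_prop) (sub_I_mul_ne_zero h)) fun ω => by
      rw [zero_mul, Real.exp_zero, mul_one, norm_div, norm_one]
      have := abs_pos.mpr h
      gcongr
      exact abs_re_le_norm_sub lam ω
  simpa only [one_div_mul_eq_div] using this

theorem StripContinuation.exists_dual_continuedTransform (hs : StripContinuation g gc p ε)
    {k : ℂ → ℂ} (hk : ExpHolomorphic p k) (lam : ℂ) :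
    ∃ μ : FpDual p, ∀ φ : Fp p,
      pair φ μ = continuedTransform g gc ε (fun z => φ z * k z) lam := by
  have h1 := hs.eps_pos
  by_cases hl : -ε < lam.re
  · have hre : (lam + ε).re ≠ 0 := by
      simp only [add_re, ofReal_re]; linarith
    obtain ⟨μ, hμ⟩ := exists_dual_integral ((hs.rapidDecay_eps hk).div_sub hre) h1.le hs.eps_le
    refine ⟨μ, fun φ => ?_⟩
    rw [hμ, continuedTransform, if_pos hl, cauchyTransform]
    refine integral_congr_ae (Eventually.of_forall fun ω => ?_)
    simp only
    ring
  · have hre : lam.re ≠ 0 := by linarith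
    obtain ⟨μ, hμ⟩ := exists_dual_integral ((hs.rapidDecay_real hk).div_sub hre) le_rfl
      (h1.le.trans hs.eps_le)
    obtain ⟨ν, hν⟩ := exists_dual_eval p (-I * lam)
    refine ⟨μ + conj (2 * Real.pi * (k (-I * lam) * gc (-I * lam))) • ν, fun φ => ?_⟩
    rw [pair_add, pair_smul, hμ, hν, Complex.conj_conj, continuedTransform, if_neg hl,
      cauchyTransform]
    congr 1
    · refine integral_congr_ae (Eventually.of_forall fun ω => ?_)
      simp only [ofReal_zero, zero_mul, add_zero]
      ring
    · ring

/-- The pairing with `μ(λ)` is the continued transform of the test function itself. -/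
theorem StripContinuation.exists_mu (hs : StripContinuation g gc p ε) (lam : ℂ) :
    ∃ μ : FpDual p, ∀ φ : Fp p, pair φ μ = continuedTransform g gc ε φ lam := by
  simpa using hs.exists_dual_continuedTransform (ExpHolomorphic.one p) lam

theorem StripContinuation.exists_psi_mu (hs : StripContinuation g gc p ε) (ψ : Fp p) {lam : ℂ}
    (hlam : -p ≤ lam.re) : ∃ ν : FpDual p, ∀ φ : Fp p,
      pair φ ν = continuedTransform g gc ε (fun z => φ z * ψ z) lam := by
  obtain ⟨k, hk, hψ⟩ := ψ.exists_expHolomorphic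
  obtain ⟨ν, hν⟩ := hs.exists_dual_continuedTransform hk lam
  refine ⟨ν, fun φ => (hν φ).trans (hs.continuedTransform_congr (fun z hz => ?_) hlam)⟩
  rw [hψ z hz]

theorem StripContinuation.continuedTransform_apply_of_neg (hs : StripContinuation g gc p ε)
    (φ : Fp p) {lam : ℂ} (h0 : -p ≤ lam.re) (h1 : lam.re < 0) :
    continuedTransform g gc ε φ lam = cauchyTransform (weighted g φ) lam +
      2 * Real.pi * (φ (-I * lam) * gc (-I * lam)) := by
  obtain ⟨h, hh, hφ⟩ := φ.exists_expHolomorphic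
  rw [hs.continuedTransform_congr hφ h0, hs.continuedTransform_of_neg hh h1,
    hφ (-I * lam) (mem_strip_zero.mpr (by rw [neg_I_mul_im]; constructor <;> linarith))]
  congr 2
  ext ω
  rw [weighted, hφ _ (real_mem_strip (by linarith) ω)]

theorem StripContinuation.continuedTransform_mul_of_neg (hs : StripContinuation g gc p ε)
    (φ ψ : Fp p) {lam : ℂ} (h0 : -p ≤ lam.re) (h1 : lam.re < 0) :
    continuedTransform g gc ε (fun z => φ z * ψ z) lam =
      cauchyTransform (fun ω : ℝ => φ ω * weighted g ψ ω) lam +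
      2 * Real.pi * (φ (-I * lam) * ψ (-I * lam) * gc (-I * lam)) := by
  obtain ⟨h, hh, hφ⟩ := φ.exists_expHolomorphic
  obtain ⟨k, hk, hψ⟩ := ψ.exists_expHolomorphic
  have hz : -I * lam ∈ strip p 0 :=
    mem_strip_zero.mpr (by rw [neg_I_mul_im]; constructor <;> linarith)
  rw [hs.continuedTransform_congr (k := fun z => h z * k z)
    (fun z hz => by rw [hφ z hz, hψ z hz]) h0, hs.continuedTransform_of_neg (hh.mul hk) h1,
    hφ _ hz, hψ _ hz]
  congr 2
  ext ω
  rw [weighted, hφ _ (real_mem_strip (by linarith) ω), hψ _ (real_mem_strip (by linarith) ω)]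
  ring

theorem exists_canonicalImage (hg : RapidDecay fun ω : ℝ => (g ω : ℂ)) (hp : 0 ≤ p) (ψ : Fp p) :
    ∃ ι : FpDual p, IsCanonicalImage g ψ ι := by
  obtain ⟨ι, hι⟩ := exists_dual_integral (rapidDecay_weighted hg hp ψ) le_rfl hp
  refine ⟨ι, fun φ => (hι φ).trans (integral_congr_ae (Eventually.of_forall fun ω => ?_))⟩
  simp [weighted, mul_assoc]

theorem StripContinuation.isMu (hs : StripContinuation g gc p ε) {lam : ℂ} (h0 : -p ≤ lam.re)
    {μ : FpDual p} (hμ : ∀ φ : Fp p, pair φ μ = continuedTransform g gc ε φ lam) :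
    IsMu g gc lam μ := by
  have hp : 0 ≤ p := hs.eps_pos.le.trans hs.eps_le
  refine ⟨fun h1 φ => ?_, fun h1 φ => ?_⟩
  · rw [hμ, hs.continuedTransform_apply_of_neg φ h0 h1, ← mul_assoc (2 * Real.pi : ℂ)]
    rfl
  · obtain ⟨h, hh, hφ⟩ := φ.exists_expHolomorphic
    rw [hμ, hs.continuedTransform_congr hφ h0]
    refine ((hs.tendsto_continuedTransform_add hh h1).mono_left nhdsWithin_le_nhds).congr' ?_
    filter_upwards [self_mem_nhdsWithin] with x hx
    rw [hs.continuedTransform_of_pos hh (by simpa [h1] using hx), cauchyTransform]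
    refine integral_congr_ae (Eventually.of_forall fun ω => ?_)
    simp only
    rw [hφ _ (real_mem_strip hp ω)]

theorem StripContinuation.isPsiMu (hs : StripContinuation g gc p ε) (ψ : Fp p) {lam : ℂ}
    (h0 : -p ≤ lam.re) (h1 : lam.re < 0) {ν : FpDual p} (hν : ∀ φ : Fp p,
      pair φ ν = continuedTransform g gc ε (fun z => φ z * ψ z) lam) : IsPsiMu g gc ψ lam ν := by
  intro φ
  rw [hν, hs.continuedTransform_mul_of_neg φ ψ h0 h1, cauchyTransform]
  congr 1
  · refine integral_congr_ae (Eventually.of_forall fun ω => ?_)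
    simp only [weighted]
    ring
  · ring

/-! ### The functionals given by line integrals -/

theorem tendsto_charTransform_atTop (u : ℝ → ℂ) : Tendsto (charTransform u) atTop (𝓝 0) := by
  have h1 : Tendsto (fun t : ℝ => -(t / (2 * Real.pi))) atTop (cocompact ℝ) :=
    (tendsto_neg_atTop_atBot.comp (tendsto_id.atTop_div_const (by positivity))).mono_right
      atBot_le_cocompact
  refine ((Real.zero_at_infty_fourier u).comp h1).congr fun t => ?_
  rw [Function.comp_apply, Real.fourier_real_eq_integral_exp_smul, charTransform]
  refine integral_congr_ae (Eventually.of_forall fun ω => ?_)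
  simp only
  rw [smul_eq_mul]
  congr 2
  push_cast
  have : (Real.pi : ℂ) ≠ 0 := by exact_mod_cast Real.pi_ne_zero
  field_simp

theorem neg_I_mul_line (a y : ℝ) : -I * (-(a : ℂ) + I * y) = y + a * I := by
  linear_combination (-(y : ℂ)) * I_sq

theorem line_re (a y : ℝ) : (-(a : ℂ) + I * y).re = -a := by simp

theorem StripContinuation.continuous_continuedTransform_line (hs : StripContinuation g gc p ε)
    (hap : a ≤ p) (han : ∀ lam : ℂ, lam.re = -a → AnalyticAt ℂ gc (-I * lam)) (φ : Fp p) :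
    Continuous fun y : ℝ => continuedTransform g gc ε φ (-a + I * y) := by
  obtain ⟨h, hh, hφ⟩ := φ.exists_expHolomorphic
  have hre : ∀ y : ℝ, -p ≤ (-(a : ℂ) + I * y).re := fun y => by rw [line_re]; linarith
  have e : (fun y : ℝ => continuedTransform g gc ε φ (-a + I * y)) =
      fun y : ℝ => continuedTransform g gc ε h (-a + I * y) :=
    funext fun y => hs.continuedTransform_congr hφ (hre y)
  rw [e, continuous_iff_continuousAt]
  intro y
  have := (hs.analyticAt_continuedTransform hh (hre y) fun _ => han _ (line_re a y)).continuousAt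
  exact ContinuousAt.comp (f := fun y : ℝ => (-(a : ℂ) + I * y)) this (by fun_prop)

theorem StripContinuation.continuous_G_line (hs : StripContinuation g gc p ε) (K : ℝ)
    (hap : a ≤ p) (han : ∀ lam : ℂ, lam.re = -a → AnalyticAt ℂ gc (-I * lam)) :
    Continuous fun y : ℝ => G K g gc (-a + I * y) := by
  rw [continuous_iff_continuousAt]
  intro y
  have := (hs.analyticAt_G K (lam := -a + I * y) (by rw [line_re]; linarith)
    fun _ => han _ (line_re a y)).continuousAt
  exact ContinuousAt.comp (f := fun y : ℝ => (-(a : ℂ) + I * y)) this (by fun_prop)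

theorem StripContinuation.exists_le_norm_G_line (hs : StripContinuation g gc p ε) (hap : a ≤ p)
    (han : ∀ lam : ℂ, lam.re = -a → AnalyticAt ℂ gc (-I * lam))
    (hG : ∀ lam : ℂ, lam.re = -a → G K g gc lam ≠ 0) :
    ∃ m : ℝ, 0 < m ∧ ∀ y : ℝ, m ≤ ‖G K g gc (-a + I * y)‖ := by
  have hc := hs.continuous_G_line K hap han
  have h1 : ∀ᶠ z in verticalEnds (-p), 1 / 2 < ‖G K g gc z‖ :=
    (hs.tendsto_G K).norm.eventually (lt_mem_nhds (by norm_num))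
  obtain ⟨Y, hY⟩ := eventually_verticalEnds.mp h1
  obtain ⟨y₀, -, hmin⟩ := (isCompact_Icc (a := -|Y|) (b := |Y|)).exists_isMinOn
    ⟨0, by simp⟩ (f := fun y : ℝ => ‖G K g gc (-a + I * y)‖) hc.norm.continuousOn
  refine ⟨min (1 / 2) ‖G K g gc (-a + I * y₀)‖, lt_min (by norm_num)
    (norm_pos_iff.mpr (hG _ (line_re a y₀))), fun y => ?_⟩
  by_cases hy : Y ≤ |y|
  · exact (min_le_left _ _).trans (hY _ (by rw [line_re]; linarith) (by simpa using hy)).le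
  · have : |y| ≤ |Y| := (not_le.mp hy).le.trans (le_abs_self Y)
    exact (min_le_right _ _).trans (hmin (abs_le.mp this))

/-- On a vertical line the continued transforms are `O(1/λ)`, uniformly on bounded sets of each
step space. -/
theorem StripContinuation.exists_line_bound (hs : StripContinuation g gc p ε) (ha : 0 < a)
    (hap : a ≤ p) (han : ∀ lam : ℂ, lam.re = -a → AnalyticAt ℂ gc (-I * lam)) (β : ℕ) :
    ∃ C : ℝ, 0 ≤ C ∧ ∀ (φ : Fp p) (M : ℝ), 0 ≤ M → (∀ z, ‖φ z‖ ≤ M * Real.exp (β * ‖z‖)) →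
      ∀ y : ℝ, ‖(-a + I * y : ℂ)‖ * ‖continuedTransform g gc ε φ (-a + I * y)‖ ≤ C * M := by
  have hg : RapidDecay fun ω : ℝ => (g ω : ℂ) := by
    simpa using hs.rapidDecay_real (ExpHolomorphic.one p)
  have hp : 0 ≤ p := ha.le.trans hap
  have hgc : RapidDecay fun ω : ℝ => gc (ω + a * I) := by
    simpa using hs.rapidDecay (ExpHolomorphic.one p) ha.le hap fun z hz => by
      have := han (I * z) (by simp [hz])
      rwa [← mul_assoc, neg_mul, I_mul_I, neg_neg, one_mul] at this
  obtain ⟨C₂, hC₂⟩ := hgc.bound (β + 1)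
  have hC₂0 : 0 ≤ C₂ :=
    nonneg_of_mul_nonneg_left ((norm_nonneg _).trans (hC₂ 0)) (Real.exp_pos _)
  have hw : RapidDecay fun ω : ℝ => (Real.exp (β * |ω|) : ℂ) * g ω :=
    hg.mul_of_exp_bound (A := 1) (β := β) (by fun_prop) fun ω => by
      rw [Complex.norm_real, Real.norm_of_nonneg (Real.exp_pos _).le, one_mul]
  set C₁ := ∫ ω : ℝ, ‖(Real.exp (β * |ω|) : ℂ) * g ω‖ * (1 + |ω| / a) with hC₁
  have hC₁0 : 0 ≤ C₁ := integral_nonneg fun ω => by positivity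
  refine ⟨C₁ + 2 * Real.pi * (Real.exp ((β + 1) * a) * C₂), by positivity,
    fun φ M hM hφ y => ?_⟩
  have hre : (-(a : ℂ) + I * y).re = -a := line_re a y
  rw [hs.continuedTransform_apply_of_neg φ (by rw [hre]; linarith) (by rw [hre]; linarith),
    neg_I_mul_line]
  have h1 : ‖(-a + I * y : ℂ)‖ * ‖cauchyTransform (weighted g φ) (-a + I * y)‖ ≤ C₁ * M := by
    refine (norm_mul_norm_cauchyTransform_le
      ((rapidDecay_weighted hg hp φ).integrable_one_add_abs_mul a) ha
      (by rw [hre, abs_neg]; exact le_abs_self a)).trans ?_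
    rw [hC₁, ← integral_mul_const]
    refine integral_mono ((rapidDecay_weighted hg hp φ).integrable_one_add_abs_mul a)
      ((hw.integrable_one_add_abs_mul a).mul_const M) fun ω => ?_
    simp only [weighted]
    rw [norm_mul, norm_mul, Complex.norm_real (Real.exp _),
      Real.norm_of_nonneg (Real.exp_pos _).le]
    have := hφ ω
    rw [Complex.norm_real, Real.norm_eq_abs] at this
    calc ‖φ ω‖ * ‖(g ω : ℂ)‖ * (1 + |ω| / a)
        ≤ (M * Real.exp (β * |ω|)) * ‖(g ω : ℂ)‖ * (1 + |ω| / a) := by gcongr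
      _ = _ := by ring
  have h2 : ‖(-a + I * y : ℂ)‖ * (‖φ (y + a * I)‖ * ‖gc (y + a * I)‖) ≤
      Real.exp ((β + 1) * a) * C₂ * M := by
    have e1 : ‖(-a + I * y : ℂ)‖ ≤ |y| + a := by
      refine (norm_add_le _ _).trans ?_
      simp [abs_of_pos ha, add_comm]
    have e2 : ‖(-a + I * y : ℂ)‖ ≤ Real.exp (|y| + a) := by
      linarith [Real.add_one_le_exp (|y| + a)]
    calc _ ≤ Real.exp (|y| + a) * ((M * Real.exp (β * a) * Real.exp (β * |y|)) *
          (C₂ * Real.exp (-(β + 1) * |y|))) := by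
          gcongr
          · exact Fp.bound_line hM hφ ha.le y
          · exact hC₂ y
      _ = (Real.exp (|y| + a) * Real.exp (β * a) * Real.exp (β * |y|) *
          Real.exp (-(β + 1) * |y|)) * C₂ * M := by ring
      _ = _ := by
          rw [← Real.exp_add, ← Real.exp_add, ← Real.exp_add]
          congr 3
          ring
  calc _ ≤ ‖(-a + I * y : ℂ)‖ * (‖cauchyTransform (weighted g φ) (-a + I * y)‖ +
        2 * Real.pi * (‖φ (y + a * I)‖ * ‖gc (y + a * I)‖)) := by
        gcongr
        refine (norm_add_le _ _).trans (le_of_eq ?_)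
        rw [norm_mul, norm_mul, norm_mul, Complex.norm_real, RCLike.norm_two,
          Real.norm_of_nonneg Real.pi_pos.le]
    _ ≤ C₁ * M + 2 * Real.pi * (Real.exp ((β + 1) * a) * C₂ * M) := by
        rw [mul_add, mul_left_comm]
        gcongr
    _ = _ := by ring

/-- The coupled part of the resolvent on the line `Re λ = -a`, up to a constant. -/
noncomputable def lineKernel (K : ℝ) (g : ℝ → ℝ) (gc : ℂ → ℂ) (ε a : ℝ) (ψ φ : Fp p) (y : ℝ) : ℂ :=
  continuedTransform g gc ε ψ (-a + I * y) / G K g gc (-a + I * y) *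
    continuedTransform g gc ε φ (-a + I * y)

theorem StripContinuation.continuous_lineKernel (hs : StripContinuation g gc p ε)
    (hap : a ≤ p) (han : ∀ lam : ℂ, lam.re = -a → AnalyticAt ℂ gc (-I * lam))
    (hG : ∀ lam : ℂ, lam.re = -a → G K g gc lam ≠ 0) (ψ φ : Fp p) :
    Continuous (lineKernel K g gc ε a ψ φ) :=
  ((hs.continuous_continuedTransform_line hap han ψ).div (hs.continuous_G_line K hap han)
    fun y => hG _ (line_re a y)).mul (hs.continuous_continuedTransform_line hap han φ)

theorem StripContinuation.exists_lineKernel_bound (hs : StripContinuation g gc p ε) (ha : 0 < a)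
    (hap : a ≤ p) (han : ∀ lam : ℂ, lam.re = -a → AnalyticAt ℂ gc (-I * lam))
    (hG : ∀ lam : ℂ, lam.re = -a → G K g gc lam ≠ 0) (ψ : Fp p) (β : ℕ) :
    ∃ C : ℝ, 0 ≤ C ∧ ∀ (φ : Fp p) (M : ℝ), 0 ≤ M → (∀ z, ‖φ z‖ ≤ M * Real.exp (β * ‖z‖)) →
      ∀ y : ℝ, ‖lineKernel K g gc ε a ψ φ y‖ ≤ C * M * (1 / (a ^ 2 + y ^ 2)) := by
  obtain ⟨m, hm, hmG⟩ := hs.exists_le_norm_G_line hap han hG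
  obtain ⟨γ, N, hN, hψ⟩ := ψ.exists_bound
  obtain ⟨C₁, hC₁, h1⟩ := hs.exists_line_bound ha hap han γ
  obtain ⟨C₂, hC₂, h2⟩ := hs.exists_line_bound ha hap han β
  refine ⟨C₁ * N * C₂ / m, by positivity, fun φ M hM hφ y => ?_⟩
  have e1 := h1 ψ N hN hψ y
  have e2 := h2 φ M hM hφ y
  have e3 := hmG y
  have e4 : ‖(-a + I * y : ℂ)‖ ^ 2 = a ^ 2 + y ^ 2 := by
    have := norm_line_sq (-a) y
    rwa [ofReal_neg, neg_sq] at this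
  have e5 : 0 < a ^ 2 + y ^ 2 := by positivity
  have e6 := mul_le_mul e1 e2 (by positivity) (by positivity)
  rw [lineKernel, norm_mul, norm_div, mul_one_div, le_div_iff₀ e5, ← e4,
    div_mul_eq_mul_div, div_mul_eq_mul_div, div_mul_eq_mul_div]
  refine div_le_div₀ (by positivity) ?_ hm e3
  linarith

theorem StripContinuation.integrable_lineKernel (hs : StripContinuation g gc p ε) (ha : 0 < a)
    (hap : a ≤ p) (han : ∀ lam : ℂ, lam.re = -a → AnalyticAt ℂ gc (-I * lam))
    (hG : ∀ lam : ℂ, lam.re = -a → G K g gc lam ≠ 0) (ψ φ : Fp p) :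
    Integrable (lineKernel K g gc ε a ψ φ) := by
  obtain ⟨β, M, hM, hφ⟩ := φ.exists_bound
  obtain ⟨C, -, hC⟩ := hs.exists_lineKernel_bound ha hap han hG ψ β
  exact ((integrable_inv_const_add_sq ha.ne').const_mul (C * M)).mono'
    (hs.continuous_lineKernel hap han hG ψ φ).aestronglyMeasurable
    (Eventually.of_forall (hC φ M hM hφ))

theorem StripContinuation.exists_dual_lineKernel (hs : StripContinuation g gc p ε) (ha : 0 < a)
    (hap : a ≤ p) (han : ∀ lam : ℂ, lam.re = -a → AnalyticAt ℂ gc (-I * lam))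
    (hG : ∀ lam : ℂ, lam.re = -a → G K g gc lam ≠ 0) (ψ : Fp p) (t : ℝ) :
    ∃ V : FpDual p, ∀ φ, pair φ V = charTransform (lineKernel K g gc ε a ψ φ) t := by
  choose μ hμ using fun y : ℝ => hs.exists_mu (-a + I * y)
  have e : ∀ φ y, lineKernel K g gc ε a ψ φ y =
      continuedTransform g gc ε ψ (-a + I * y) / G K g gc (-a + I * y) * pair φ (μ y) :=
    fun φ y => by rw [hμ, lineKernel]
  have hi := hs.integrable_lineKernel ha hap han hG ψ
  refine exists_dual _ (fun φ φ' => ?_) (fun c φ => ?_) fun β => ?_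
  · rw [charTransform, charTransform, charTransform, ← integral_add
      (integrable_exp_I_mul (hi φ) t) (integrable_exp_I_mul (hi φ') t)]
    refine integral_congr_ae (Eventually.of_forall fun y => ?_)
    simp only
    rw [e, e, e, pair_add_left]
    ring
  · rw [charTransform, charTransform, ← integral_const_mul]
    refine integral_congr_ae (Eventually.of_forall fun y => ?_)
    simp only
    rw [e, e, pair_smul_left]
    ring
  · obtain ⟨C, hC0, hC⟩ := hs.exists_lineKernel_bound ha hap han hG ψ β
    refine ⟨C * ∫ y : ℝ, 1 / (a ^ 2 + y ^ 2), fun φ M hM hφ => ?_⟩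
    refine (norm_charTransform_le _ t).trans ?_
    refine (integral_mono (hi φ).norm ((integrable_inv_const_add_sq ha.ne').const_mul (C * M))
      (hC φ M hM hφ)).trans (le_of_eq ?_)
    rw [integral_const_mul]
    ring

/-- The contribution of the continuous part of the generator on the line `Im z = a`. -/
noncomputable def lineDensity (gc : ℂ → ℂ) (a : ℝ) (ψ φ : Fp p) (y : ℝ) : ℂ :=
  2 * Real.pi * (φ (y + a * I) * ψ (y + a * I) * gc (y + a * I))

theorem StripContinuation.rapidDecay_line (hs : StripContinuation g gc p ε) (ha : 0 < a)
    (hap : a ≤ p) (han : ∀ lam : ℂ, lam.re = -a → AnalyticAt ℂ gc (-I * lam)) (ψ : Fp p) :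
    RapidDecay fun y : ℝ => ψ (y + a * I) * gc (y + a * I) := by
  have hgc : RapidDecay fun ω : ℝ => gc (ω + a * I) := by
    simpa using hs.rapidDecay (ExpHolomorphic.one p) ha.le hap fun z hz => by
      have := han (I * z) (by simp [hz])
      rwa [← mul_assoc, neg_mul, I_mul_I, neg_neg, one_mul] at this
  exact ψ.rapidDecay_mul hgc ha.le hap

theorem StripContinuation.integrable_lineDensity (hs : StripContinuation g gc p ε) (ha : 0 < a)
    (hap : a ≤ p) (han : ∀ lam : ℂ, lam.re = -a → AnalyticAt ℂ gc (-I * lam)) (ψ φ : Fp p) :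
    Integrable (lineDensity gc a ψ φ) := by
  have := ((φ.rapidDecay_mul (hs.rapidDecay_line ha hap han ψ) ha.le hap).integrable).const_mul
    (2 * Real.pi : ℂ)
  refine this.congr (Eventually.of_forall fun y => ?_)
  simp only [lineDensity]
  ring

theorem StripContinuation.exists_dual_lineDensity (hs : StripContinuation g gc p ε) (ha : 0 < a)
    (hap : a ≤ p) (han : ∀ lam : ℂ, lam.re = -a → AnalyticAt ℂ gc (-I * lam)) (ψ : Fp p) (t : ℝ) :
    ∃ U : FpDual p, ∀ φ, pair φ U = charTransform (lineDensity gc a ψ φ) t := by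
  have hw := (hs.rapidDecay_line ha hap han ψ).mul_of_exp_bound
    (v := fun y : ℝ => Complex.exp (I * y * t) * (2 * Real.pi)) (A := 2 * Real.pi) (β := 0)
    (by fun_prop) fun y => by
      rw [norm_mul, norm_exp_I_mul, norm_mul, Complex.norm_real, RCLike.norm_two,
        Real.norm_of_nonneg Real.pi_pos.le, zero_mul, Real.exp_zero]
      simp
  obtain ⟨U, hU⟩ := exists_dual_integral hw ha.le hap
  refine ⟨U, fun φ => (hU φ).trans (integral_congr_ae (Eventually.of_forall fun y => ?_))⟩
  simp only [lineDensity]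
  ring

end Kuramoto

namespace Kuramoto

variable {g : ℝ → ℝ} {gc : ℂ → ℂ} {p ε K a : ℝ}

/-! ### The spectral decomposition -/

theorem tendsto_integral_charTransform {u : ℝ → ℂ} (hu : Integrable u) (t : ℝ) :
    Tendsto (fun r : ℝ × ℝ => ∫ y in r.1..r.2, Complex.exp (I * y * t) * u y) (atBot ×ˢ atTop)
      (𝓝 (charTransform u t)) :=
  intervalIntegral_tendsto_integral (integrable_exp_I_mul hu t) tendsto_fst tendsto_snd

theorem StripContinuation.continuous_lineDensity (hs : StripContinuation g gc p ε) (ha : 0 < a)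
    (hap : a ≤ p) (han : ∀ lam : ℂ, lam.re = -a → AnalyticAt ℂ gc (-I * lam)) (ψ φ : Fp p) :
    Continuous (lineDensity gc a ψ φ) := by
  have := (φ.rapidDecay_mul (hs.rapidDecay_line ha hap han ψ) ha.le hap).cont.const_mul
    (2 * Real.pi : ℂ)
  refine this.congr fun y => ?_
  rw [lineDensity]
  ring

theorem continuous_cauchyTransform_neg_line {u : ℝ → ℂ} (hu : Integrable u) (ha : 0 < a) :
    Continuous fun y : ℝ => cauchyTransform u (-a + I * y) := by
  have := continuous_cauchyTransform_line hu (neg_ne_zero.mpr ha.ne')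
  simpa only [ofReal_neg] using this

theorem StripContinuation.continuedTransform_mul_line (hs : StripContinuation g gc p ε)
    (ha : 0 < a) (hap : a ≤ p) (φ ψ : Fp p) (y : ℝ) :
    continuedTransform g gc ε (fun z => φ z * ψ z) (-a + I * y) =
      cauchyTransform (fun ω : ℝ => φ ω * weighted g ψ ω) (-a + I * y) +
        lineDensity gc a ψ φ y := by
  rw [hs.continuedTransform_mul_of_neg φ ψ (by rw [line_re]; linarith) (by rw [line_re]; linarith),
    neg_I_mul_line, lineDensity]

theorem StripContinuation.tendsto_integral_mul_line (hs : StripContinuation g gc p ε)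
    (ha : 0 < a) (hap : a ≤ p) (han : ∀ lam : ℂ, lam.re = -a → AnalyticAt ℂ gc (-I * lam))
    (φ ψ : Fp p) {t : ℝ} (ht : 0 < t) :
    (∀ r s : ℝ, IntervalIntegrable (fun y : ℝ => Complex.exp (I * y * t) *
      continuedTransform g gc ε (fun z => φ z * ψ z) (-a + I * y)) volume r s) ∧
    Tendsto (fun r : ℝ × ℝ => ∫ y in r.1..r.2, Complex.exp (I * y * t) *
      continuedTransform g gc ε (fun z => φ z * ψ z) (-a + I * y)) (atBot ×ˢ atTop)
      (𝓝 (charTransform (lineDensity gc a ψ φ) t)) := by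
  have hp : 0 ≤ p := ha.le.trans hap
  have hg : RapidDecay fun ω : ℝ => (g ω : ℂ) := by
    simpa using hs.rapidDecay_real (ExpHolomorphic.one p)
  have hu : RapidDecay fun ω : ℝ => φ ω * weighted g ψ ω := by
    simpa using φ.rapidDecay_mul (rapidDecay_weighted hg hp ψ) le_rfl hp
  have c1 := continuous_cauchyTransform_neg_line hu.integrable ha
  have c2 := hs.continuous_lineDensity ha hap han ψ φ
  simp_rw [hs.continuedTransform_mul_line ha hap φ ψ, mul_add]
  constructor
  · exact fun r s => Continuous.intervalIntegrable (by fun_prop) _ _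
  · have t1 := tendsto_integral_exp_mul_cauchyTransform hu.integrable (neg_ne_zero.mpr ha.ne') ht
    rw [if_neg (by linarith)] at t1
    have t2 := t1.add (tendsto_integral_charTransform (hs.integrable_lineDensity ha hap han ψ φ) t)
    rw [zero_add] at t2
    refine t2.congr fun r => ?_
    simp only [ofReal_neg]
    rw [← intervalIntegral.integral_add (Continuous.intervalIntegrable (by fun_prop) _ _)
      (Continuous.intervalIntegrable (by fun_prop) _ _)]

/-- The decomposition of the matrix elements of the semigroup. -/
theorem StripContinuation.integral_orbit_decomposition (hs : StripContinuation g gc p ε)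
    (hK : 0 < K) (ha : 0 < a) (hap : a ≤ p)
    (hright : ∀ lam : ℂ, 0 < lam.re → G K g gc lam ≠ 0)
    (hline : ∀ lam : ℂ, lam.re = -a → AnalyticAt ℂ gc (-I * lam) ∧ ¬ IsResonancePole K g gc lam)
    (hsimple : ∀ lam ∈ resonancePoles K g gc a, IsSimpleRoot K g gc lam)
    (hfin : (resonancePoles K g gc a).Finite) {φ ψ ζ : Fp p} {t : ℝ} (ht : 0 < t)
    {η : ℝ → ℂ} (hη : IsFeedback K g φ η)
    (hζ : ∀ z ∈ strip p 0, ζ z = orbit (K / 2) η (φ z) z t) :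
    ∫ ω : ℝ, ζ ω * ψ ω * g ω =
      ∑ lam ∈ hfin.toFinset, (K / (2 * residueConst K g gc lam) * Complex.exp (lam * t) *
        continuedTransform g gc ε ψ lam) * continuedTransform g gc ε φ lam +
      Complex.exp (-a * t) / (2 * Real.pi) * charTransform (lineDensity gc a ψ φ) t +
      K * Complex.exp (-a * t) / (4 * Real.pi) *
        charTransform (lineKernel K g gc ε a ψ φ) t := by
  have hp : 0 ≤ p := ha.le.trans hap
  have han : ∀ lam : ℂ, lam.re = -a → AnalyticAt ℂ gc (-I * lam) := fun lam h => (hline lam h).1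
  have hG : ∀ lam : ℂ, lam.re = -a → G K g gc lam ≠ 0 := fun lam h =>
    hs.G_ne_zero_line hK ha hline h
  obtain ⟨h, hh, hφ⟩ := φ.exists_expHolomorphic
  obtain ⟨k, hk, hψ⟩ := ψ.exists_expHolomorphic
  have hb := feedbackBound_nonneg K g
  have hleft := hs.tendsto_integral_left hK ha hap hright hline hsimple hfin hh hk
    (b := 2 * feedbackBound K g + 2) (by linarith) ht
    (hs.tendsto_integral_right hp hh hk hφ hψ ht (by linarith) hη hζ)
  have e1 : ∀ y : ℝ, Complex.exp (((-a : ℝ) + I * y) * t) *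
      resolventElement K g gc ε h k ((-a : ℝ) + I * y) =
      Complex.exp (-a * t) * (Complex.exp (I * y * t) *
        continuedTransform g gc ε (fun z => φ z * ψ z) (-a + I * y)) +
      Complex.exp (-a * t) * (K / 2) * (Complex.exp (I * y * t) *
        lineKernel K g gc ε a ψ φ y) := by
    intro y
    have hre : -p ≤ (-(a : ℂ) + I * y).re := by rw [line_re]; linarith
    rw [exp_line_eq, ofReal_neg, resolventElement, lineKernel,
      hs.continuedTransform_congr (k := h) hφ hre, hs.continuedTransform_congr (k := k) hψ hre,
      hs.continuedTransform_congr (h := fun z => φ z * ψ z) (k := fun z => h z * k z)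
        (fun z hz => by rw [hφ z hz, hψ z hz]) hre]
    ring
  simp_rw [e1] at hleft
  obtain ⟨i1, t1⟩ := hs.tendsto_integral_mul_line ha hap han φ ψ ht
  have i2 := hs.integrable_lineKernel ha hap han hG ψ φ
  have t2 := tendsto_integral_charTransform i2 t
  have hsum := (t1.const_mul (Complex.exp (-a * t))).add
    (t2.const_mul (Complex.exp (-a * t) * (K / 2)))
  have huniq := tendsto_nhds_unique hleft (hsum.congr fun r => ?_)
  · have hpi : (Real.pi : ℂ) ≠ 0 := by exact_mod_cast Real.pi_ne_zero
    have e2 : ∑ lam ∈ hfin.toFinset, resolventResidue K g gc ε h k lam *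
        (2 * Real.pi * Complex.exp (lam * t)) = 2 * Real.pi *
        ∑ lam ∈ hfin.toFinset, (K / (2 * residueConst K g gc lam) * Complex.exp (lam * t) *
        continuedTransform g gc ε ψ lam) * continuedTransform g gc ε φ lam := by
      rw [Finset.mul_sum]
      refine Finset.sum_congr rfl fun lam hl => ?_
      have hre : -p ≤ lam.re := by
        have := ((Set.Finite.mem_toFinset hfin).mp hl).2.1
        linarith
      rw [resolventResidue, hs.continuedTransform_congr hφ hre,
        hs.continuedTransform_congr hψ hre]
      rw [div_mul_eq_div_div]
      ring
    rw [e2] at huniq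
    generalize ∑ lam ∈ hfin.toFinset, (K / (2 * residueConst K g gc lam) * Complex.exp (lam * t) *
        continuedTransform g gc ε ψ lam) * continuedTransform g gc ε φ lam = X at huniq ⊢
    generalize Complex.exp (-a * t) = E at huniq ⊢
    field_simp
    linear_combination 4 * huniq
  · rw [← intervalIntegral.integral_const_mul, ← intervalIntegral.integral_const_mul,
      ← intervalIntegral.integral_add ((i1 _ _).const_mul _)
        (((integrable_exp_I_mul i2 t).intervalIntegrable).const_mul _)]

theorem HasWeakIntegral.smul {f : ℝ → FpDual p} {ξ : FpDual p} (h : HasWeakIntegral f ξ) (c : ℂ) :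
    HasWeakIntegral (fun y => c • f y) (c • ξ) := by
  intro φ
  obtain ⟨h1, h2⟩ := h φ
  simp_rw [pair_smul, intervalIntegral.integral_const_mul]
  exact ⟨fun r s => (h1 r s).const_mul _, h2.const_mul _⟩

theorem conj_exp_neg_I_mul (y t : ℝ) :
    conj (Complex.exp (-I * y * t)) = Complex.exp (I * y * t) := by
  rw [← Complex.exp_conj]
  simp

theorem exp_conj_line_mul (a y t : ℝ) : I * Complex.exp (-a * t) * Complex.exp (-I * y * t) =
    I * Complex.exp (conj (-(a : ℂ) + I * y) * t) := by
  rw [mul_assoc, ← Complex.exp_add]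
  congr 2
  simp
  ring

theorem HasWeakIntegral.hasLineIntegral {f : ℂ → ℂ} {μ : ℂ → FpDual p} {ξ : FpDual p} {t : ℝ}
    (h : HasWeakIntegral (fun y : ℝ => (Complex.exp (-I * y * t) * f (-a + I * y)) •
      μ (-a + I * y)) ξ) :
    HasLineIntegral a (fun lam => (Complex.exp (conj lam * t) * f lam) • μ lam)
      ((I * Complex.exp (-a * t)) • ξ) := by
  have := h.smul (I * Complex.exp (-a * t))
  rw [HasLineIntegral]
  convert this using 2 with y
  rw [smul_smul, smul_smul, ← mul_assoc, ← mul_assoc, exp_conj_line_mul]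

theorem tendsto_nnreal_charTransform {u : ℝ → ℂ} (hu : Integrable u) :
    Tendsto (fun t : ℝ≥0 => charTransform u t) (𝓝[>] 0) (𝓝 (charTransform u 0)) := by
  have := (continuous_charTransform hu).comp NNReal.continuous_coe
  exact (this.tendsto' 0 _ (by simp)).mono_left nhdsWithin_le_nhds

theorem tendsto_smul_line {W : ℝ≥0 → FpDual p} {u : Fp p → ℝ → ℂ} (hu : ∀ φ, Integrable (u φ))
    (hW : ∀ φ t, pair φ (W t) = charTransform (u φ) t) (a : ℝ) :
    Tendsto (fun t : ℝ≥0 => (I * Complex.exp (-a * (t : ℝ))) • W t) (𝓝[>] 0) (𝓝 (I • W 0)) := by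
  refine tendsto_dual_iff.mpr fun φ => ?_
  simp_rw [pair_smul, hW]
  refine Tendsto.mul ?_ (tendsto_nnreal_charTransform (hu φ))
  have hc : Continuous fun t : ℝ≥0 => conj (I * Complex.exp (-a * (t : ℝ))) := by fun_prop
  exact (hc.tendsto' 0 _ (by simp)).mono_left nhdsWithin_le_nhds

theorem tendsto_atTop_line {W : ℝ≥0 → FpDual p} {u : Fp p → ℝ → ℂ}
    (hW : ∀ φ t, pair φ (W t) = charTransform (u φ) t) : Tendsto W atTop (𝓝 0) := by
  refine tendsto_dual_iff.mpr fun φ => ?_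
  simp_rw [hW, pair_zero]
  exact (tendsto_charTransform_atTop _).comp (NNReal.tendsto_coe_atTop.mpr tendsto_id)

end Kuramoto

open Kuramoto in
theorem theorem5p14 (g : ℝ → ℝ) (gc : ℂ → ℂ) (K p a : ℝ)
    (hg : IsProbabilityDensity g) (hA1 : HasMeromorphicContinuation g gc)
    (hA2 : DecaysSuperexponentially g) (hA3 : DecaysInSectors gc)
    (hK : 0 < K) (hKc : K ≤ criticalCoupling g)
    (hp : 0 < p) (ha : 0 < a) (hap : a ≤ p)
    (hline : ∀ lam : ℂ, lam.re = -a →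
      AnalyticAt ℂ gc (-I * lam) ∧ ¬ IsResonancePole K g gc lam)
    (hsimple : ∀ lam ∈ resonancePoles K g gc a, IsSimpleRoot K g gc lam) :
    -- the semigroup generated by `T₁` on `F_p` exists and is unique
    (∃! S : ℝ≥0 → Fp p →L[ℂ] Fp p, IsSemigroupGeneratedBy (T1 K g p) S) ∧
    -- there are finitely many resonance poles in the strip
    ∃ hfin : (resonancePoles K g gc a).Finite,
    -- the functionals `i(ψ)`, `μ(λ)` and `ψ̄ · μ(λ)` belong to `F_p'`
    ∃ (ι : Fp p → FpDual p) (μ : ℂ → FpDual p) (ν : Fp p → ℂ → FpDual p),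
      (∀ ψ, IsCanonicalImage g ψ (ι ψ)) ∧
      (∀ lam : ℂ, -p ≤ lam.re → lam.re ≤ 0 → AnalyticAt ℂ gc (-I * lam) →
        IsMu g gc lam (μ lam)) ∧
      (∀ ψ, ∀ lam : ℂ, -p ≤ lam.re → lam.re < 0 → AnalyticAt ℂ gc (-I * lam) →
        IsPsiMu g gc ψ lam (ν ψ lam)) ∧
      ∀ S : ℝ≥0 → Fp p →L[ℂ] Fp p, IsSemigroupGeneratedBy (T1 K g p) S → ∀ ψ : Fp p,
        ∃ (U V U' V' : ℝ≥0 → FpDual p) (L M : FpDual p),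
          (∀ t : ℝ≥0, 0 < t →
            HasWeakIntegral (fun y : ℝ => Complex.exp (-I * y * (t : ℝ)) • ν ψ (-a + I * y))
              (U t) ∧
            HasWeakIntegral (fun y : ℝ => (Complex.exp (-I * y * (t : ℝ)) *
                (1 / conj (G K g gc (-a + I * y))) * conj (pair ψ (μ (-a + I * y)))) •
                  μ (-a + I * y))
              (V t) ∧
            dualOp (S t) (ι ψ) =
              (∑ lam ∈ hfin.toFinset, ((K / (2 * conj (residueConst K g gc lam)) : ℂ) *
                Complex.exp (conj lam * (t : ℝ)) * conj (pair ψ (μ lam))) • μ lam) +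
              (Complex.exp (-a * (t : ℝ)) / (2 * Real.pi) : ℂ) • U t +
              (K * Complex.exp (-a * (t : ℝ)) / (4 * Real.pi) : ℂ) • V t ∧
            HasLineIntegral a (fun lam => Complex.exp (conj lam * (t : ℝ)) • ν ψ lam) (U' t) ∧
            HasLineIntegral a (fun lam => (Complex.exp (conj lam * (t : ℝ)) *
                (1 / conj (G K g gc lam)) * conj (pair ψ (μ lam))) • μ lam) (V' t) ∧
            dualOp (S t) (ι ψ) =
              (∑ lam ∈ hfin.toFinset, ((K / (2 * conj (residueConst K g gc lam)) : ℂ) *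
                Complex.exp (conj lam * (t : ℝ)) * conj (pair ψ (μ lam))) • μ lam) +
              (1 / (2 * Real.pi * I) : ℂ) • U' t +
              (K / (4 * Real.pi * I) : ℂ) • V' t) ∧
          -- the two integral terms are `o(exp(-a t))` as `t → ∞`
          Tendsto U atTop (𝓝 0) ∧ Tendsto V atTop (𝓝 0) ∧
          -- the limit `t → +0`
          Tendsto U' (𝓝[>] 0) (𝓝 L) ∧ Tendsto V' (𝓝[>] 0) (𝓝 M) ∧
          ι ψ =
            (∑ lam ∈ hfin.toFinset, ((K / (2 * conj (residueConst K g gc lam)) : ℂ) *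
              conj (pair ψ (μ lam))) • μ lam) +
            (1 / (2 * Real.pi * I) : ℂ) • L +
            (K / (4 * Real.pi * I) : ℂ) • M := by
  obtain ⟨ε, hs⟩ := exists_stripContinuation hA1 hA3 hp
  have hgr : RapidDecay fun ω : ℝ => (g ω : ℂ) := by
    simpa using hs.rapidDecay_real (ExpHolomorphic.one p)
  have han : ∀ lam : ℂ, lam.re = -a → AnalyticAt ℂ gc (-I * lam) := fun lam h => (hline lam h).1
  have hG : ∀ lam : ℂ, lam.re = -a → G K g gc lam ≠ 0 := fun lam h =>
    hs.G_ne_zero_line hK ha hline h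
  have hright : ∀ lam : ℂ, 0 < lam.re → G K g gc lam ≠ 0 := fun lam h =>
    hs.G_ne_zero_of_pos hg.2.1 hA2 hK hKc h
  have hpi : (Real.pi : ℂ) ≠ 0 := by exact_mod_cast Real.pi_ne_zero
  have hfin := hs.finite_resonancePoles hK hap hsimple
  have hν' : ∀ (ψ : Fp p) (lam : ℂ), ∃ ν : FpDual p, -p ≤ lam.re → ∀ φ : Fp p,
      pair φ ν = continuedTransform g gc ε (fun z => φ z * ψ z) lam := by
    intro ψ lam
    by_cases h : -p ≤ lam.re
    · obtain ⟨ν, hν⟩ := hs.exists_psi_mu ψ h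
      exact ⟨ν, fun _ => hν⟩
    · exact ⟨0, fun h' => absurd h' h⟩
  choose ι hι using fun ψ : Fp p => exists_canonicalImage hgr hp.le ψ
  choose μ hμ using fun lam : ℂ => hs.exists_mu lam
  choose ν hν using hν'
  refine ⟨existsUnique_semigroup hgr hp.le K, hfin, ι, μ, ν, hι, fun lam h _ _ => hs.isMu h (hμ lam),
    fun ψ lam h1 h2 _ => hs.isPsiMu ψ h1 h2 (hν ψ lam h1), fun S hS ψ => ?_⟩
  choose U hU using fun t : ℝ≥0 => hs.exists_dual_lineDensity ha hap han ψ (t : ℝ)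
  choose V hV using fun t : ℝ≥0 => hs.exists_dual_lineKernel ha hap han hG ψ (t : ℝ)
  have hiU := hs.integrable_lineDensity ha hap han ψ
  have hiV := hs.integrable_lineKernel ha hap han hG ψ
  have hreline : ∀ y : ℝ, -p ≤ (-(a : ℂ) + I * y).re := fun y => by rw [line_re]; linarith
  have hUint : ∀ t : ℝ≥0, 0 < t → HasWeakIntegral
      (fun y : ℝ => (Complex.exp (-I * y * (t : ℝ)) * 1) • ν ψ (-a + I * y)) (U t) := by
    intro t ht φ
    have := hs.tendsto_integral_mul_line ha hap han φ ψ (t := t) (by exact_mod_cast ht)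
    simp_rw [pair_smul, mul_one, conj_exp_neg_I_mul, hν ψ _ (hreline _), hU]
    exact this
  have hVint : ∀ t : ℝ≥0, HasWeakIntegral (fun y : ℝ => (Complex.exp (-I * y * (t : ℝ)) *
      (1 / conj (G K g gc (-a + I * y)) * conj (pair ψ (μ (-a + I * y))))) •
        μ (-a + I * y)) (V t) := by
    intro t φ
    have e : ∀ y : ℝ, pair φ ((Complex.exp (-I * y * (t : ℝ)) *
        (1 / conj (G K g gc (-a + I * y)) * conj (pair ψ (μ (-a + I * y))))) •
        μ (-a + I * y)) = Complex.exp (I * y * (t : ℝ)) * lineKernel K g gc ε a ψ φ y := by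
      intro y
      rw [pair_smul, map_mul, map_mul, conj_exp_neg_I_mul, map_div₀, map_one, Complex.conj_conj,
        Complex.conj_conj, hμ, hμ, lineKernel]
      ring
    simp_rw [e, hV]
    exact ⟨fun r s => (integrable_exp_I_mul (hiV φ) t).intervalIntegrable,
      tendsto_integral_charTransform (hiV φ) t⟩
  have hdecomp : ∀ t : ℝ≥0, 0 < t → dualOp (S t) (ι ψ) =
      (∑ lam ∈ hfin.toFinset, ((K / (2 * conj (residueConst K g gc lam)) : ℂ) *
        Complex.exp (conj lam * (t : ℝ)) * conj (pair ψ (μ lam))) • μ lam) +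
      (Complex.exp (-a * (t : ℝ)) / (2 * Real.pi) : ℂ) • U t +
      (K * Complex.exp (-a * (t : ℝ)) / (4 * Real.pi) : ℂ) • V t := by
    intro t ht
    refine FpDual.ext fun φ => ?_
    obtain ⟨η, hη, -⟩ := exists_isFeedback hgr hp.le K φ
    rw [pair_dualOp, hι, hs.integral_orbit_decomposition hK ha hap hright hline hsimple hfin
      (by exact_mod_cast ht) hη (hS.isOrbitMap hgr hp.le t φ η hη), pair_add, pair_add, pair_smul,
      pair_smul, pair_sum, hU, hV]
    congr 1
    · congr 1
      · refine Finset.sum_congr rfl fun lam _ => ?_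
        rw [pair_smul, hμ, hμ]
        congr 1
        simp only [map_mul, map_div₀, Complex.conj_conj, ← Complex.exp_conj, conj_ofReal,
          map_ofNat]
      · congr 1
        simp only [map_mul, map_div₀, ← Complex.exp_conj, conj_ofReal, map_ofNat, map_neg]
    · congr 1
      simp only [map_mul, map_div₀, ← Complex.exp_conj, conj_ofReal, map_ofNat, map_neg]
  have hU' : ∀ t : ℝ≥0, (Complex.exp (-a * (t : ℝ)) / (2 * Real.pi) : ℂ) • U t =
      (1 / (2 * Real.pi * I) : ℂ) • ((I * Complex.exp (-a * (t : ℝ))) • U t) := fun t => by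
    rw [smul_smul]
    congr 1
    field_simp
  have hV' : ∀ t : ℝ≥0, (K * Complex.exp (-a * (t : ℝ)) / (4 * Real.pi) : ℂ) • V t =
      (K / (4 * Real.pi * I) : ℂ) • ((I * Complex.exp (-a * (t : ℝ))) • V t) := fun t => by
    rw [smul_smul]
    congr 1
    field_simp
  have hL := tendsto_smul_line hiU (fun φ t => hU t φ) a
  have hM := tendsto_smul_line hiV (fun φ t => hV t φ) a
  refine ⟨U, V, fun t => (I * Complex.exp (-a * (t : ℝ))) • U t,
    fun t => (I * Complex.exp (-a * (t : ℝ))) • V t, I • U 0, I • V 0, fun t ht => ⟨?_, ?_,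
    hdecomp t ht, ?_, ?_, ?_⟩, tendsto_atTop_line fun φ t => hU t φ,
    tendsto_atTop_line fun φ t => hV t φ, hL, hM, ?_⟩
  · simpa only [mul_one] using hUint t ht
  · simpa only [mul_assoc] using hVint t
  · simpa only [mul_one] using (hUint t ht).hasLineIntegral (f := fun _ => 1)
  · simpa only [mul_assoc] using (hVint t).hasLineIntegral
      (f := fun lam => 1 / conj (G K g gc lam) * conj (pair ψ (μ lam)))
  · rw [hdecomp t ht, hU', hV']
  · refine FpDual.ext fun φ => ?_
    have h1 : Tendsto (fun t : ℝ≥0 => pair φ (dualOp (S t) (ι ψ))) (𝓝[>] 0)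
        (𝓝 (pair φ (ι ψ))) := by
      have := ((continuous_pair (ι ψ)).comp (hS.continuous φ)).tendsto' 0 (pair φ (ι ψ))
        (by simp [hS.map_zero])
      exact this.mono_left nhdsWithin_le_nhds
    have h2 : Tendsto (fun t : ℝ≥0 => ∑ lam ∈ hfin.toFinset, pair φ
        (((K / (2 * conj (residueConst K g gc lam)) : ℂ) *
          Complex.exp (conj lam * (t : ℝ)) * conj (pair ψ (μ lam))) • μ lam)) (𝓝[>] 0)
        (𝓝 (∑ lam ∈ hfin.toFinset, pair φ (((K / (2 * conj (residueConst K g gc lam)) : ℂ) *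
          conj (pair ψ (μ lam))) • μ lam))) := by
      refine tendsto_finsetSum _ fun lam _ => ?_
      simp_rw [pair_smul]
      refine Tendsto.mul_const _ ?_
      have hc : Continuous fun t : ℝ≥0 => conj ((K / (2 * conj (residueConst K g gc lam)) : ℂ) *
          Complex.exp (conj lam * (t : ℝ)) * conj (pair ψ (μ lam))) := by fun_prop
      exact (hc.tendsto' 0 _ (by simp)).mono_left nhdsWithin_le_nhds
    have h3 := (tendsto_dual_iff.mp hL φ).const_mul (conj (1 / (2 * Real.pi * I) : ℂ))
    have h4 := (tendsto_dual_iff.mp hM φ).const_mul (conj (K / (4 * Real.pi * I) : ℂ))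
    rw [pair_add, pair_add, pair_sum, pair_smul φ (1 / _), pair_smul φ (K / _)]
    refine tendsto_nhds_unique (h1.congr' ?_) ((h2.add h3).add h4)
    filter_upwards [self_mem_nhdsWithin] with t ht
    rw [hdecomp t ht, hU', hV', pair_add, pair_add, pair_sum, pair_smul φ (1 / _),
      pair_smul φ (K / _)]
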